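/- Let $M$ be a connected closed smooth manifold of dimension $n$, let $0<\tau_0<\tau_1$, and let $g(\tau)$, $\tau\in[\tau_0,\tau_1]$, be a smooth family of Riemannian metrics on $M$ that solves the Ricci flow equation in backward time, $\frac{dg}{d\tau}=2\operatorname{Ric}(g(\tau))$. All geometric quantities at time $\tau$ (the Riemannian density $\operatorname{dvol}_M$, $\nabla$, $\operatorname{Hess}$, $\operatorname{Ric}$, the scalar curvature $R$, norms and inner products) are taken with respect to $g(\tau)$, and $R_\tau=\partial R/\partial\tau$. Let $\rho,\phi\in C^\infty([\tau_0,\tau_1]\times M)$ with $\rho>0$ and $\int_M\rho\,\operatorname{dvol}_M=1$ for every $\tau$, and suppose that $$\frac{\partial\rho}{\partial\tau}=-\nabla^i(\rho\nabla_i\phi)-R\rho,\qquad \frac{\partial\phi}{\partial\tau}=-\frac12|\nabla\phi|^2+\frac12R-\frac1{2\tau}\phi .$$ For a tangent vector $X$ put $$H(X)=-R_\tau-2\langle\nabla R,X\rangle+2\operatorname{Ric}(X,X)-\frac R\tau .$$ Then $\int_M\rho\log(\rho)\operatorname{dvol}_M$ and $\int_M(\rho\log(\rho)+\phi\rho)\operatorname{dvol}_M$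 are twice continuously differentiable functions of $\tau\in[\tau_0,\tau_1]$ (with one-sided derivatives at the end points), all the integrals here and below converge, and for all $\tau\in[\tau_0,\tau_1]$ $$\Big(\tau^{\frac12}\frac{d}{d\tau}\Big)^2\int_M\rho\log(\rho)\,\operatorname{dvol}_M=\tau\int_M\Big(|\operatorname{Ric}+\operatorname{Hess}\phi|^2+\frac12H(\nabla\phi)\Big)\rho\,\operatorname{dvol}_M$$ and $$\Big(\tau^{\frac32}\frac{d}{d\tau}\Big)^2\Big(\int_M(\rho\log(\rho)+\phi\rho)\,\operatorname{dvol}_M+\frac n2\log(\tau)\Big)=\tau^3\int_M\Big|\operatorname{Ric}+\operatorname{Hess}\phi-\frac g{2\tau}\Big|^2\rho\,\operatorname{dvol}_M .$$ In particular, $\int_M(\rho\log(\rho)+\phi\rho)\,\operatorname{dvol}_M+\frac n2\log(\tau)$ is a convex function of $s=\tau^{-\frac12}\in[\tau_1^{-\frac12},\tau_0^{-\frac12}]$. -/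

import Mathlib

open Set MeasureTheory Bundle
open scoped Manifold ContDiff

noncomputable section

namespace LMinus

/-- The model space `ℝⁿ`. -/
abbrev E (n : ℕ) : Type := EuclideanSpace ℝ (Fin n)

/-! ### Riemannian geometry in a coordinate domain of `ℝⁿ` -/

section Coordinates

variable {n : ℕ}

/-- The partial derivative `∂ᵢ f` at `y`. -/
def pd (i : Fin n) (f : E n → ℝ) (y : E n) : ℝ :=
  fderiv ℝ f y (EuclideanSpace.single i 1)

/-- The Christoffel symbol `Γᵏᵢⱼ` of the metric with coefficient matrix `G`. -/
def christoffel (G : E n → Matrix (Fin n) (Fin n) ℝ) (k i j : Fin n) (y : E n) : ℝ :=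
  (1 / 2) * ∑ l, (G y)⁻¹ k l *
    (pd i (fun z => G z j l) y + pd j (fun z => G z i l) y - pd l (fun z => G z i j) y)

/-- The component `Ricᵢⱼ` of the Ricci tensor of the metric with coefficient matrix `G`. -/
def ricciCoord (G : E n → Matrix (Fin n) (Fin n) ℝ) (i j : Fin n) (y : E n) : ℝ :=
  ∑ k, (pd k (christoffel G k i j) y - pd j (christoffel G k i k) y) +
    ∑ k, ∑ l, (christoffel G k k l y * christoffel G l i j y -
      christoffel G k j l y * christoffel G l i k y)

/-- The component `(∇α)ᵢⱼ = ∂ᵢ αⱼ - Γᵏᵢⱼ αₖ` of the covariant derivative of the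
one-form `α`. -/
def covDerivCoord (G : E n → Matrix (Fin n) (Fin n) ℝ) (α : Fin n → E n → ℝ)
    (i j : Fin n) (y : E n) : ℝ :=
  pd i (α j) y - ∑ k, christoffel G k i j y * α k y

end Coordinates

/-! ### Riemannian geometry on a manifold -/

section Manifold

variable {n : ℕ} {M : Type*} [TopologicalSpace M] [ChartedSpace (E n) M]
  [IsManifold (𝓡 n) ∞ M]

variable (n M) in
/-- Smooth Riemannian metrics on `M`. -/
abbrev Metric : Type _ :=
  ContMDiffRiemannianMetric (𝓡 n) ∞ (E n) (fun x : M => TangentSpace (𝓡 n) x)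

/-- The coordinate vector field `∂ᵢ` of the chart at `x₀`, at the point with coordinates `y`. -/
def coordVec (x₀ : M) (y : E n) (i : Fin n) :
    TangentSpace (𝓡 n) ((extChartAt (𝓡 n) x₀).symm y) :=
  mfderiv 𝓘(ℝ, E n) (𝓡 n) (extChartAt (𝓡 n) x₀).symm y
    (EuclideanSpace.single i (1 : ℝ) : E n)

/-- The component `dxⁱ(v)` of the tangent vector `v` in the chart at `x`. -/
def coords (x : M) (v : TangentSpace (𝓡 n) x) (i : Fin n) : ℝ :=
  let u : E n := mfderiv (𝓡 n) 𝓘(ℝ, E n) (extChartAt (𝓡 n) x) x v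
  u i

/-- The coefficient matrix of the metric in the chart at `x₀`. -/
def chartMetric (g : Metric n M) (x₀ : M) (y : E n) : Matrix (Fin n) (Fin n) ℝ :=
  Matrix.of fun i j =>
    g.inner ((extChartAt (𝓡 n) x₀).symm y) (coordVec x₀ y i) (coordVec x₀ y j)

/-- A basis of `T_x M` (which is a copy of `ℝⁿ`). -/
def frame (x : M) (i : Fin n) : TangentSpace (𝓡 n) x :=
  (EuclideanSpace.single i (1 : ℝ) : E n)

/-- The Gram matrix of the metric at `x` in the basis `frame x`. -/
def gram (g : Metric n M) (x : M) : Matrix (Fin n) (Fin n) ℝ :=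
  Matrix.of fun i j => g.inner x (frame x i) (frame x j)

/-- The metric trace `g^{ij} Bᵢⱼ` of a bilinear form `B` on `T_x M`. -/
def trace (g : Metric n M) (x : M)
    (B : TangentSpace (𝓡 n) x → TangentSpace (𝓡 n) x → ℝ) : ℝ :=
  ∑ i, ∑ j, (gram g x)⁻¹ i j * B (frame x i) (frame x j)

/-- The squared norm `g^{ia} g^{jb} Bᵢⱼ B_{ab}` of a bilinear form `B` on `T_x M`. -/
def normSq (g : Metric n M) (x : M)
    (B : TangentSpace (𝓡 n) x → TangentSpace (𝓡 n) x → ℝ) : ℝ :=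
  ∑ i, ∑ j, ∑ a, ∑ b, (gram g x)⁻¹ i a * (gram g x)⁻¹ j b *
    B (frame x i) (frame x j) * B (frame x a) (frame x b)

/-- The Ricci tensor. -/
def Ric (g : Metric n M) (x : M) (v w : TangentSpace (𝓡 n) x) : ℝ :=
  ∑ i, ∑ j, ricciCoord (chartMetric g x) i j (extChartAt (𝓡 n) x x) * coords x v i * coords x w j

/-- The scalar curvature. -/
def scal (g : Metric n M) (x : M) : ℝ := trace g x (Ric g x)

/-- The differential `df` of a function. -/
def dif (f : M → ℝ) (x : M) (v : TangentSpace (𝓡 n) x) : ℝ :=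
  mfderiv (𝓡 n) 𝓘(ℝ, ℝ) f x v

/-- The gradient `∇f` of a function. -/
def grad (g : Metric n M) (f : M → ℝ) (x : M) : TangentSpace (𝓡 n) x :=
  ∑ i, (∑ j, (gram g x)⁻¹ i j * dif f x (frame x j)) • frame x i

/-- The covariant derivative `∇α` of a one-form `α`, as a bilinear form:
`covDeriv g α x v w = (∇_v α)(w)`. -/
def covDeriv (g : Metric n M) (α : (x : M) → TangentSpace (𝓡 n) x → ℝ) (x : M)
    (v w : TangentSpace (𝓡 n) x) : ℝ :=
  ∑ i, ∑ j, covDerivCoord (chartMetric g x)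
    (fun k y => α ((extChartAt (𝓡 n) x).symm y) (coordVec x y k)) i j (extChartAt (𝓡 n) x x) *
      coords x v i * coords x w j

/-- The Hessian `Hess f = ∇ df`. -/
def Hess (g : Metric n M) (f : M → ℝ) (x : M) (v w : TangentSpace (𝓡 n) x) : ℝ :=
  covDeriv g (dif f) x v w

/-- The expression `∇ⁱ (ρ ∇ᵢ φ)`. -/
def divGrad (g : Metric n M) (ρ φ : M → ℝ) (x : M) : ℝ :=
  trace g x (covDeriv g (fun z v => ρ z * dif φ z v) x)

variable (n M) in
/-- A smooth partition of unity subordinate to the chart domains of `M`. -/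
def chartPartition [T2Space M] [SigmaCompactSpace M] :
    SmoothPartitionOfUnity M (𝓡 n) M univ :=
  (SmoothPartitionOfUnity.exists_isSubordinate_chartAt_source (𝓡 n) M).choose

/-- The Riemannian measure `dvol`: in each chart it is `√(det gᵢⱼ) dy`, and the charts are patched
together by a partition of unity. -/
def dvol [T2Space M] [SigmaCompactSpace M] [MeasurableSpace M] (g : Metric n M) :
    Measure M :=
  Measure.sum fun x₀ : M =>
    ((volume.restrict (extChartAt (𝓡 n) x₀).target).withDensity fun y =>
      ENNReal.ofReal (chartPartition n M x₀ ((extChartAt (𝓡 n) x₀).symm y) *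
        √(chartMetric g x₀ y).det)).map (extChartAt (𝓡 n) x₀).symm

/-! ### Ricci flow, in backward time `τ` -/

/-- `g` is a smooth family of metrics, parametrized by `τ ∈ S`, that satisfies `dg/dτ = 2 Ric`. -/
structure IsBackwardRicciFlow (g : ℝ → Metric n M) (S : Set ℝ) : Prop where
  smooth : ContMDiffOn (𝓘(ℝ, ℝ).prod (𝓡 n)) ((𝓡 n).prod 𝓘(ℝ, E n →L[ℝ] E n →L[ℝ] ℝ)) ∞
    (fun p : ℝ × M => TotalSpace.mk' (E n →L[ℝ] E n →L[ℝ] ℝ)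
      (E := fun x : M => TangentSpace (𝓡 n) x →L[ℝ] TangentSpace (𝓡 n) x →L[ℝ] ℝ)
      p.2 ((g p.1).inner p.2)) (S ×ˢ univ)
  flow : ∀ τ ∈ S, ∀ (x : M) (v w : TangentSpace (𝓡 n) x),
    HasDerivWithinAt (fun s => (g s).inner x v w) (2 * Ric (g τ) x v w) S τ

/-- `f(τ, x)` is smooth for `τ ∈ S` and `x ∈ M`. -/
def IsSmoothFamily (n : ℕ) {M : Type*} [TopologicalSpace M] [ChartedSpace (E n) M]
    (f : ℝ → M → ℝ) (S : Set ℝ) : Prop :=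
  ContMDiffOn (𝓘(ℝ, ℝ).prod (𝓡 n)) 𝓘(ℝ, ℝ) ∞ (fun p : ℝ × M => f p.1 p.2) (S ×ˢ univ)

/-- The transport equation `∂ρ/∂τ = - ∇ⁱ(ρ ∇ᵢ φ) - R ρ`. -/
def TransportEq (g : ℝ → Metric n M) (ρ φ : ℝ → M → ℝ) (S : Set ℝ) : Prop :=
  ∀ τ ∈ S, ∀ x : M, HasDerivWithinAt (fun s => ρ s x)
    (-divGrad (g τ) (ρ τ) (φ τ) x - scal (g τ) x * ρ τ x) S τ

/-- The Hamilton-Jacobi equation `∂φ/∂τ = - ½ |∇φ|² + ½ R - φ / (2τ)`. -/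
def HamiltonJacobiEq (g : ℝ → Metric n M) (φ : ℝ → M → ℝ) (S : Set ℝ) : Prop :=
  ∀ τ ∈ S, ∀ x : M, HasDerivWithinAt (fun s => φ s x)
    (-(1 / 2) * (g τ).inner x (grad (g τ) (φ τ) x) (grad (g τ) (φ τ) x)
      + (1 / 2) * scal (g τ) x - 1 / (2 * τ) * φ τ x) S τ

/-- Hamilton's trace Harnack expression
`H(X) = - R_τ - 2 ⟨∇R, X⟩ + 2 Ric(X, X) - R / τ` at time `τ` and at the point `x`. -/
def harnack (g : ℝ → Metric n M) (S : Set ℝ) (τ : ℝ) (x : M) (X : TangentSpace (𝓡 n) x) : ℝ :=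
  -derivWithin (fun s => scal (g s) x) S τ
    - 2 * (g τ).inner x (grad (g τ) (scal (g τ)) x) X
    + 2 * Ric (g τ) x X X - scal (g τ) x / τ

/-- The entropy `∫ ρ log ρ dvol` at time `τ`. -/
def entropy [T2Space M] [SigmaCompactSpace M] [MeasurableSpace M]
    (g : ℝ → Metric n M) (ρ : ℝ → M → ℝ) (τ : ℝ) : ℝ :=
  ∫ x, ρ τ x * Real.log (ρ τ x) ∂dvol (g τ)

/-- The quantity `∫ (ρ log ρ + φ ρ) dvol + (n/2) log τ` at time `τ`. -/
def modEntropy [T2Space M] [SigmaCompactSpace M] [MeasurableSpace M]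
    (g : ℝ → Metric n M) (ρ φ : ℝ → M → ℝ) (τ : ℝ) : ℝ :=
  (∫ x, (ρ τ x * Real.log (ρ τ x) + φ τ x * ρ τ x) ∂dvol (g τ)) + (n : ℝ) / 2 * Real.log τ

end Manifold

/-- The operator `τ^a d/dτ`, acting on functions of `τ ∈ S`. -/
def scaledDeriv (a : ℝ) (S : Set ℝ) (F : ℝ → ℝ) (τ : ℝ) : ℝ := τ ^ a * derivWithin F S τ

end LMinus

end

/-! Write D f = ∂f/∂τ + ⟨∇f, ∇φ⟩ for the derivative of f along the flow lines of ∇φ (`flowDeriv`).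
The transport equation says that these flow lines carry the measure ρ dvol: under the flow the
volume form grows at rate R, which cancels the term -Rρ, and the divergence integrates to zero.
Hence d/dτ ∫ f ρ dvol = ∫ (D f) ρ dvol for every smooth f (`hasDerivWithinAt_weightedIntegral`), and
both formulas reduce to pointwise computations of D.

Put L = Δφ + R, e = ½(|∇φ|² + R) and Z = ½R_τ + ⟨∇R, ∇φ⟩ - Ric(∇φ, ∇φ). Then D log ρ = -L, D φ = e -
φ/(2τ), D L = -|Ric + Hess φ|² + Z - Δφ/(2τ), D e = Z - |∇φ|²/(2τ). The third identity is the heart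
of the matter. It combines Bochner's formula with the evolution equations of the Laplacian and of
the scalar curvature under the flow (`bochner`, `time_laplacian`, `time_scal`), both of which rest
on the contracted Bianchi identity.

Since (τ^a d/dτ)² F = τ^(2a) (F'' + (a/τ) F'), the exponent 1/2 leaves |Ric + Hess φ|² - Z - R/(2τ),
and -Z - R/(2τ) is half of the Harnack expression. With the exponent 3/2 and the added term φρ, Z
cancels between D L and D e, the multiples of φ cancel too, and what remains is |Ric + Hess φ|² -
L/τ + n/(4τ²). This is a complete square, because L is the trace of Ric + Hess φ. Convexity follows
since d/ds = -2 τ^(3/2) d/dτ for s = τ^(-1/2).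

All tensor identities are proved as pure algebra over a commutative ring with commuting derivations
(`IsMetric`, `IsFlow`). The ring used is that of functions on [τ₀, τ₁] × U smooth up to the end
times (`smoothRing`). The tensors of the statement are defined at a point x through the chart at x,
whereas identities and integrals need one fixed chart; the transformation laws (`IsChange`) together
with `eq_ev_of_center` bridge this gap. The divergence theorem and differentiation under the
integral are done in charts and glued by a partition of unity. -/

noncomputable section

/-! ### Riemannian geometry over a commutative ring with commuting derivations -/

namespace CoordGeom

open scoped Matrix

/-! ### Derivations applied to matrices, and the derivative of a determinant. -/

section MatrixDerivation

set_option linter.unusedSectionVars false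

variable {ι A : Type*} [Fintype ι] [CommRing A] [Algebra ℝ A]

/-- Entrywise application of a derivation to a matrix. -/
def dm (d : Derivation ℝ A A) (X : Matrix ι ι A) : Matrix ι ι A := X.map d

variable (d e : Derivation ℝ A A) (X Y : Matrix ι ι A)

theorem dm_apply (i j : ι) : dm d X i j = d (X i j) := rfl

theorem dm_add : dm d (X + Y) = dm d X + dm d Y := by ext; simp [dm]

theorem dm_sub : dm d (X - Y) = dm d X - dm d Y := by ext; simp [dm]

theorem dm_transpose : dm d Xᵀ = (dm d X)ᵀ := by ext; simp [dm]

theorem dm_mul : dm d (X * Y) = dm d X * Y + X * dm d Y := by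
  ext a b
  simp only [dm, Matrix.map_apply, Matrix.mul_apply, map_sum, Derivation.leibniz, smul_eq_mul,
    Matrix.add_apply, ← Finset.sum_add_distrib]
  exact Finset.sum_congr rfl fun k _ => by ring

theorem dm_one [DecidableEq ι] : dm d (1 : Matrix ι ι A) = 0 := by
  ext a b
  by_cases h : a = b <;> simp [dm, h]

theorem map_trace : d X.trace = (dm d X).trace := by
  simp [Matrix.trace, dm]

theorem dm_comm (h : ∀ a, d (e a) = e (d a)) : dm d (dm e X) = dm e (dm d X) := by
  ext; simp [dm, h]

theorem dm_inv [DecidableEq ι] {G H : Matrix ι ι A} (hGH : G * H = 1) :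
    dm d H = -(H * dm d G * H) := by
  have hHG : H * G = 1 := mul_eq_one_comm.1 hGH
  have h := congrArg (dm d) hGH
  rw [dm_mul, dm_one] at h
  have h2 : H * (dm d G * H + G * dm d H) = 0 := by rw [h, Matrix.mul_zero]
  rw [Matrix.mul_add, ← Matrix.mul_assoc, ← Matrix.mul_assoc, hHG, Matrix.one_mul] at h2
  exact eq_neg_of_add_eq_zero_right h2

theorem derivation_prod {κ : Type*} [DecidableEq κ] (s : Finset κ) (f : κ → A) :
    d (∏ i ∈ s, f i) = ∑ i ∈ s, (∏ j ∈ s.erase i, f j) * d (f i) := by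
  induction s using Finset.induction_on with
  | empty => simp
  | insert a s ha ih =>
    rw [Finset.prod_insert ha, Derivation.leibniz, ih, Finset.sum_insert ha,
      Finset.erase_insert ha, smul_eq_mul, smul_eq_mul, Finset.mul_sum, add_comm]
    congr 1
    refine Finset.sum_congr rfl fun i hi => ?_
    have hia : a ≠ i := fun h => ha (h ▸ hi)
    rw [Finset.erase_insert_of_ne hia, Finset.prod_insert (fun h => ha (Finset.mem_of_mem_erase h)),
      mul_assoc]

/-- Jacobi's formula. -/
theorem map_det [DecidableEq ι] {G H : Matrix ι ι A} (hGH : G * H = 1) :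
    d G.det = G.det * (H * dm d G).trace := by
  -- The product rule in the Leibniz expansion differentiates one column at a time. Cramer's rule
  -- then expands along the changed column, and the adjugate equals `G.det • H`.
  have key : d G.det = ∑ i, (G.updateCol i fun k => d (G k i)).det := by
    simp only [Matrix.det_apply, map_sum]
    rw [Finset.sum_comm]
    refine Finset.sum_congr rfl fun σ _ => ?_
    rw [Units.smul_def, map_zsmul, derivation_prod, Finset.smul_sum]
    refine Finset.sum_congr rfl fun i _ => ?_
    rw [Units.smul_def, ← Finset.mul_prod_erase _ _ (Finset.mem_univ i), Matrix.updateCol_self,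
      mul_comm]
    congr 1
    congr 1
    refine Finset.prod_congr rfl fun j hj => ?_
    rw [Matrix.updateCol_ne (Finset.ne_of_mem_erase hj)]
  have hadj : G.adjugate = G.det • H := by
    have h := congrArg (fun X => G.adjugate * X) hGH
    simp only [← Matrix.mul_assoc, Matrix.adjugate_mul, Matrix.mul_one] at h
    rw [← h]; simp
  rw [key]
  have h2 : ∀ i, (G.updateCol i fun k => d (G k i)).det = ∑ k, G.adjugate i k * d (G k i) := by
    intro i
    rw [← Matrix.cramer_apply, Matrix.cramer_eq_adjugate_mulVec]
    rfl
  simp only [h2, hadj, Matrix.trace, Matrix.diag, Matrix.mul_apply, Finset.mul_sum, dm_apply,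
    Matrix.smul_apply, smul_eq_mul, mul_assoc]

end MatrixDerivation

end CoordGeom

/-! ### The Levi-Civita connection, its curvature and the second Bianchi identity. -/

namespace CoordGeom

open scoped Matrix

section Geometry

variable {ι A : Type*} [Fintype ι] [CommRing A] [Algebra ℝ A]
  (D : ι → Derivation ℝ A A) (G H : Matrix ι ι A)

/-- The Christoffel symbol `Γᵏᵢⱼ` of the metric `G` with inverse `H`. -/
def chr (k i j : ι) : A :=
  algebraMap ℝ A (1 / 2) * ∑ l, H k l * (D i (G j l) + D j (G i l) - D l (G i j))

/-- The connection matrix in the direction `i`. -/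
def conn (i : ι) : Matrix ι ι A := Matrix.of fun k j => chr D G H k i j

/-- The curvature matrix of the connection in the directions `i` and `j`. -/
def curv (i j : ι) : Matrix ι ι A :=
  dm (D i) (conn D G H j) - dm (D j) (conn D G H i) +
    conn D G H i * conn D G H j - conn D G H j * conn D G H i

/-- The Ricci tensor. -/
def ric : Matrix ι ι A := Matrix.of fun i j =>
  ∑ k, (D k (chr D G H k i j) - D j (chr D G H k i k)) +
    ∑ k, ∑ l, (chr D G H k k l * chr D G H l i j - chr D G H k j l * chr D G H l i k)

/-- The scalar curvature. -/
def scal : A := (H * ric D G H).trace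

/-- The contracted Christoffel symbol `Γᵏₖᵢ`. -/
def cst (i : ι) : A := ∑ k, chr D G H k k i

/-- The divergence of a vector field. -/
def dv (X : ι → A) : A := ∑ i, (D i (X i) + cst D G H i * X i)

/-- The component `(∇ᵢ X)ᵏ` of the covariant derivative of a vector field. -/
def cov (X : ι → A) (i k : ι) : A := D i (X k) + ∑ j, chr D G H k i j * X j

/-- The gradient of a function. -/
def gradient (u : A) (i : ι) : A := ∑ j, H i j * D j u

/-- The inner product of two gradients. -/
def innerGrad (u v : A) : A := ∑ i, ∑ j, H i j * (D i u * D j v)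

/-- The components `∂ᵢ αⱼ - Γᵏᵢⱼ αₖ` of the covariant derivative of a one-form. -/
def covForm (α : ι → A) : Matrix ι ι A :=
  Matrix.of fun i j => D i (α j) - ∑ k, chr D G H k i j * α k

/-- The Hessian of a function. -/
def hess (u : A) : Matrix ι ι A := covForm D G H fun k => D k u

/-- The expression `∇ⁱ (a ∇ᵢ u)`. -/
def dvGrad (a u : A) : A := (H * (covForm D G H fun k => a * D k u)ᵀ).trace

/-- The divergence of a mixed tensor `Mⁱⱼ` on its upper index. -/
def dvMixed (M : Matrix ι ι A) (j : ι) : A :=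
  ∑ i, (D i (M i j) + cst D G H i * M i j - ∑ k, chr D G H k i j * M i k)

/-- `G` is a symmetric matrix with inverse `H`, and the derivations commute. -/
structure IsMetric [DecidableEq ι] : Prop where
  comm : ∀ i j a, D i (D j a) = D j (D i a)
  symm : ∀ i j, G i j = G j i
  inv : G * H = 1

variable {D G H}

/-- In an abstract ℝ-algebra one half is only available as an image of `algebraMap`; this relation
is fed to `linear_combination` whenever a factor 2 has to be cancelled. -/
theorem half_mul_two (A : Type*) [CommRing A] [Algebra ℝ A] :
    algebraMap ℝ A (1 / 2) * 2 = 1 := by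
  rw [← map_ofNat (algebraMap ℝ A) 2, ← map_mul]; norm_num

theorem eq_zero_of_eq_neg {a : A} (h : a = -a) : a = 0 := by
  linear_combination (-a) * half_mul_two A + algebraMap ℝ A (1 / 2) * h

theorem curv_swap (i j : ι) :
    curv D G H j i = -curv D G H i j := by
  unfold curv; abel

namespace IsMetric

variable [DecidableEq ι] (h : IsMetric D G H)
include h

theorem inv' : H * G = 1 := mul_eq_one_comm.1 h.inv

theorem transpose_eq : Gᵀ = G := by ext i j; exact h.symm j i

theorem transpose_inv : Hᵀ = H := by
  have h1 : Hᵀ * G = 1 := by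
    have := congrArg Matrix.transpose h.inv
    rwa [Matrix.transpose_mul, h.transpose_eq, Matrix.transpose_one] at this
  calc Hᵀ = Hᵀ * (G * H) := by rw [h.inv, Matrix.mul_one]
    _ = H := by rw [← Matrix.mul_assoc, h1, Matrix.one_mul]

theorem symm_inv (i j : ι) : H i j = H j i := congrFun (congrFun h.transpose_inv j) i

theorem chr_symm (k i j : ι) : chr D G H k i j = chr D G H k j i := by
  unfold chr
  congr 1
  refine Finset.sum_congr rfl fun l _ => ?_
  rw [h.symm i j]; ring

/-- Lowering the upper index removes the inverse metric and gives the Christoffel symbols of the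
first kind. -/
theorem mul_conn (a i b : ι) : (G * conn D G H i) a b =
    algebraMap ℝ A (1 / 2) * (D i (G b a) + D b (G i a) - D a (G i b)) := by
  have : ∀ k, G a k * conn D G H i k b = algebraMap ℝ A (1 / 2) *
      ∑ l, (G a k * H k l) * (D i (G b l) + D b (G i l) - D l (G i b)) := by
    intro k
    simp only [conn, Matrix.of_apply, chr, Finset.mul_sum]
    exact Finset.sum_congr rfl fun l _ => by ring
  rw [Matrix.mul_apply]
  simp only [this]
  rw [← Finset.mul_sum, Finset.sum_comm]
  congr 1
  have h2 : ∀ l, ∑ k, G a k * H k l * (D i (G b l) + D b (G i l) - D l (G i b)) =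
      (1 : Matrix ι ι A) a l * (D i (G b l) + D b (G i l) - D l (G i b)) := by
    intro l
    rw [← Finset.sum_mul, ← Matrix.mul_apply, h.inv]
  simp only [h2, Matrix.one_apply, ite_mul, one_mul, zero_mul, Finset.sum_ite_eq,
    Finset.mem_univ, if_true]

/-- Metric compatibility: in the sum of the first-kind symbols with `a` and `b` exchanged, all
derivatives cancel except two copies of `D i (G a b)`. -/
theorem dm_metric (i : ι) : dm (D i) G = G * conn D G H i + (conn D G H i)ᵀ * G := by
  have h1 : (conn D G H i)ᵀ * G = (G * conn D G H i)ᵀ := by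
    rw [Matrix.transpose_mul, h.transpose_eq]
  ext a b
  rw [h1, Matrix.add_apply, Matrix.transpose_apply, h.mul_conn, h.mul_conn, dm_apply,
    h.symm b a]
  linear_combination (-D i (G a b)) * half_mul_two A

/-- Uniqueness of the Levi-Civita connection. -/
theorem conn_unique (C : ι → Matrix ι ι A) (hC : ∀ k i j, C i k j = C j k i)
    (hG : ∀ i, dm (D i) G = G * C i + (C i)ᵀ * G) (i : ι) : conn D G H i = C i := by
  have hD : ∀ i a b, D i (G a b) = (G * C i) a b + (G * C i) b a := by
    intro i a b
    have h1 : (C i)ᵀ * G = (G * C i)ᵀ := by rw [Matrix.transpose_mul, h.transpose_eq]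
    have := congrFun (congrFun (hG i) a) b
    rwa [dm_apply, h1] at this
  have hs : ∀ i a b, (G * C i) a b = (G * C b) a i := by
    intro i a b
    simp only [Matrix.mul_apply, hC _ i b]
  -- The Koszul computation: compatibility turns the three derivatives of the metric into six terms,
  -- and symmetry of `C` cancels four of them.
  have h2 : G * conn D G H i = G * C i := by
    ext a b
    rw [h.mul_conn, hD, hD, hD, hs b a i, hs b i a, hs a i b, hs a b i]
    linear_combination (G * C i) a b * half_mul_two A
  calc conn D G H i = (H * G) * conn D G H i := by rw [h.inv', Matrix.one_mul]
    _ = (H * G) * C i := by rw [Matrix.mul_assoc, h2, Matrix.mul_assoc]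
    _ = C i := by rw [h.inv', Matrix.one_mul]

theorem dm_inverse (i : ι) :
    dm (D i) H = -(conn D G H i * H + H * (conn D G H i)ᵀ) := by
  rw [dm_inv (D i) h.inv, h.dm_metric, Matrix.mul_add, Matrix.add_mul, ← Matrix.mul_assoc,
    h.inv', Matrix.one_mul, Matrix.mul_assoc H (_ * G) H, Matrix.mul_assoc _ G H, h.inv,
    Matrix.mul_one]

theorem ric_eq (i j : ι) : ric D G H i j = ∑ k, curv D G H k j k i := by
  simp only [ric, curv, Matrix.of_apply, Matrix.sub_apply, Matrix.add_apply, Matrix.mul_apply,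
    dm_apply, conn, Finset.sum_sub_distrib, Finset.sum_add_distrib]
  simp only [h.chr_symm _ i]
  ring

theorem dm_dm (i j : ι) (X : Matrix ι ι A) : dm (D i) (dm (D j) X) = dm (D j) (dm (D i) X) :=
  dm_comm _ _ _ (h.comm i j)

/-- The mixed second derivatives of `G` agree. Expanding both by metric compatibility, the
difference is exactly the lowered curvature plus its transpose. -/
theorem curv_skew (i j : ι) : G * curv D G H i j + (curv D G H i j)ᵀ * G = 0 := by
  have e1 := congrArg (dm (D i)) (h.dm_metric j)
  have e2 := congrArg (dm (D j)) (h.dm_metric i)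
  rw [h.dm_dm i j, e2] at e1
  simp only [dm_add, dm_mul, h.dm_metric, dm_transpose] at e1
  simp only [curv, Matrix.transpose_add, Matrix.transpose_sub, Matrix.transpose_mul]
  rw [← sub_eq_zero] at e1
  rw [← neg_eq_zero, ← e1]
  noncomm_ring

/-- The second Bianchi identity. -/
theorem bianchi (i j k : ι) :
    (dm (D i) (curv D G H j k) + conn D G H i * curv D G H j k
        - curv D G H j k * conn D G H i) +
      (dm (D j) (curv D G H k i) + conn D G H j * curv D G H k i
        - curv D G H k i * conn D G H j) +
      (dm (D k) (curv D G H i j) + conn D G H k * curv D G H i j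
        - curv D G H i j * conn D G H k) = 0 := by
  simp only [curv, dm_add, dm_sub, dm_mul]
  rw [h.dm_dm j i, h.dm_dm k i, h.dm_dm k j]
  noncomm_ring

end IsMetric

end Geometry

end CoordGeom

/-! ### Divergences, the contracted Bianchi identity and the contracted Ricci identity. -/

namespace CoordGeom

open scoped Matrix

variable {ι A : Type*} [Fintype ι] [CommRing A] [Algebra ℝ A]
  {D : ι → Derivation ℝ A A} {G H : Matrix ι ι A}

/-- The product rule for contracting a tensor with a vector field: the connection terms acting on
the contracted index cancel between the two summands. -/
theorem dv_mixed (M : Matrix ι ι A) (X : ι → A) :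
    dv D G H (fun i => ∑ j, M i j * X j) =
      ∑ j, dvMixed D G H M j * X j + ∑ i, ∑ k, M i k * cov D G H X i k := by
  have h1 : ∀ i, D i (∑ j, M i j * X j) + cst D G H i * ∑ j, M i j * X j =
      ∑ j, ((D i (M i j) + cst D G H i * M i j) * X j + M i j * D i (X j)) := by
    intro i
    rw [map_sum, Finset.mul_sum, ← Finset.sum_add_distrib]
    refine Finset.sum_congr rfl fun j _ => ?_
    simp only [Derivation.leibniz, smul_eq_mul]; ring
  have h2 : ∑ i, ∑ k, M i k * ∑ j, chr D G H k i j * X j =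
      ∑ i, ∑ j, (∑ k, chr D G H k i j * M i k) * X j := by
    refine Finset.sum_congr rfl fun i _ => ?_
    simp only [Finset.mul_sum, Finset.sum_mul]
    rw [Finset.sum_comm]
    exact Finset.sum_congr rfl fun j _ => Finset.sum_congr rfl fun k _ => by ring
  unfold dv dvMixed cov
  have h3 : ∀ j, (∑ i, (D i (M i j) + cst D G H i * M i j - ∑ k, chr D G H k i j * M i k)) * X j =
      ∑ i, (D i (M i j) + cst D G H i * M i j - ∑ k, chr D G H k i j * M i k) * X j :=
    fun j => Finset.sum_mul _ _ _
  simp only [h1, h3, mul_add, Finset.sum_add_distrib, h2]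
  rw [Finset.sum_comm (f := fun j i => (D i (M i j) + cst D G H i * M i j -
    ∑ k, chr D G H k i j * M i k) * X j)]
  simp only [sub_mul, Finset.sum_sub_distrib]
  ring

theorem dv_add (X Y : ι → A) : dv D G H (fun i => X i + Y i) = dv D G H X + dv D G H Y := by
  simp only [dv, map_add, mul_add, ← Finset.sum_add_distrib]
  exact Finset.sum_congr rfl fun i _ => by ring

theorem dv_mul_const {c : A} (hc : ∀ i, D i c = 0) (X : ι → A) :
    dv D G H (fun i => c * X i) = c * dv D G H X := by
  simp only [dv, Derivation.leibniz, hc, Finset.mul_sum, smul_eq_mul]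
  exact Finset.sum_congr rfl fun i _ => by ring

theorem dv_eq (X : ι → A) : dv D G H X = ∑ i, cov D G H X i i := by
  unfold dv cov cst
  simp only [Finset.sum_add_distrib, Finset.sum_mul]
  rw [Finset.sum_comm]

namespace IsMetric

variable [DecidableEq ι] (h : IsMetric D G H)
include h

theorem cst_eq_trace (i : ι) : cst D G H i = (conn D G H i).trace :=
  Finset.sum_congr rfl fun k _ => h.chr_symm k k i

theorem curv_mul_inv_skew (i j : ι) :
    (curv D G H i j * H)ᵀ = -(curv D G H i j * H) := by
  have h1 := h.curv_skew i j
  have h2 : H * (G * curv D G H i j + (curv D G H i j)ᵀ * G) * H = 0 := by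
    rw [h1, Matrix.mul_zero, Matrix.zero_mul]
  rw [Matrix.mul_add, Matrix.add_mul, ← Matrix.mul_assoc, h.inv', Matrix.one_mul,
    ← Matrix.mul_assoc, Matrix.mul_assoc _ G H, h.inv, Matrix.mul_one] at h2
  rw [Matrix.transpose_mul, h.transpose_inv]
  exact eq_neg_of_add_eq_zero_right h2

/-- Raising an index commutes with covariant differentiation, since `dm_inverse` says that the
inverse metric is parallel. With both matrix indices raised, the curvature can be traced twice
directly. -/
theorem bianchi_raised (i j k : ι) :
    (dm (D i) (curv D G H j k * H) + conn D G H i * (curv D G H j k * H)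
        + (curv D G H j k * H) * (conn D G H i)ᵀ) +
      (dm (D j) (curv D G H k i * H) + conn D G H j * (curv D G H k i * H)
        + (curv D G H k i * H) * (conn D G H j)ᵀ) +
      (dm (D k) (curv D G H i j * H) + conn D G H k * (curv D G H i j * H)
        + (curv D G H i j * H) * (conn D G H k)ᵀ) = 0 := by
  have h1 := congrArg (· * H) (h.bianchi i j k)
  simp only [Matrix.zero_mul] at h1
  rw [← h1]
  simp only [dm_mul, h.dm_inverse]
  noncomm_ring

theorem ric_mixed (p j : ι) :
    ((ric D G H)ᵀ * H) j p = ∑ k, (curv D G H k j * H) k p := by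
  simp only [Matrix.mul_apply, Matrix.transpose_apply, h.ric_eq, Finset.sum_mul]
  exact Finset.sum_comm

/-- The contracted second Bianchi identity. -/
theorem dvMixed_ric (hr : ∀ i j, ric D G H i j = ric D G H j i) (i : ι) :
    2 * dvMixed D G H (H * ric D G H) i = D i (scal D G H) := by
  set W : ι → ι → Matrix ι ι A := fun j k => curv D G H j k * H with hW
  set M := H * ric D G H with hM
  have hrT : (ric D G H)ᵀ = ric D G H := by ext a b; exact hr b a
  have hMW : ∀ p j, ∑ k, W k j k p = M p j := by
    intro p j
    have h1 : M = ((ric D G H)ᵀ * H)ᵀ := by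
      rw [Matrix.transpose_mul, h.transpose_inv, Matrix.transpose_transpose]
    rw [h1, Matrix.transpose_apply, h.ric_mixed]
  have s1 : ∀ j k a b, W j k a b = -W j k b a := by
    intro j k a b
    have := congrFun (congrFun (h.curv_mul_inv_skew j k) b) a
    simpa using this
  have s2 : ∀ j k a b, W j k a b = -W k j a b := by
    intro j k a b
    simp only [hW, curv_swap k j, Matrix.neg_mul, Matrix.neg_apply]
  have s3 : ∀ j k a b, W j k a b = W k j b a := by
    intro j k a b
    rw [s1, s2, neg_neg]
  set T : ι → ι → ι → Matrix ι ι A := fun i j k =>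
    dm (D i) (W j k) + conn D G H i * W j k + W j k * (conn D G H i)ᵀ with hT
  have hTe : ∀ i j k a b, T i j k a b = D i (W j k a b) +
      ∑ p, chr D G H a i p * W j k p b + ∑ p, W j k a p * chr D G H b i p := by
    intro i j k a b
    simp only [hT, Matrix.add_apply, Matrix.mul_apply, Matrix.transpose_apply, dm_apply, conn,
      Matrix.of_apply]
  -- The double trace of the Bianchi identity. Up to connection terms, the first cyclic summand is
  -- the derivative of the scalar curvature, and the other two are equal (`e3`), each being minus
  -- the divergence of Ricci. The connection terms recombine in `e4`.
  have hB : ∑ j, ∑ k, T i j k j k + ∑ j, ∑ k, T j k i j k + ∑ j, ∑ k, T k i j j k = 0 := by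
    simp only [← Finset.sum_add_distrib]
    refine Finset.sum_eq_zero fun j _ => Finset.sum_eq_zero fun k _ => ?_
    exact congrFun (congrFun (h.bianchi_raised i j k) j) k
  have hR : ∑ j, ∑ k, W j k j k = scal D G H := by
    rw [Finset.sum_comm]
    simp only [hMW]
    rfl
  have e1 : ∑ j, ∑ k, T i j k j k = D i (scal D G H) +
      2 * ∑ j, ∑ p, chr D G H j i p * M p j := by
    simp only [hTe, Finset.sum_add_distrib]
    have a1 : ∑ j, ∑ k, ∑ p, chr D G H j i p * W j k p k =
        ∑ j, ∑ p, chr D G H j i p * M p j := by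
      refine Finset.sum_congr rfl fun j _ => ?_
      rw [Finset.sum_comm]
      refine Finset.sum_congr rfl fun p _ => ?_
      rw [← Finset.mul_sum, ← hMW]
      congr 1
      exact Finset.sum_congr rfl fun k _ => s3 _ _ _ _
    have a2 : ∑ j, ∑ k, ∑ p, W j k j p * chr D G H k i p =
        ∑ j, ∑ p, chr D G H j i p * M p j := by
      rw [Finset.sum_comm]
      refine Finset.sum_congr rfl fun k _ => ?_
      rw [Finset.sum_comm]
      refine Finset.sum_congr rfl fun p _ => ?_
      rw [← Finset.sum_mul, hMW, mul_comm]
    rw [a1, a2, ← hR]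
    simp only [map_sum]
    ring
  have e2 : ∑ j, ∑ k, T j k i j k = -(∑ j, (D j (M j i) + cst D G H j * M j i)) := by
    simp only [hTe, Finset.sum_add_distrib]
    have a0 : ∀ j, ∑ k, W k i j k = -M j i := by
      intro j
      rw [← hMW, ← Finset.sum_neg_distrib]
      exact Finset.sum_congr rfl fun k _ => s1 _ _ _ _
    have a1 : ∑ j, ∑ k, ∑ p, chr D G H j j p * W k i p k = -∑ j, cst D G H j * M j i := by
      have : ∀ j, ∑ k, ∑ p, chr D G H j j p * W k i p k =
          ∑ p, -(chr D G H j j p * M p i) := by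
        intro j
        rw [Finset.sum_comm]
        refine Finset.sum_congr rfl fun p _ => ?_
        rw [← Finset.mul_sum, a0, mul_neg]
      simp only [this]
      rw [Finset.sum_comm]
      simp only [Finset.sum_neg_distrib, cst, Finset.sum_mul]
    -- `W` is antisymmetric in its upper pair `j`, `p`, while the Christoffel symbol is symmetric in
    -- these indices.
    have a2 : ∑ j, ∑ k, ∑ p, W k i j p * chr D G H k j p = 0 := by
      refine eq_zero_of_eq_neg ?_
      have : ∀ j k p, W k i j p * chr D G H k j p = -(W k i p j * chr D G H k p j) := by
        intro j k p
        rw [s1, h.chr_symm]; ring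
      calc ∑ j, ∑ k, ∑ p, W k i j p * chr D G H k j p
          = ∑ j, ∑ p, ∑ k, -(W k i p j * chr D G H k p j) :=
            Finset.sum_congr rfl fun j _ => by
              rw [Finset.sum_comm]
              exact Finset.sum_congr rfl fun p _ => Finset.sum_congr rfl fun k _ => this _ _ _
        _ = ∑ p, ∑ j, ∑ k, -(W k i p j * chr D G H k p j) := Finset.sum_comm
        _ = -∑ p, ∑ k, ∑ j, W k i p j * chr D G H k p j := by
            rw [← Finset.sum_neg_distrib]
            refine Finset.sum_congr rfl fun p _ => ?_
            rw [Finset.sum_comm]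
            simp only [Finset.sum_neg_distrib]
    rw [a1, a2]
    simp only [← map_sum, a0, map_neg, Finset.sum_neg_distrib]
    ring
  have e3 : ∑ j, ∑ k, T k i j j k = ∑ j, ∑ k, T j k i j k := by
    rw [Finset.sum_comm]
    refine Finset.sum_congr rfl fun j _ => Finset.sum_congr rfl fun k _ => ?_
    rw [hTe, hTe, s3 i k k j]
    have b1 : ∑ p, chr D G H k j p * W i k p j = ∑ p, W k i j p * chr D G H k j p :=
      Finset.sum_congr rfl fun p _ => by rw [s3]; ring
    have b2 : ∑ p, W i k k p * chr D G H j j p = ∑ p, chr D G H j j p * W k i p k :=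
      Finset.sum_congr rfl fun p _ => by rw [s3]; ring
    rw [b1, b2]; ring
  rw [e3, e2, e1] at hB
  have e4 : dvMixed D G H M i = ∑ j, (D j (M j i) + cst D G H j * M j i) -
      ∑ j, ∑ p, chr D G H j i p * M p j := by
    simp only [dvMixed]
    rw [Finset.sum_sub_distrib]
    congr 1
    rw [Finset.sum_comm]
    refine Finset.sum_congr rfl fun j _ => Finset.sum_congr rfl fun p _ => ?_
    rw [h.chr_symm]
  rw [e4]
  linear_combination -hB

/-- The contracted Ricci identity. -/
theorem dvMixed_cov (X : ι → A) (j : ι) :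
    dvMixed D G H (Matrix.of fun i k => cov D G H X k i) j =
      D j (dv D G H X) + ∑ p, ric D G H p j * X p := by
  have hr : ∑ p, ric D G H p j * X p = ∑ i, ∑ p, curv D G H i j i p * X p := by
    simp only [h.ric_eq, Finset.sum_mul]
    rw [Finset.sum_comm]
  -- The curvature as the commutator of two covariant derivatives of `X`. Corrections on the index
  -- of differentiation are left out: they are symmetric in the two directions and would cancel.
  have key : ∀ i, ∑ p, curv D G H i j i p * X p =
      D i (cov D G H X j i) + ∑ p, chr D G H i i p * cov D G H X j p -
        D j (cov D G H X i i) - ∑ p, chr D G H i j p * cov D G H X i p := by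
    intro i
    have c1 : ∑ p, (conn D G H i * conn D G H j) i p * X p =
        ∑ p, chr D G H i i p * ∑ q, chr D G H p j q * X q := by
      simp only [Matrix.mul_apply, conn, Matrix.of_apply, Finset.sum_mul, Finset.mul_sum]
      rw [Finset.sum_comm]
      exact Finset.sum_congr rfl fun _ _ => Finset.sum_congr rfl fun _ _ => by ring
    have c2 : ∑ p, (conn D G H j * conn D G H i) i p * X p =
        ∑ p, chr D G H i j p * ∑ q, chr D G H p i q * X q := by
      simp only [Matrix.mul_apply, conn, Matrix.of_apply, Finset.sum_mul, Finset.mul_sum]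
      rw [Finset.sum_comm]
      exact Finset.sum_congr rfl fun _ _ => Finset.sum_congr rfl fun _ _ => by ring
    simp only [curv, Matrix.add_apply, Matrix.sub_apply, add_mul, sub_mul,
      Finset.sum_add_distrib, Finset.sum_sub_distrib, c1, c2, dm_apply]
    simp only [cov, map_add, map_sum, Finset.sum_add_distrib,
      Derivation.leibniz, smul_eq_mul, mul_add, conn, Matrix.of_apply, h.comm j i]
    simp only [mul_comm (X _)]
    ring
  rw [hr, dv_eq, map_sum, ← Finset.sum_add_distrib]
  simp only [key, dvMixed, Matrix.of_apply]
  have c3 : ∑ i, cst D G H i * cov D G H X j i = ∑ i, ∑ p, chr D G H i i p * cov D G H X j p := by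
    simp only [cst, Finset.sum_mul]
    exact Finset.sum_comm
  have c4 : ∑ i, ∑ k, chr D G H k i j * cov D G H X k i =
      ∑ i, ∑ p, chr D G H i j p * cov D G H X i p := by
    rw [Finset.sum_comm]
    exact Finset.sum_congr rfl fun k _ => Finset.sum_congr rfl fun i _ => by rw [h.chr_symm]
  simp only [Finset.sum_add_distrib, Finset.sum_sub_distrib, c3, c4]
  ring

end IsMetric

end CoordGeom

/-! ### Gradients, Hessians and Bochner's formula. -/

namespace CoordGeom

open scoped Matrix

set_option linter.unusedSectionVars false

variable {ι A : Type*} [Fintype ι] [CommRing A] [Algebra ℝ A]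
  {D : ι → Derivation ℝ A A} {G H : Matrix ι ι A}

variable (D G H) in
/-- The value of the Ricci tensor on two gradients. -/
def ricGrad (u v : A) : A :=
  ∑ k, ∑ l, ric D G H k l * (gradient D H u k * gradient D H v l)

variable (H) in
/-- The inner product of two symmetric bilinear forms. -/
def pair (T S : Matrix ι ι A) : A := (H * T * (H * S)).trace

theorem pair_comm (T S : Matrix ι ι A) : pair H T S = pair H S T := Matrix.trace_mul_comm _ _

theorem pair_add_self (T S : Matrix ι ι A) :
    pair H (T + S) (T + S) = pair H T T + 2 * pair H T S + pair H S S := by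
  have h1 : pair H (T + S) (T + S) = pair H T T + pair H T S + (pair H S T + pair H S S) := by
    simp only [pair, Matrix.mul_add, Matrix.add_mul, Matrix.trace_add]
    ring
  rw [h1, pair_comm S T]; ring

theorem innerGrad_eq_sum (u v : A) :
    innerGrad D H u v = ∑ i, D i u * gradient D H v i := by
  unfold innerGrad gradient
  refine Finset.sum_congr rfl fun i _ => ?_
  rw [Finset.mul_sum]
  exact Finset.sum_congr rfl fun j _ => by ring

namespace IsMetric

variable [DecidableEq ι] (h : IsMetric D G H)
include h

/-- The inverse metric is parallel, so raising an index commutes with covariant differentiation. -/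
theorem cov_raise (α : ι → A) (i k : ι) :
    cov D G H (fun k => ∑ l, H k l * α l) i k = (H * (covForm D G H α)ᵀ) k i := by
  have h1 : ∀ l, D i (H k l) = -(∑ p, chr D G H k i p * H p l + ∑ p, H k p * chr D G H l i p) := by
    intro l
    have := congrFun (congrFun (h.dm_inverse i) k) l
    simpa [dm_apply, conn, Matrix.mul_apply] using this
  have h2 : ∑ j, chr D G H k i j * ∑ l, H j l * α l =
      ∑ l, (∑ p, chr D G H k i p * H p l) * α l := by
    simp only [Finset.mul_sum, Finset.sum_mul]
    rw [Finset.sum_comm]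
    exact Finset.sum_congr rfl fun _ _ => Finset.sum_congr rfl fun _ _ => by ring
  have h3 : ∑ l, H k l * ∑ j, chr D G H j i l * α j =
      ∑ l, (∑ p, H k p * chr D G H l i p) * α l := by
    simp only [Finset.mul_sum, Finset.sum_mul]
    rw [Finset.sum_comm]
    exact Finset.sum_congr rfl fun _ _ => Finset.sum_congr rfl fun _ _ => by ring
  have h4 : (H * (covForm D G H α)ᵀ) k i =
      ∑ l, H k l * D i (α l) - ∑ l, H k l * ∑ j, chr D G H j i l * α j := by
    simp only [Matrix.mul_apply, Matrix.transpose_apply, covForm, Matrix.of_apply, mul_sub,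
      Finset.sum_sub_distrib]
  rw [h4, h3, cov, h2, map_sum, ← Finset.sum_add_distrib, ← Finset.sum_sub_distrib]
  refine Finset.sum_congr rfl fun l _ => ?_
  rw [Derivation.leibniz, h1, smul_eq_mul, smul_eq_mul]
  ring

theorem trace_covForm (α : ι → A) :
    (H * (covForm D G H α)ᵀ).trace = dv D G H (fun k => ∑ l, H k l * α l) := by
  rw [dv_eq]
  exact Finset.sum_congr rfl fun i _ => (h.cov_raise α i i).symm

theorem dvGrad_eq (a u : A) : dvGrad D G H a u = dv D G H (fun i => a * gradient D H u i) := by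
  rw [dvGrad, h.trace_covForm]
  congr 1
  ext k
  rw [gradient, Finset.mul_sum]
  exact Finset.sum_congr rfl fun l _ => by ring

theorem dvGrad_mul (f a u : A) :
    dvGrad D G H (f * a) u = f * dvGrad D G H a u + a * innerGrad D H f u := by
  rw [h.dvGrad_eq, h.dvGrad_eq, innerGrad_eq_sum, dv, dv, Finset.mul_sum, Finset.mul_sum,
    ← Finset.sum_add_distrib]
  refine Finset.sum_congr rfl fun i _ => ?_
  simp only [Derivation.leibniz, smul_eq_mul]; ring

theorem dvGrad_add_right (a u v : A) :
    dvGrad D G H a (u + v) = dvGrad D G H a u + dvGrad D G H a v := by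
  rw [h.dvGrad_eq, h.dvGrad_eq, h.dvGrad_eq, ← dv_add]
  congr 1
  ext i
  simp only [gradient, map_add, mul_add, Finset.sum_add_distrib]

theorem dvGrad_const_mul {c : A} (hc : ∀ i, D i c = 0) (a u : A) :
    dvGrad D G H a (c * u) = c * dvGrad D G H a u := by
  rw [h.dvGrad_eq, h.dvGrad_eq, ← dv_mul_const hc]
  congr 1
  ext i
  simp only [gradient, Derivation.leibniz, hc, smul_eq_mul, mul_zero, add_zero, Finset.mul_sum]
  exact Finset.sum_congr rfl fun l _ => by ring

theorem innerGrad_comm (u v : A) : innerGrad D H u v = innerGrad D H v u := by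
  unfold innerGrad
  rw [Finset.sum_comm]
  exact Finset.sum_congr rfl fun j _ => Finset.sum_congr rfl fun i _ => by
    rw [h.symm_inv i j]; ring

theorem cov_gradient (u : A) (i k : ι) :
    cov D G H (gradient D H u) i k = (H * (hess D G H u)ᵀ) k i :=
  h.cov_raise _ i k

theorem hess_transpose (u : A) : (hess D G H u)ᵀ = hess D G H u := by
  ext i j
  simp only [Matrix.transpose_apply, hess, covForm, Matrix.of_apply, h.comm j i, h.chr_symm _ j i]

/-- Bochner's formula. -/
theorem bochner (u : A) :
    dvGrad D G H 1 (algebraMap ℝ A (1 / 2) * innerGrad D H u u) =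
      pair H (hess D G H u) (hess D G H u) + innerGrad D H u (dvGrad D G H 1 u) +
        ricGrad D G H u u := by
  set X := gradient D H u with hX
  have hc : ∀ i, D i (algebraMap ℝ A (1 / 2)) = 0 := fun i => (D i).map_algebraMap _
  have hlap : dvGrad D G H 1 u = dv D G H X := by
    rw [h.dvGrad_eq]; simp only [one_mul]; rfl
  have hY : ∀ j, D j (algebraMap ℝ A (1 / 2) * innerGrad D H u u) =
      ∑ k, X k * hess D G H u j k := by
    intro j
    have e1 : D j (innerGrad D H u u) = 2 * ∑ k, X k * D j (D k u) +
        ∑ k, ∑ l, D j (H k l) * (D k u * D l u) := by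
      have : D j (innerGrad D H u u) = ∑ k, ∑ l, H k l * (D j (D k u) * D l u) +
          ∑ k, ∑ l, H k l * (D k u * D j (D l u)) +
          ∑ k, ∑ l, D j (H k l) * (D k u * D l u) := by
        simp only [innerGrad, map_sum, ← Finset.sum_add_distrib, Derivation.leibniz, smul_eq_mul]
        exact Finset.sum_congr rfl fun _ _ => Finset.sum_congr rfl fun _ _ => by ring
      rw [this]
      have a1 : ∑ k, ∑ l, H k l * (D j (D k u) * D l u) = ∑ k, X k * D j (D k u) := by
        refine Finset.sum_congr rfl fun k _ => ?_
        rw [hX, gradient, Finset.sum_mul]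
        exact Finset.sum_congr rfl fun _ _ => by ring
      have a2 : ∑ k, ∑ l, H k l * (D k u * D j (D l u)) = ∑ k, X k * D j (D k u) := by
        rw [Finset.sum_comm, ← a1]
        exact Finset.sum_congr rfl fun _ _ => Finset.sum_congr rfl fun _ _ => by
          rw [h.symm_inv]; ring
      rw [a1, a2]; ring
    have e2 : ∑ k, ∑ l, D j (H k l) * (D k u * D l u) =
        -(2 * ∑ k, X k * ∑ m, chr D G H m j k * D m u) := by
      have b0 : ∀ k l, D j (H k l) =
          -(∑ p, chr D G H k j p * H p l + ∑ p, H k p * chr D G H l j p) := by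
        intro k l
        have := congrFun (congrFun (h.dm_inverse j) k) l
        simpa [dm_apply, conn, Matrix.mul_apply] using this
      have b1 : ∑ k, ∑ l, (∑ p, chr D G H k j p * H p l) * (D k u * D l u) =
          ∑ k, X k * ∑ m, chr D G H m j k * D m u := by
        simp only [hX, gradient, Finset.sum_mul, Finset.mul_sum]
        rw [Finset.sum_congr rfl fun k _ => Finset.sum_comm, Finset.sum_comm]
        refine Finset.sum_congr rfl fun p _ => Finset.sum_congr rfl fun k _ =>
          Finset.sum_congr rfl fun l _ => by ring
      have b2 : ∑ k, ∑ l, (∑ p, H k p * chr D G H l j p) * (D k u * D l u) =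
          ∑ k, X k * ∑ m, chr D G H m j k * D m u := by
        rw [← b1, Finset.sum_comm]
        refine Finset.sum_congr rfl fun l _ => Finset.sum_congr rfl fun k _ => ?_
        rw [mul_comm (D k u)]
        congr 1
        exact Finset.sum_congr rfl fun p _ => by rw [h.symm_inv]; ring
      simp only [b0, neg_mul, add_mul, Finset.sum_neg_distrib, Finset.sum_add_distrib, b1, b2]
      ring
    rw [Derivation.leibniz, hc, e1, e2]
    simp only [hess, covForm, Matrix.of_apply, mul_sub, Finset.sum_sub_distrib, smul_eq_mul]
    linear_combination (∑ k, X k * D j (D k u) -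
      ∑ k, X k * ∑ m, chr D G H m j k * D m u) * half_mul_two A
  -- Thus the gradient of ½|∇u|² is the tensor ∇X applied to X = ∇u. Its divergence splits by
  -- `dv_mixed` into |Hess u|² and the divergence of ∇X paired with X; `dvMixed_cov` turns the
  -- latter into ⟨∇Δu, ∇u⟩ + Ric(∇u, ∇u).
  have hgr : ∀ i, gradient D H (algebraMap ℝ A (1 / 2) * innerGrad D H u u) i =
      ∑ k, (Matrix.of fun i k => cov D G H X k i) i k * X k := by
    intro i
    have hcov : ∀ k, cov D G H X k i = ∑ j, H i j * hess D G H u j k := by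
      intro k
      rw [hX, h.cov_gradient, h.hess_transpose, Matrix.mul_apply]
    simp only [gradient, hY, Matrix.of_apply, hcov, Finset.mul_sum, Finset.sum_mul]
    rw [Finset.sum_comm]
    exact Finset.sum_congr rfl fun _ _ => Finset.sum_congr rfl fun _ _ => by ring
  rw [h.dvGrad_eq]
  simp only [one_mul, hgr]
  rw [dv_mixed, hlap]
  have p1 : ∑ i, ∑ k, (Matrix.of fun i k => cov D G H X k i) i k * cov D G H X i k =
      pair H (hess D G H u) (hess D G H u) := by
    simp only [Matrix.of_apply, hX, h.cov_gradient, h.hess_transpose]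
    rfl
  rw [p1]
  simp only [h.dvMixed_cov, add_mul, Finset.sum_add_distrib]
  have p2 : ∑ j, D j (dv D G H X) * X j = innerGrad D H u (dv D G H X) := by
    rw [h.innerGrad_comm, innerGrad_eq_sum]
  have p3 : ∑ j, (∑ p, ric D G H p j * X p) * X j = ricGrad D G H u u := by
    rw [ricGrad, Finset.sum_comm]
    simp only [Finset.sum_mul]
    exact Finset.sum_congr rfl fun _ _ => Finset.sum_congr rfl fun _ _ => by rw [hX]; ring
  rw [p2, p3]; ring

end IsMetric

/-! ### Evolution equations under the backward Ricci flow. -/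

variable (D G H) in
/-- The metric evolves by the Ricci flow in backward time. -/
structure IsFlow [DecidableEq ι] (Dt : Derivation ℝ A A) : Prop extends IsMetric D G H where
  comm_time : ∀ i a, Dt (D i a) = D i (Dt a)
  flow : ∀ i j, Dt (G i j) = 2 * ric D G H i j

namespace IsFlow

variable [DecidableEq ι] {Dt : Derivation ℝ A A} (h : IsFlow D G H Dt)
include h

/-- Twice the Ricci matrix is the time derivative of the symmetric matrix `G`, so symmetry need not
be derived from the curvature. -/
theorem ric_symm (i j : ι) : ric D G H i j = ric D G H j i := by
  have h1 : 2 * ric D G H i j = 2 * ric D G H j i := by rw [← h.flow, ← h.flow, h.symm]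
  linear_combination algebraMap ℝ A (1 / 2) * h1 +
    (ric D G H j i - ric D G H i j) * half_mul_two A

theorem ric_transpose : (ric D G H)ᵀ = ric D G H := by ext i j; exact h.ric_symm j i

theorem dm_time : dm Dt G = ric D G H + ric D G H := by
  ext i j; rw [dm_apply, h.flow, Matrix.add_apply, two_mul]

theorem dm_time_inv : dm Dt H = -(H * ric D G H * H + H * ric D G H * H) := by
  rw [dm_inv Dt h.inv, h.dm_time, Matrix.mul_add, Matrix.add_mul]

/-- The inverse metric evolves by -2 H Ric H; this produces the Ricci term. -/
theorem time_innerGrad (u v : A) : Dt (innerGrad D H u v) =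
    -(2 * ricGrad D G H u v) + innerGrad D H (Dt u) v + innerGrad D H u (Dt v) := by
  have h1 : Dt (innerGrad D H u v) = ∑ i, ∑ j, Dt (H i j) * (D i u * D j v) +
      innerGrad D H (Dt u) v + innerGrad D H u (Dt v) := by
    simp only [innerGrad, map_sum, ← Finset.sum_add_distrib, Derivation.leibniz, smul_eq_mul,
      h.comm_time]
    exact Finset.sum_congr rfl fun _ _ => Finset.sum_congr rfl fun _ _ => by ring
  have h2 : ∀ i j, Dt (H i j) = -(2 * (H * ric D G H * H) i j) := by
    intro i j
    rw [← dm_apply, h.dm_time_inv, Matrix.neg_apply, Matrix.add_apply, two_mul]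
  have h3 : ∑ i, ∑ j, (H * ric D G H * H) i j * (D i u * D j v) = ricGrad D G H u v := by
    have : ∀ i j, (H * ric D G H * H) i j * (D i u * D j v) =
        ∑ l, ∑ k, ric D G H k l * ((H k i * D i u) * (H l j * D j v)) := by
      intro i j
      simp only [Matrix.mul_apply, Finset.sum_mul]
      refine Finset.sum_congr rfl fun _ _ => Finset.sum_congr rfl fun _ _ => ?_
      rw [h.symm_inv i]; ring
    simp only [this, ricGrad, gradient, Finset.mul_sum, Finset.sum_mul]
    rw [Finset.sum_congr rfl fun i _ => Finset.sum_comm, Finset.sum_comm]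
    rw [Finset.sum_congr rfl fun l _ => Finset.sum_congr rfl fun i _ => Finset.sum_comm]
    rw [Finset.sum_congr rfl fun l _ => Finset.sum_comm, Finset.sum_comm]
    refine Finset.sum_congr rfl fun _ _ => Finset.sum_congr rfl fun _ _ => ?_
    rw [Finset.sum_comm]
  rw [h1, ← h3]
  simp only [h2, Finset.mul_sum, ← Finset.sum_neg_distrib]
  congr 2
  exact Finset.sum_congr rfl fun _ _ => Finset.sum_congr rfl fun _ _ => by ring

/-- Morally `cst` is ∂ᵢ log √det G, and log √det G grows at rate R. The ring need not contain a
logarithm, so the argument differentiates the trace of H ∂ᵢG instead. -/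
theorem time_cst (i : ι) : Dt (cst D G H i) = D i (scal D G H) := by
  have h1 : (H * dm (D i) G).trace = 2 * cst D G H i := by
    rw [h.dm_metric, Matrix.mul_add, Matrix.trace_add, ← Matrix.mul_assoc, h.inv', Matrix.one_mul,
      Matrix.trace_mul_comm, Matrix.mul_assoc, h.inv, Matrix.mul_one, Matrix.trace_transpose,
      h.cst_eq_trace, two_mul]
  have h2 := congrArg Dt h1
  have h3 : dm Dt (dm (D i) G) = dm (D i) (dm Dt G) := dm_comm _ _ _ (h.comm_time i)
  rw [map_trace, dm_mul, h3, h.dm_time, h.dm_time_inv, Derivation.leibniz] at h2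
  have h4 : D i (scal D G H) =
      (-(H * dm (D i) G * H * ric D G H) + H * dm (D i) (ric D G H)).trace := by
    rw [scal, map_trace, dm_mul, dm_inv (D i) h.inv, Matrix.neg_mul]
  have h5 : (H * dm (D i) G * H * ric D G H).trace =
      (H * ric D G H * H * dm (D i) G).trace := by
    rw [Matrix.mul_assoc (H * _) H, Matrix.trace_mul_comm, ← Matrix.mul_assoc]
  rw [Matrix.trace_add, Matrix.trace_neg, h5] at h4
  have h6 : Dt (2 : A) = 0 := by
    rw [← map_ofNat (algebraMap ℝ A) 2]; exact Dt.map_algebraMap _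
  rw [h6, dm_add] at h2
  simp only [Matrix.neg_mul, Matrix.add_mul, Matrix.mul_add, Matrix.trace_add,
    Matrix.trace_neg, smul_eq_mul, mul_zero, add_zero] at h2
  rw [h4]
  linear_combination (-algebraMap ℝ A (1 / 2)) * h2 +
    ((H * dm (D i) (ric D G H)).trace - (H * ric D G H * H * dm (D i) G).trace -
      Dt (cst D G H i)) * half_mul_two A

theorem two_mul_dv_ric (X : ι → A) :
    2 * dv D G H (fun i => ∑ j, (H * ric D G H) i j * X j) =
      ∑ j, D j (scal D G H) * X j + 2 * ∑ i, ∑ k, (H * ric D G H) i k * cov D G H X i k := by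
  rw [dv_mixed, mul_add, Finset.mul_sum]
  congr 1
  refine Finset.sum_congr rfl fun j _ => ?_
  rw [← h.dvMixed_ric h.ric_symm]; ring

/-- Evolution of the Laplacian under the flow. -/
theorem time_laplacian (u : A) : Dt (dvGrad D G H 1 u) =
    dvGrad D G H 1 (Dt u) - 2 * pair H (ric D G H) (hess D G H u) := by
  set X := gradient D H u with hX
  have hlap : ∀ v, dvGrad D G H 1 v = dv D G H (gradient D H v) := by
    intro v
    rw [h.dvGrad_eq]; simp only [one_mul]
  have hDX : ∀ i, Dt (X i) = gradient D H (Dt u) i +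
      (-2) * ∑ j, (H * ric D G H) i j * X j := by
    intro i
    have h2 : ∀ i j, Dt (H i j) = -(2 * (H * ric D G H * H) i j) := by
      intro i j
      rw [← dm_apply, h.dm_time_inv, Matrix.neg_apply, Matrix.add_apply, two_mul]
    have h3 : ∑ j, (H * ric D G H) i j * X j = ∑ j, (H * ric D G H * H) i j * D j u := by
      have : ∀ j, (H * ric D G H * H) i j = ∑ k, (H * ric D G H) i k * H k j :=
        fun j => Matrix.mul_apply
      simp only [hX, gradient, Finset.mul_sum, this, Finset.sum_mul]
      rw [Finset.sum_comm]
      exact Finset.sum_congr rfl fun _ _ => Finset.sum_congr rfl fun _ _ => by ring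
    rw [h3, Finset.mul_sum, gradient, hX, gradient, map_sum, ← Finset.sum_add_distrib]
    refine Finset.sum_congr rfl fun j _ => ?_
    rw [Derivation.leibniz, h2, h.comm_time, smul_eq_mul, smul_eq_mul]; ring
  have h1 : Dt (dv D G H X) = dv D G H (fun i => Dt (X i)) + ∑ i, D i (scal D G H) * X i := by
    simp only [dv, map_sum, ← Finset.sum_add_distrib]
    refine Finset.sum_congr rfl fun i _ => ?_
    rw [map_add, Derivation.leibniz, h.comm_time, h.time_cst, smul_eq_mul, smul_eq_mul]; ring
  have hc : ∀ i, D i (-2 : A) = 0 := fun i => by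
    rw [map_neg, ← map_ofNat (algebraMap ℝ A) 2, (D i).map_algebraMap, neg_zero]
  have h4 : ∑ i, ∑ k, (H * ric D G H) i k * cov D G H X i k =
      pair H (ric D G H) (hess D G H u) := by
    simp only [hX, h.cov_gradient, h.hess_transpose]
    rfl
  -- The term ⟨∇R, X⟩ contributed by the contracted Bianchi identity cancels the one that `time_cst`
  -- produces in `h1`.
  have h5 := h.two_mul_dv_ric X
  rw [h4] at h5
  rw [hlap, hlap, h1]
  simp only [hDX]
  rw [dv_add, dv_mul_const hc]
  linear_combination -h5

/-- Evolution of the scalar curvature under the flow. -/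
theorem time_scal : Dt (scal D G H) =
    -dvGrad D G H 1 (scal D G H) - 2 * pair H (ric D G H) (ric D G H) := by
  set B : ι → Matrix ι ι A := fun j => dm Dt (conn D G H j) with hB
  set K := H * ric D G H * H with hK
  have hlap : dvGrad D G H 1 (scal D G H) = dv D G H (gradient D H (scal D G H)) := by
    rw [h.dvGrad_eq]; simp only [one_mul]
  have hdH : ∀ i j, Dt (H i j) = -(2 * K i j) := by
    intro i j
    rw [← dm_apply, h.dm_time_inv, Matrix.neg_apply, Matrix.add_apply, two_mul]
  have hKs : Kᵀ = K := by
    rw [hK, Matrix.transpose_mul, Matrix.transpose_mul, h.transpose_inv, h.ric_transpose,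
      Matrix.mul_assoc]
  have hHA : ∀ i k l, D i (H k l) = -((conn D G H i * H) k l + (H * (conn D G H i)ᵀ) k l) := by
    intro i k l
    rw [← dm_apply, h.dm_inverse]; rfl
  have hBs : ∀ i k j, B i k j = B j k i := by
    intro i k j
    simp only [hB, dm_apply, conn, Matrix.of_apply, h.chr_symm k i j]
  -- the contraction `g^{ij} ∂_τ Γᵏᵢⱼ` vanishes
  have hV1 : ∀ k, ∑ j, (B j * H) k j = 0 := by
    intro k
    -- This expresses the contraction g^{ij} Γᵏᵢⱼ through derivatives of the inverse metric and
    -- `cst`, whose time derivatives are known. A formula for ∂_τ Γ itself is thereby avoided.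
    have c1 : ∑ j, (conn D G H j * H) k j =
        -(∑ j, D j (H k j) + ∑ p, H k p * cst D G H p) := by
      have : ∑ j, (H * (conn D G H j)ᵀ) k j = ∑ p, H k p * cst D G H p := by
        simp only [Matrix.mul_apply, Matrix.transpose_apply, conn, Matrix.of_apply, cst,
          Finset.mul_sum]
        exact Finset.sum_comm
      rw [← this]
      simp only [hHA, Finset.sum_neg_distrib, Finset.sum_add_distrib]
      ring
    have c2 := congrArg Dt c1
    have c3 : Dt (∑ j, (conn D G H j * H) k j) =
        ∑ j, (B j * H) k j - 2 * ∑ j, (conn D G H j * K) k j := by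
      simp only [map_sum, ← dm_apply, dm_mul, hB, Matrix.add_apply, Finset.sum_add_distrib,
        Finset.mul_sum, sub_eq_add_neg, ← Finset.sum_neg_distrib]
      congr 1
      refine Finset.sum_congr rfl fun j _ => ?_
      rw [h.dm_time_inv, ← hK, Matrix.mul_neg, Matrix.mul_add, Matrix.neg_apply, Matrix.add_apply]
      ring
    have c4 : Dt (-(∑ j, D j (H k j) + ∑ p, H k p * cst D G H p)) =
        2 * ∑ j, D j (K k j) + 2 * ∑ p, K k p * cst D G H p -
          ∑ p, H k p * D p (scal D G H) := by
      have d2 : ∀ j, D j (2 : A) = 0 := fun j => by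
        rw [← map_ofNat (algebraMap ℝ A) 2]; exact (D j).map_algebraMap _
      simp only [map_neg, map_add, map_sum, h.comm_time, hdH, Derivation.leibniz, smul_eq_mul,
        h.time_cst, d2, mul_zero, add_zero, Finset.sum_add_distrib, Finset.sum_neg_distrib,
        mul_neg, Finset.mul_sum]
      have : ∑ p, cst D G H p * (2 * K k p) = ∑ p, 2 * (K k p * cst D G H p) :=
        Finset.sum_congr rfl fun _ _ => by ring
      rw [this]; ring
    rw [c3, c4] at c2
    -- The Bianchi identity tested on the `k`-th column of the inverse metric, treated as a vector
    -- field. It supplies exactly the divergence of K that appears in `c4`.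
    have c5 := h.two_mul_dv_ric (fun j => H j k)
    have c6 : (fun i => ∑ j, (H * ric D G H) i j * H j k) = fun i => K k i := by
      ext i
      have : K k i = K i k := congrFun (congrFun hKs i) k
      rw [this, hK, Matrix.mul_apply]
    have c7 : ∑ j, D j (scal D G H) * H j k = ∑ p, H k p * D p (scal D G H) :=
      Finset.sum_congr rfl fun p _ => by rw [h.symm_inv]; ring
    have c8 : ∑ i, ∑ l, (H * ric D G H) i l * cov D G H (fun j => H j k) i l =
        -∑ j, (conn D G H j * K) k j := by
      have d1 : ∀ i l, cov D G H (fun j => H j k) i l = -(H * (conn D G H i)ᵀ) l k := by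
        intro i l
        have : ∑ j, chr D G H l i j * H j k = (conn D G H i * H) l k := by
          rw [Matrix.mul_apply]; rfl
        rw [cov, this, hHA]; ring
      simp only [d1, mul_neg, Finset.sum_neg_distrib]
      congr 1
      have d2 : ∀ i, ∑ l, (H * ric D G H) i l * (H * (conn D G H i)ᵀ) l k =
          (conn D G H i * K) k i := by
        intro i
        rw [← Matrix.mul_apply, ← Matrix.mul_assoc, ← hK]
        have : (K * (conn D G H i)ᵀ) = (conn D G H i * K)ᵀ := by
          rw [Matrix.transpose_mul, hKs]
        rw [this]; rfl
      exact Finset.sum_congr rfl fun i _ => d2 i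
    rw [c6, c7, c8] at c5
    have c9 : dv D G H (fun i => K k i) = ∑ j, D j (K k j) + ∑ p, K k p * cst D G H p := by
      simp only [dv, Finset.sum_add_distrib]
      congr 1
      exact Finset.sum_congr rfl fun _ _ => by ring
    rw [c9] at c5
    linear_combination c2 + c5
  have hV2 : ∀ j, ∑ k, (B k * H) k j = gradient D H (scal D G H) j := by
    intro j
    simp only [Matrix.mul_apply, gradient]
    rw [Finset.sum_comm]
    refine Finset.sum_congr rfl fun i _ => ?_
    rw [← Finset.sum_mul, ← h.time_cst, h.symm_inv, mul_comm, cst, map_sum]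
    rfl
  -- variation of the curvature
  have hR : ∀ j k, dm Dt (curv D G H k j) * H =
      (dm (D k) (B j * H) + conn D G H k * (B j * H) + (B j * H) * (conn D G H k)ᵀ) -
        (dm (D j) (B k * H) + conn D G H j * (B k * H) + (B k * H) * (conn D G H j)ᵀ) := by
    intro j k
    have e1 : ∀ i l, dm Dt (dm (D i) (conn D G H l)) = dm (D i) (B l) :=
      fun i l => dm_comm _ _ _ (h.comm_time i)
    simp only [curv, dm_add, dm_sub, dm_mul, e1, h.dm_inverse]
    simp only [hB]
    noncomm_ring
  -- Tracing the variation of the curvature leaves two divergences: that of g^{ij} ∂_τ Γᵏᵢⱼ, which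
  -- vanishes by `hV1`, and minus that of g^{jl} ∂_τ Γᵏₖₗ, which is the gradient of R by `hV2`. The
  -- remaining Christoffel terms cancel by `g3`.
  have hmain : ∑ i, ∑ j, H i j * Dt (ric D G H i j) = -dv D G H (gradient D H (scal D G H)) := by
    have f1 : ∑ i, ∑ j, H i j * Dt (ric D G H i j) =
        ∑ j, ∑ k, (dm Dt (curv D G H k j) * H) k j := by
      simp only [h.ric_eq, map_sum, Matrix.mul_apply, dm_apply, Finset.mul_sum]
      rw [Finset.sum_comm]
      refine Finset.sum_congr rfl fun j _ => ?_
      rw [Finset.sum_comm]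
      exact Finset.sum_congr rfl fun _ _ => Finset.sum_congr rfl fun _ _ => by ring
    have f2 : ∀ j k, (dm Dt (curv D G H k j) * H) k j =
        (D k ((B j * H) k j) + ∑ p, chr D G H k k p * (B j * H) p j
          + ∑ p, (B j * H) k p * chr D G H j k p) -
        (D j ((B k * H) k j) + ∑ p, chr D G H k j p * (B k * H) p j
          + ∑ p, (B k * H) k p * chr D G H j j p) := by
      intro j k
      have m1 : ∀ i (M : Matrix ι ι A) a b,
          (conn D G H i * M) a b = ∑ p, chr D G H a i p * M p b := fun _ _ _ _ => Matrix.mul_apply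
      have m2 : ∀ i (M : Matrix ι ι A) a b,
          (M * (conn D G H i)ᵀ) a b = ∑ p, M a p * chr D G H b i p := fun _ _ _ _ => Matrix.mul_apply
      rw [hR]
      simp only [Matrix.sub_apply, Matrix.add_apply, dm_apply, m1, m2]
    rw [f1]
    simp only [f2, Finset.sum_sub_distrib, Finset.sum_add_distrib]
    have g1 : ∑ j, ∑ k, D k ((B j * H) k j) = 0 := by
      rw [Finset.sum_comm]
      simp only [← map_sum, hV1, map_zero, Finset.sum_const_zero]
    have g2 : ∑ j, ∑ k, ∑ p, chr D G H k k p * (B j * H) p j = 0 := by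
      rw [Finset.sum_comm]
      refine Finset.sum_eq_zero fun k _ => ?_
      rw [Finset.sum_comm]
      simp only [← Finset.mul_sum, hV1, mul_zero, Finset.sum_const_zero]
    have g3 : ∑ j, ∑ k, ∑ p, (B j * H) k p * chr D G H j k p =
        ∑ j, ∑ k, ∑ p, chr D G H k j p * (B k * H) p j := by
      rw [Finset.sum_comm]
      have : ∀ j, ∑ k, ∑ p, chr D G H k j p * (B k * H) p j =
          ∑ k, ∑ p, (B k * H) p j * chr D G H k p j := fun j =>
        Finset.sum_congr rfl fun _ _ => Finset.sum_congr rfl fun _ _ => by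
          rw [h.chr_symm]; ring
      simp only [this]
      rw [Finset.sum_comm, Finset.sum_comm (f := fun j k => ∑ p, (B k * H) p j * chr D G H k p j)]
      exact Finset.sum_congr rfl fun j _ => Finset.sum_comm
    have g4 : ∑ j, ∑ k, D j ((B k * H) k j) =
        ∑ j, D j (gradient D H (scal D G H) j) := by
      simp only [← map_sum, hV2]
    have g5 : ∑ j, ∑ k, ∑ p, (B k * H) k p * chr D G H j j p =
        ∑ p, cst D G H p * gradient D H (scal D G H) p := by
      simp only [← hV2, cst, Finset.sum_mul, Finset.mul_sum]
      rw [Finset.sum_congr rfl fun j _ => Finset.sum_comm, Finset.sum_comm]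
      refine Finset.sum_congr rfl fun _ _ => ?_
      rw [Finset.sum_comm]
      exact Finset.sum_congr rfl fun _ _ => Finset.sum_congr rfl fun _ _ => by ring
    rw [g1, g2, g3, g4, g5]
    simp only [dv, Finset.sum_add_distrib]
    ring
  have hs : scal D G H = ∑ i, ∑ j, H i j * ric D G H i j := by
    simp only [scal, Matrix.trace, Matrix.diag, Matrix.mul_apply]
    exact Finset.sum_congr rfl fun _ _ => Finset.sum_congr rfl fun _ _ => by rw [h.ric_symm]
  have hp : ∑ i, ∑ j, K i j * ric D G H i j = pair H (ric D G H) (ric D G H) := by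
    have : pair H (ric D G H) (ric D G H) = (K * ric D G H).trace := by
      rw [pair, ← Matrix.mul_assoc]
    have h2 : ∀ i, (K * ric D G H) i i = ∑ j, K i j * ric D G H j i := fun i => Matrix.mul_apply
    rw [this]
    simp only [Matrix.trace, Matrix.diag, h2]
    exact Finset.sum_congr rfl fun _ _ => Finset.sum_congr rfl fun _ _ => by rw [h.ric_symm]
  have ht : Dt (scal D G H) = ∑ i, ∑ j, H i j * Dt (ric D G H i j) +
      (-2) * ∑ i, ∑ j, K i j * ric D G H i j := by
    rw [hs]
    simp only [map_sum, Derivation.leibniz, smul_eq_mul, hdH, Finset.mul_sum,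
      ← Finset.sum_add_distrib]
    exact Finset.sum_congr rfl fun _ _ => Finset.sum_congr rfl fun _ _ => by ring
  rw [ht, hmain, hp, hlap]; ring

end IsFlow

end CoordGeom

namespace CoordGeom

open scoped Matrix

set_option linter.unusedSectionVars false

/-! ### The Riemannian density. -/

section Density

variable {ι A : Type*} [Fintype ι] [DecidableEq ι] [CommRing A] [Algebra ℝ A]
  {D : ι → Derivation ℝ A A} {G H : Matrix ι ι A}

/-- Differentiate q² = det G by Jacobi's formula and divide by q. The only facts needed about a
square root are its square and the existence of an inverse `r`. -/
theorem map_sqrt_det (d : Derivation ℝ A A) (hGH : G * H = 1) {q r : A} (hq : q * q = G.det)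
    (hr : r * q = 1) : d q = algebraMap ℝ A (1 / 2) * (q * (H * dm d G).trace) := by
  have h1 := congrArg d hq
  rw [map_det d hGH, Derivation.leibniz, ← hq, smul_eq_mul] at h1
  linear_combination algebraMap ℝ A (1 / 2) * r * h1 + (algebraMap ℝ A (1 / 2) *
    (q * (H * dm d G).trace) - 2 * algebraMap ℝ A (1 / 2) * d q) * hr - d q * half_mul_two A

theorem IsMetric.map_density (h : IsMetric D G H) {q r : A} (hq : q * q = G.det)
    (hr : r * q = 1) (i : ι) : D i q = q * cst D G H i := by
  have h1 : (H * dm (D i) G).trace = 2 * cst D G H i := by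
    rw [h.dm_metric, Matrix.mul_add, Matrix.trace_add, ← Matrix.mul_assoc, h.inv', Matrix.one_mul,
      Matrix.trace_mul_comm, Matrix.mul_assoc, h.inv, Matrix.mul_one, Matrix.trace_transpose,
      h.cst_eq_trace, two_mul]
  rw [map_sqrt_det _ h.inv hq hr, h1]
  linear_combination q * cst D G H i * half_mul_two A

theorem IsFlow.time_density {Dt : Derivation ℝ A A} (h : IsFlow D G H Dt) {q r : A}
    (hq : q * q = G.det) (hr : r * q = 1) : Dt q = scal D G H * q := by
  rw [map_sqrt_det _ h.inv hq hr, h.dm_time, Matrix.mul_add, Matrix.trace_add, ← scal]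
  linear_combination q * scal D G H * half_mul_two A

/-- The logarithmic derivative of the density is the contracted Christoffel symbol, so
multiplication by the density turns a covariant divergence into a sum of partial derivatives. This
is the local form of the divergence theorem. -/
theorem IsMetric.density_mul_dvGrad (h : IsMetric D G H) {q r : A} (hq : q * q = G.det)
    (hr : r * q = 1) (a u : A) :
    q * dvGrad D G H a u = ∑ i, D i (q * (a * gradient D H u i)) := by
  rw [h.dvGrad_eq, dv, Finset.mul_sum]
  refine Finset.sum_congr rfl fun i _ => ?_
  rw [(D i).leibniz q, h.map_density hq hr, smul_eq_mul, smul_eq_mul]; ring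

end Density

/-! ### Transformation laws under a change of coordinates. -/

section ChangeOfCoordinates

variable {ι A B : Type*} [Fintype ι] [DecidableEq ι] [CommRing A] [Algebra ℝ A]
  [CommRing B] [Algebra ℝ B]
  {D : ι → Derivation ℝ A A} {G H : Matrix ι ι A}
  {D' : ι → Derivation ℝ B B} {G' H' : Matrix ι ι B}

/-- The data of a change of coordinates with Jacobian matrix `J` and inverse Jacobian `K`. -/
structure IsChange (D : ι → Derivation ℝ A A) (D' : ι → Derivation ℝ B B) (ψ : A →ₐ[ℝ] B)
    (J K : Matrix ι ι B) : Prop where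
  chain : ∀ i f, D' i (ψ f) = ∑ a, J a i * ψ (D a f)
  symm : ∀ i j a, D' i (J a j) = D' j (J a i)
  inv : J * K = 1

namespace IsChange

variable {ψ : A →ₐ[ℝ] B} {J K : Matrix ι ι B} (c : IsChange D D' ψ J K)
  (h : IsMetric D G H) (h' : IsMetric D' G' H') (hG : G' = Jᵀ * G.map ψ * J)
include c

theorem inv' : K * J = 1 := mul_eq_one_comm.1 c.inv

theorem dm_map (i : ι) (X : Matrix ι ι A) :
    dm (D' i) (X.map ψ) = ∑ a, J a i • (dm (D a) X).map ψ := by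
  ext p q
  simp only [dm_apply, Matrix.map_apply, c.chain, Matrix.sum_apply, Matrix.smul_apply, smul_eq_mul]

omit c in
theorem map_mul (X Y : Matrix ι ι A) : (X * Y).map ψ = X.map ψ * Y.map ψ := Matrix.map_mul

omit c in
theorem map_transpose (X : Matrix ι ι A) : Xᵀ.map ψ = (X.map ψ)ᵀ := rfl

include h h' hG

theorem inverse_eq : H' = K * H.map ψ * Kᵀ := by
  have e0 : G.map ψ * H.map ψ = 1 := by
    rw [← map_mul, h.inv]; exact Matrix.map_one _ (map_zero ψ) (map_one ψ)
  have e1 : G' * (K * H.map ψ * Kᵀ) = 1 := by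
    have e2 : Jᵀ * Kᵀ = 1 := by rw [← Matrix.transpose_mul, c.inv', Matrix.transpose_one]
    calc G' * (K * H.map ψ * Kᵀ) = Jᵀ * (G.map ψ * ((J * K) * H.map ψ)) * Kᵀ := by
          rw [hG]; simp only [Matrix.mul_assoc]
      _ = 1 := by rw [c.inv, Matrix.one_mul, e0, Matrix.mul_one, e2]
  calc H' = H' * (G' * (K * H.map ψ * Kᵀ)) := by rw [e1, Matrix.mul_one]
    _ = K * H.map ψ * Kᵀ := by rw [← Matrix.mul_assoc, h'.inv', Matrix.one_mul]

/-- The transformation law of the Christoffel symbols. -/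
theorem mul_conn (i : ι) : J * conn D' G' H' i =
    dm (D' i) J + (∑ a, J a i • (conn D G H a).map ψ) * J := by
  set Â : ι → Matrix ι ι B := fun i => ∑ a, J a i • (conn D G H a).map ψ with hA
  have e1 : ∀ i, dm (D' i) (G.map ψ) = G.map ψ * Â i + (Â i)ᵀ * G.map ψ := by
    intro i
    rw [c.dm_map, hA]
    simp only [h.dm_metric, Matrix.mul_sum, Matrix.transpose_sum, Matrix.sum_mul,
      ← Finset.sum_add_distrib]
    refine Finset.sum_congr rfl fun a _ => ?_
    rw [Matrix.map_add _ (map_add ψ), map_mul, map_mul, Matrix.transpose_smul,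
      Matrix.mul_smul, Matrix.smul_mul, smul_add, map_transpose]
  have hGt : (G.map ψ)ᵀ = G.map ψ := by rw [← map_transpose, h.transpose_eq]
  -- The expected right-hand side, multiplied by the inverse Jacobian, is torsion free (second
  -- derivatives commute) and compatible with `G'`. Uniqueness of the Levi-Civita connection
  -- identifies it without computing Christoffel symbols.
  have e2 := h'.conn_unique (fun i => K * (dm (D' i) J + Â i * J)) ?_ ?_ i
  · rw [e2, ← Matrix.mul_assoc, c.inv, Matrix.one_mul]
  · intro k i j
    simp only [Matrix.mul_apply (M := K)]
    refine Finset.sum_congr rfl fun a _ => ?_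
    congr 1
    simp only [Matrix.add_apply, dm_apply, c.symm i j a]
    congr 1
    simp only [hA, Matrix.mul_apply, Matrix.sum_apply, Matrix.smul_apply, smul_eq_mul,
      Finset.sum_mul, Matrix.map_apply]
    rw [Finset.sum_comm]
    refine Finset.sum_congr rfl fun p _ => Finset.sum_congr rfl fun q _ => ?_
    simp only [conn, Matrix.of_apply, h.chr_symm a q p]; ring
  · intro i
    have e3 : ∀ X : Matrix ι ι B, G' * (K * X) = Jᵀ * G.map ψ * X := by
      intro X
      rw [hG, ← Matrix.mul_assoc, Matrix.mul_assoc _ J K, c.inv, Matrix.mul_one]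
    have e4 : ∀ X : Matrix ι ι B, (K * X)ᵀ * G' = (Jᵀ * G.map ψ * X)ᵀ := by
      intro X
      rw [← e3, Matrix.transpose_mul G', h'.transpose_eq]
    rw [e3, e4, hG]
    simp only [dm_mul, dm_transpose, e1, Matrix.transpose_mul, Matrix.transpose_transpose, hGt,
      Matrix.transpose_add]
    noncomm_ring

/-- Differentiate `mul_conn` and antisymmetrize: the second derivatives of `J` commute and drop out,
leaving the curvature of the pulled-back connection `Â`. In that curvature the first derivatives of
`J` drop out as well, by the symmetry of the Jacobian. -/
theorem mul_curv (i j : ι) : J * curv D' G' H' i j =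
    (∑ a, ∑ b, (J a i * J b j) • (curv D G H a b).map ψ) * J := by
  set Â : ι → Matrix ι ι B := fun i => ∑ a, J a i • (conn D G H a).map ψ with hA
  have e1 : ∀ i, J * conn D' G' H' i = dm (D' i) J + Â i * J := c.mul_conn h h' hG
  have hJ : dm (D' i) (dm (D' j) J) = dm (D' j) (dm (D' i) J) := h'.dm_dm i j J
  have e2 : ∀ i j, dm (D' j) J * conn D' G' H' i + J * dm (D' j) (conn D' G' H' i) =
      dm (D' j) (dm (D' i) J) + (dm (D' j) (Â i) * J + Â i * dm (D' j) J) := by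
    intro i j
    have := congrArg (dm (D' j)) (e1 i)
    rwa [dm_mul, dm_add, dm_mul] at this
  have e3 : J * curv D' G' H' i j =
      (dm (D' i) (Â j) - dm (D' j) (Â i) + Â i * Â j - Â j * Â i) * J := by
    have f1 := e2 i j
    have f2 := e2 j i
    have f3 : ∀ i, dm (D' i) J = J * conn D' G' H' i - Â i * J := fun i => by
      rw [e1]; abel
    rw [hJ] at f2
    have f4 : J * dm (D' j) (conn D' G' H' i) = dm (D' j) (dm (D' i) J) +
        (dm (D' j) (Â i) * J + Â i * dm (D' j) J) - dm (D' j) J * conn D' G' H' i := by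
      rw [← f1]; abel
    have f5 : J * dm (D' i) (conn D' G' H' j) = dm (D' j) (dm (D' i) J) +
        (dm (D' i) (Â j) * J + Â j * dm (D' i) J) - dm (D' i) J * conn D' G' H' j := by
      rw [← f2]; abel
    have f6 : J * curv D' G' H' i j = J * dm (D' i) (conn D' G' H' j) -
        J * dm (D' j) (conn D' G' H' i) + (J * conn D' G' H' i) * conn D' G' H' j -
        (J * conn D' G' H' j) * conn D' G' H' i := by
      unfold curv; noncomm_ring
    rw [f6, f4, f5]
    generalize dm (D' j) (dm (D' i) J) = Z
    rw [f3 i, f3 j]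
    noncomm_ring
  rw [e3]
  congr 1
  have g1 : ∀ i j, dm (D' i) (Â j) = ∑ a, D' i (J a j) • (conn D G H a).map ψ +
      ∑ a, ∑ b, (J a j * J b i) • (dm (D b) (conn D G H a)).map ψ := by
    intro i j
    ext p q
    simp only [hA, dm_apply, Matrix.sum_apply, Matrix.smul_apply, map_sum, smul_eq_mul,
      Derivation.leibniz, Matrix.map_apply, Matrix.add_apply, c.chain, Finset.mul_sum,
      ← Finset.sum_add_distrib]
    refine Finset.sum_congr rfl fun a _ => ?_
    rw [add_comm, mul_comm (ψ _)]
    congr 1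
    exact Finset.sum_congr rfl fun b _ => by ring
  have g2 : ∀ i j, Â i * Â j =
      ∑ a, ∑ b, (J a i * J b j) • (conn D G H a * conn D G H b).map ψ := by
    intro i j
    simp only [hA, Matrix.sum_mul, Matrix.mul_sum, map_mul, Matrix.smul_mul, Matrix.mul_smul,
      Finset.smul_sum, smul_smul]
    rw [Finset.sum_comm]
    exact Finset.sum_congr rfl fun a _ => Finset.sum_congr rfl fun b _ => by rw [mul_comm]
  have g3 : ∑ a, ∑ b, (J a j * J b i) • (dm (D b) (conn D G H a)).map ψ =
      ∑ a, ∑ b, (J a i * J b j) • (dm (D a) (conn D G H b)).map ψ := by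
    rw [Finset.sum_comm]
    exact Finset.sum_congr rfl fun a _ => Finset.sum_congr rfl fun b _ => by rw [mul_comm]
  have g4 : ∑ a, ∑ b, (J a j * J b i) • (conn D G H a * conn D G H b).map ψ =
      ∑ a, ∑ b, (J a i * J b j) • (conn D G H b * conn D G H a).map ψ := by
    rw [Finset.sum_comm]
    exact Finset.sum_congr rfl fun a _ => Finset.sum_congr rfl fun b _ => by rw [mul_comm]
  rw [g1, g1, g2, g2, g3, g4]
  simp only [c.symm j i]
  rw [add_sub_add_left_eq_sub]
  simp only [← Finset.sum_sub_distrib, ← Finset.sum_add_distrib, ← smul_sub, ← smul_add]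
  refine Finset.sum_congr rfl fun a _ => Finset.sum_congr rfl fun b _ => ?_
  congr 1
  ext p q
  simp only [curv, Matrix.map_apply, Matrix.sub_apply, Matrix.add_apply, map_sub, map_add]

/-- The Ricci tensor is a tensor. -/
theorem ric_eq : ric D' G' H' = Jᵀ * (ric D G H).map ψ * J := by
  have e1 : ∀ i j, curv D' G' H' i j =
      K * ((∑ a, ∑ b, (J a i * J b j) • (curv D G H a b).map ψ) * J) := by
    intro i j
    rw [← c.mul_curv h h' hG, ← Matrix.mul_assoc, c.inv', Matrix.one_mul]
  have e2 : ∀ a q, ∑ k, J a k * K k q = (1 : Matrix ι ι B) a q := by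
    intro a q
    rw [← c.inv, Matrix.mul_apply]
  ext i j
  have e3 : ric D' G' H' i j =
      ∑ b, ∑ q, ∑ a, (J b j * J q i) * ψ (curv D G H a b a q) := by
    rw [h'.ric_eq]
    simp only [e1, Matrix.mul_apply, Matrix.sum_apply, Matrix.smul_apply, smul_eq_mul,
      Matrix.map_apply]
    have : ∀ k, ∑ p, K k p * ∑ q, (∑ a, ∑ b, J a k * J b j * ψ (curv D G H a b p q)) * J q i =
        ∑ b, ∑ q, ∑ a, ∑ p, (J a k * K k p) * ((J b j * J q i) * ψ (curv D G H a b p q)) := by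
      intro k
      simp only [Finset.mul_sum, Finset.sum_mul]
      rw [Finset.sum_comm]
      rw [Finset.sum_comm (f := fun b q => ∑ a, ∑ p,
        (J a k * K k p) * ((J b j * J q i) * ψ (curv D G H a b p q)))]
      refine Finset.sum_congr rfl fun q _ => ?_
      rw [Finset.sum_congr rfl fun p _ => Finset.sum_comm, Finset.sum_comm]
      refine Finset.sum_congr rfl fun b _ => ?_
      rw [Finset.sum_comm]
      exact Finset.sum_congr rfl fun a _ => Finset.sum_congr rfl fun p _ => by ring
    simp only [this]
    rw [Finset.sum_comm]
    refine Finset.sum_congr rfl fun b _ => ?_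
    rw [Finset.sum_comm]
    refine Finset.sum_congr rfl fun q _ => ?_
    rw [Finset.sum_comm]
    refine Finset.sum_congr rfl fun a _ => ?_
    rw [Finset.sum_comm]
    simp only [← Finset.sum_mul, e2, Matrix.one_apply, ite_mul, one_mul, zero_mul,
      Finset.sum_ite_eq, Finset.mem_univ, if_true]
  rw [e3]
  simp only [Matrix.mul_apply, Matrix.transpose_apply, Matrix.map_apply, h.ric_eq, map_sum,
    Finset.mul_sum, Finset.sum_mul]
  exact Finset.sum_congr rfl fun b _ => Finset.sum_congr rfl fun q _ =>
    Finset.sum_congr rfl fun a _ => by ring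

/-- The covariant derivative of a one-form is a tensor. -/
theorem covForm_eq (α : ι → A) : covForm D' G' H' (fun j => ∑ a, J a j * ψ (α a)) =
    Jᵀ * (covForm D G H α).map ψ * J := by
  ext i j
  have e1 : ∑ k, chr D' G' H' k i j * ∑ a, J a k * ψ (α a) =
      ∑ a, (J * conn D' G' H' i) a j * ψ (α a) := by
    simp only [Matrix.mul_apply, conn, Matrix.of_apply, Finset.mul_sum, Finset.sum_mul]
    rw [Finset.sum_comm]
    exact Finset.sum_congr rfl fun _ _ => Finset.sum_congr rfl fun _ _ => by ring
  have e2 : ∑ a, ((∑ b, J b i • (conn D G H b).map ψ) * J) a j * ψ (α a) =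
      ∑ p, ∑ b, ∑ k, J b i * ψ (chr D G H k b p) * ψ (α k) * J p j := by
    simp only [Matrix.mul_apply, conn, Matrix.sum_apply, Matrix.smul_apply, smul_eq_mul,
      Matrix.map_apply, Matrix.of_apply, Finset.sum_mul]
    rw [Finset.sum_comm]
    refine Finset.sum_congr rfl fun p _ => ?_
    rw [Finset.sum_comm]
    exact Finset.sum_congr rfl fun _ _ => Finset.sum_congr rfl fun _ _ => by ring
  have e3 : (Jᵀ * (covForm D G H α).map ψ * J) i j =
      ∑ p, ∑ b, J p j * (J b i * ψ (D b (α p))) -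
        ∑ p, ∑ b, ∑ k, J b i * ψ (chr D G H k b p) * ψ (α k) * J p j := by
    simp only [Matrix.mul_apply, Matrix.transpose_apply, covForm, Matrix.map_apply,
      Matrix.of_apply, map_sub, map_sum, _root_.map_mul, mul_sub, sub_mul, Finset.sum_sub_distrib,
      Finset.sum_mul, Finset.mul_sum]
    congr 1
    · exact Finset.sum_congr rfl fun _ _ => Finset.sum_congr rfl fun _ _ => by ring
    · exact Finset.sum_congr rfl fun _ _ => Finset.sum_congr rfl fun _ _ =>
        Finset.sum_congr rfl fun _ _ => by ring
  rw [e3]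
  simp only [covForm, Matrix.of_apply, e1, c.mul_conn h h' hG, Matrix.add_apply, add_mul,
    Finset.sum_add_distrib, e2, dm_apply]
  simp only [Finset.sum_add_distrib, map_sum, Derivation.leibniz, smul_eq_mul, c.chain,
    Finset.mul_sum]
  simp only [mul_comm (ψ (α _))]
  ring

theorem trace_eq (T : Matrix ι ι A) :
    (H' * (Jᵀ * T.map ψ * J)).trace = ψ (H * T).trace := by
  have e2 : Kᵀ * Jᵀ = 1 := by rw [← Matrix.transpose_mul, c.inv, Matrix.transpose_one]
  have e3 : H' * (Jᵀ * T.map ψ * J) = K * (H.map ψ * T.map ψ * J) := by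
    rw [c.inverse_eq h h' hG]
    calc K * H.map ψ * Kᵀ * (Jᵀ * T.map ψ * J) = K * (H.map ψ * (Kᵀ * Jᵀ) * T.map ψ * J) := by
          simp only [Matrix.mul_assoc]
      _ = _ := by rw [e2, Matrix.mul_one]
  rw [e3, Matrix.trace_mul_comm, Matrix.mul_assoc, c.inv, Matrix.mul_one, ← map_mul]
  simp only [Matrix.trace, Matrix.diag, Matrix.map_apply, map_sum]

theorem scal_eq : scal D' G' H' = ψ (scal D G H) := by
  rw [scal, c.ric_eq h h' hG, c.trace_eq h h' hG, scal]

theorem dvGrad_eq (a u : A) : dvGrad D' G' H' (ψ a) (ψ u) = ψ (dvGrad D G H a u) := by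
  have e1 : (fun k => ψ a * D' k (ψ u)) = fun j => ∑ b, J b j * ψ (a * D b u) := by
    ext k
    rw [c.chain, Finset.mul_sum]
    exact Finset.sum_congr rfl fun b _ => by rw [_root_.map_mul]; ring
  rw [dvGrad, e1, c.covForm_eq h h' hG, Matrix.transpose_mul, Matrix.transpose_mul,
    Matrix.transpose_transpose, ← map_transpose, ← Matrix.mul_assoc Jᵀ, c.trace_eq h h' hG, dvGrad]

theorem innerGrad_eq (u v : A) : innerGrad D' H' (ψ u) (ψ v) = ψ (innerGrad D H u v) := by
  have e1 : innerGrad D H u v = (H * Matrix.of fun i j => D i v * D j u).trace := by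
    simp only [innerGrad, Matrix.trace, Matrix.diag, Matrix.mul_apply, Matrix.of_apply]
    exact Finset.sum_congr rfl fun _ _ => Finset.sum_congr rfl fun _ _ => by ring
  have e2 : innerGrad D' H' (ψ u) (ψ v) =
      (H' * Matrix.of fun i j => D' i (ψ v) * D' j (ψ u)).trace := by
    simp only [innerGrad, Matrix.trace, Matrix.diag, Matrix.mul_apply, Matrix.of_apply]
    exact Finset.sum_congr rfl fun _ _ => Finset.sum_congr rfl fun _ _ => by ring
  have e3 : (Matrix.of fun i j => D' i (ψ v) * D' j (ψ u)) =
      Jᵀ * (Matrix.of fun i j => D i v * D j u).map ψ * J := by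
    ext i j
    simp only [Matrix.mul_apply, Matrix.of_apply, Matrix.transpose_apply, Matrix.map_apply,
      c.chain, Finset.sum_mul, Finset.mul_sum, _root_.map_mul]
    exact Finset.sum_congr rfl fun _ _ => Finset.sum_congr rfl fun _ _ => by ring
  rw [e2, e3, c.trace_eq h h' hG, e1]

end IsChange

end ChangeOfCoordinates

/-! ### Derivatives along the flow lines of a Hamilton-Jacobi potential. -/

section HamiltonJacobi

variable {ι A : Type*} [Fintype ι] [DecidableEq ι] [CommRing A] [Algebra ℝ A]
  {D : ι → Derivation ℝ A A} {G H : Matrix ι ι A}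

theorem IsMetric.innerGrad_add_left (u v w : A) :
    innerGrad D H (u + v) w = innerGrad D H u w + innerGrad D H v w := by
  simp only [innerGrad, ← Finset.sum_add_distrib, map_add]
  exact Finset.sum_congr rfl fun _ _ => Finset.sum_congr rfl fun _ _ => by ring

theorem IsMetric.innerGrad_const_mul {c : A} (hc : ∀ i, D i c = 0) (u w : A) :
    innerGrad D H (c * u) w = c * innerGrad D H u w := by
  simp only [innerGrad, Finset.mul_sum, Derivation.leibniz, hc, smul_eq_mul]
  exact Finset.sum_congr rfl fun _ _ => Finset.sum_congr rfl fun _ _ => by ring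

theorem IsMetric.pair_sub_smul (h : IsMetric D G H) (T : Matrix ι ι A) (c : A) :
    pair H (T - c • G) (T - c • G) =
      pair H T T - 2 * c * (H * T).trace + Fintype.card ι * c ^ 2 := by
  simp only [pair, Matrix.mul_sub, Matrix.sub_mul, Matrix.mul_smul, Matrix.smul_mul, h.inv',
    Matrix.mul_one, Matrix.one_mul, Matrix.trace_sub, Matrix.trace_smul, Matrix.trace_one,
    smul_eq_mul]
  ring

namespace IsFlow

variable {Dt : Derivation ℝ A A} (h : IsFlow D G H Dt) {c φ : A} (hc : ∀ i, D i c = 0)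
  (hφ : Dt φ = -(algebraMap ℝ A (1 / 2) * innerGrad D H φ φ) +
    algebraMap ℝ A (1 / 2) * scal D G H - c * φ)
include h hc hφ

/-- Apply Δ to the Hamilton-Jacobi equation. Bochner's formula cancels ⟨∇Δφ, ∇φ⟩ and yields -|Hess
φ|² - Ric(∇φ, ∇φ); the moving Laplacian contributes the cross term -2⟨Ric, Hess φ⟩; and `time_scal`
replaces ½ΔR by -½R_τ - |Ric|², which completes the square. The element `c` stands for 1/(2τ); only
its constancy in space matters. -/
theorem time_laplacian_add_scal :
    Dt (dvGrad D G H 1 φ + scal D G H) + innerGrad D H (dvGrad D G H 1 φ + scal D G H) φ =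
      -pair H (ric D G H + hess D G H φ) (ric D G H + hess D G H φ) +
        algebraMap ℝ A (1 / 2) * Dt (scal D G H) + innerGrad D H (scal D G H) φ -
        ricGrad D G H φ φ - c * dvGrad D G H 1 φ := by
  have hh : ∀ i, D i (algebraMap ℝ A (1 / 2)) = 0 := fun i => (D i).map_algebraMap _
  have hc' : ∀ i, D i (-c) = 0 := fun i => by rw [map_neg, hc, neg_zero]
  have e1 : dvGrad D G H 1 (Dt φ) =
      -(dvGrad D G H 1 (algebraMap ℝ A (1 / 2) * innerGrad D H φ φ)) +
        algebraMap ℝ A (1 / 2) * dvGrad D G H 1 (scal D G H) - c * dvGrad D G H 1 φ := by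
    have : Dt φ = (algebraMap ℝ A (-1)) * (algebraMap ℝ A (1 / 2) * innerGrad D H φ φ) +
        algebraMap ℝ A (1 / 2) * scal D G H + (-c) * φ := by
      rw [hφ, map_neg, map_one]; ring
    rw [this, h.dvGrad_add_right, h.dvGrad_add_right,
      h.dvGrad_const_mul (fun i => (D i).map_algebraMap _), h.dvGrad_const_mul hh 1 (scal D G H),
      h.dvGrad_const_mul hc', map_neg, map_one]
    ring
  rw [map_add, h.time_laplacian, e1, h.bochner, IsMetric.innerGrad_add_left,
    h.innerGrad_comm (dvGrad D G H 1 φ), pair_add_self]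
  linear_combination algebraMap ℝ A (1 / 2) * h.time_scal +
    (-Dt (scal D G H) - pair H (ric D G H) (ric D G H)) * half_mul_two A

/-- The two terms ½⟨∇|∇φ|², ∇φ⟩ cancel. The curvature terms on the right are those of
`time_laplacian_add_scal`, so that they disappear from the difference of the two identities. -/
theorem time_energy :
    Dt (algebraMap ℝ A (1 / 2) * (innerGrad D H φ φ + scal D G H)) +
      innerGrad D H (algebraMap ℝ A (1 / 2) * (innerGrad D H φ φ + scal D G H)) φ =
      algebraMap ℝ A (1 / 2) * Dt (scal D G H) + innerGrad D H (scal D G H) φ -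
        ricGrad D G H φ φ - c * innerGrad D H φ φ := by
  have hh : ∀ i, D i (algebraMap ℝ A (1 / 2)) = 0 := fun i => (D i).map_algebraMap _
  have hc' : ∀ i, D i (-c) = 0 := fun i => by rw [map_neg, hc, neg_zero]
  have e1 : innerGrad D H (Dt φ) φ =
      -(algebraMap ℝ A (1 / 2) * innerGrad D H (innerGrad D H φ φ) φ) +
        algebraMap ℝ A (1 / 2) * innerGrad D H (scal D G H) φ - c * innerGrad D H φ φ := by
    have : Dt φ = (algebraMap ℝ A (-1)) * (algebraMap ℝ A (1 / 2) * innerGrad D H φ φ) +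
        algebraMap ℝ A (1 / 2) * scal D G H + (-c) * φ := by
      rw [hφ, map_neg, map_one]; ring
    rw [this, IsMetric.innerGrad_add_left, IsMetric.innerGrad_add_left,
      IsMetric.innerGrad_const_mul (fun i => (D i).map_algebraMap _),
      IsMetric.innerGrad_const_mul hh, IsMetric.innerGrad_const_mul hh,
      IsMetric.innerGrad_const_mul hc', map_neg, map_one]
    ring
  rw [IsMetric.innerGrad_const_mul hh, IsMetric.innerGrad_add_left, Derivation.leibniz,
    Dt.map_algebraMap, map_add, h.time_innerGrad, h.innerGrad_comm φ (Dt φ), e1, smul_eq_mul]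
  linear_combination (-ricGrad D G H φ φ - c * innerGrad D H φ φ -
    algebraMap ℝ A (1 / 2) * innerGrad D H (innerGrad D H φ φ) φ +
    (algebraMap ℝ A (1 / 2) + 1) * innerGrad D H (scal D G H) φ) * half_mul_two A

end IsFlow

end HamiltonJacobi

end CoordGeom

/-! ### The ring of smooth functions on a domain, with its derivations -/

namespace SmoothRing

variable {V V' : Type*} [NormedAddCommGroup V] [NormedSpace ℝ V]
  [NormedAddCommGroup V'] [NormedSpace ℝ V']

/-- Sets on which the derivatives within the set are unique and commute. -/
structure IsRegularDomain (Ω : Set V) : Prop where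
  uniqueDiffOn : UniqueDiffOn ℝ Ω
  subset_closure : Ω ⊆ closure (interior Ω)

theorem isRegularDomain_Icc_prod {a b : ℝ} (hab : a < b) {U : Set V} (hU : IsOpen U) :
    IsRegularDomain (Icc a b ×ˢ U) where
  uniqueDiffOn := (uniqueDiffOn_Icc hab).prod hU.uniqueDiffOn
  subset_closure := by
    rw [interior_prod_eq, closure_prod_eq, interior_Icc, closure_Ioo hab.ne, hU.interior_eq]
    exact prod_mono_right subset_closure

/-- The functions on `Ω` that are smooth up to the boundary. -/
def smoothSubalgebra (Ω : Set V) : Subalgebra ℝ (Ω → ℝ) where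
  -- The elements are functions on the subtype, so that equality in the ring is equality at the
  -- points of `Ω` alone; a smooth representative is merely required to exist.
  carrier := {f | ∃ F : V → ℝ, ContDiffOn ℝ ∞ F Ω ∧ ∀ p : Ω, f p = F p}
  mul_mem' := by
    rintro f g ⟨F, hF, hf⟩ ⟨F', hF', hg⟩
    exact ⟨fun p => F p * F' p, hF.mul hF', fun p => by simp [hf, hg]⟩
  add_mem' := by
    rintro f g ⟨F, hF, hf⟩ ⟨F', hF', hg⟩
    exact ⟨fun p => F p + F' p, hF.add hF', fun p => by simp [hf, hg]⟩
  algebraMap_mem' r := ⟨fun _ => r, contDiffOn_const, fun _ => rfl⟩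

/-- The ring of the functions on `Ω` that are smooth up to the boundary. -/
def smoothRing (Ω : Set V) : Type _ := smoothSubalgebra Ω

instance (Ω : Set V) : CommRing (smoothRing Ω) :=
  inferInstanceAs (CommRing (smoothSubalgebra Ω))

instance (Ω : Set V) : Algebra ℝ (smoothRing Ω) :=
  inferInstanceAs (Algebra ℝ (smoothSubalgebra Ω))

variable {Ω : Set V} {Ω' : Set V'}

/-- The restriction of a smooth function. -/
def ofFun (F : V → ℝ) (hF : ContDiffOn ℝ ∞ F Ω) : smoothRing Ω :=
  ⟨fun p => F p, F, hF, fun _ => rfl⟩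

/-- The extension of a function by zero. -/
def ext (f : smoothRing Ω) : V → ℝ := Function.extend Subtype.val f.1 0

/-- Evaluation at a point. -/
def ev (p : Ω) : smoothRing Ω →ₐ[ℝ] ℝ :=
  (Pi.evalAlgHom ℝ (fun _ : Ω => ℝ) p).comp (smoothSubalgebra Ω).val

theorem ev_ofFun (p : Ω) (F : V → ℝ) (hF : ContDiffOn ℝ ∞ F Ω) : ev p (ofFun F hF) = F p := rfl

theorem ext_apply (f : smoothRing Ω) (p : Ω) : ext f p = ev p f :=
  Subtype.val_injective.extend_apply _ _ _

theorem hom_ext {f g : smoothRing Ω} (h : ∀ p, ev p f = ev p g) : f = g :=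
  Subtype.ext (funext h)

theorem contDiffOn_ext (f : smoothRing Ω) : ContDiffOn ℝ ∞ (ext f) Ω := by
  obtain ⟨F, hF, h⟩ := f.2
  exact hF.congr fun p hp => (ext_apply f ⟨p, hp⟩).trans (h ⟨p, hp⟩)

theorem eqOn_ext_ofFun (F : V → ℝ) (hF : ContDiffOn ℝ ∞ F Ω) : EqOn (ext (ofFun F hF)) F Ω :=
  fun p hp => ext_apply (ofFun F hF) ⟨p, hp⟩

theorem hasFDerivWithinAt_ext (f : smoothRing Ω) (p : Ω) :
    HasFDerivWithinAt (ext f) (fderivWithin ℝ (ext f) Ω p) Ω p :=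
  ((contDiffOn_ext f).differentiableOn (by simp) p p.2).hasFDerivWithinAt

theorem contDiffOn_fderivWithin_ext (hΩ : IsRegularDomain Ω) (f : smoothRing Ω) (v : V) :
    ContDiffOn ℝ ∞ (fun p => fderivWithin ℝ (ext f) Ω p v) Ω :=
  ((contDiffOn_ext f).fderivWithin hΩ.uniqueDiffOn (by simp)).clm_apply contDiffOn_const

/-- The directional derivative in the direction `v`. -/
def der (hΩ : IsRegularDomain Ω) (v : V) : Derivation ℝ (smoothRing Ω) (smoothRing Ω) :=
  Derivation.mk'
    { toFun := fun f => ofFun _ (contDiffOn_fderivWithin_ext hΩ f v)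
      map_add' := fun f g => hom_ext fun p => by
        have h : HasFDerivWithinAt (ext (f + g)) _ Ω p :=
          ((hasFDerivWithinAt_ext f p).add (hasFDerivWithinAt_ext g p)).congr
            (fun q hq => by
              simp only [Pi.add_apply, ext_apply _ ⟨q, hq⟩, map_add])
            (by simp only [Pi.add_apply, ext_apply, map_add])
        simp only [map_add, ev_ofFun]
        rw [h.fderivWithin (hΩ.uniqueDiffOn p p.2)]
        rfl
      map_smul' := fun c f => hom_ext fun p => by
        have h : HasFDerivWithinAt (ext (c • f)) _ Ω p :=
          ((hasFDerivWithinAt_ext f p).const_smul c).congr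
            (fun q hq => by simp only [Pi.smul_apply, ext_apply _ ⟨q, hq⟩, map_smul])
            (by simp only [Pi.smul_apply, ext_apply, map_smul])
        simp only [map_smul, ev_ofFun]
        rw [h.fderivWithin (hΩ.uniqueDiffOn p p.2)]
        rfl }
    fun f g => hom_ext fun p => by
      have h : HasFDerivWithinAt (ext (f * g)) _ Ω p :=
        ((hasFDerivWithinAt_ext f p).mul (hasFDerivWithinAt_ext g p)).congr
          (fun q hq => by simp only [Pi.mul_apply, ext_apply _ ⟨q, hq⟩, map_mul])
          (by simp only [Pi.mul_apply, ext_apply, map_mul])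
      simp only [LinearMap.coe_mk, AddHom.coe_mk, ev_ofFun, smul_eq_mul, map_add, map_mul]
      rw [h.fderivWithin (hΩ.uniqueDiffOn p p.2)]
      simp [ext_apply]

variable (hΩ : IsRegularDomain Ω)

theorem ev_der (v : V) (f : smoothRing Ω) (p : Ω) :
    ev p (der hΩ v f) = fderivWithin ℝ (ext f) Ω p v := rfl

theorem ev_der_ofFun (v : V) (F : V → ℝ) (hF : ContDiffOn ℝ ∞ F Ω) (p : Ω) :
    ev p (der hΩ v (ofFun F hF)) = fderivWithin ℝ F Ω p v := by
  rw [ev_der, fderivWithin_congr (eqOn_ext_ofFun F hF) (eqOn_ext_ofFun F hF p.2)]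

/-- Second derivatives within `Ω` are symmetric also at boundary points, in particular at the end
times, because these lie in the closure of the interior. -/
theorem der_comm (v w : V) (f : smoothRing Ω) :
    der hΩ v (der hΩ w f) = der hΩ w (der hΩ v f) := by
  refine hom_ext fun p => ?_
  have h2 : DifferentiableWithinAt ℝ (fderivWithin ℝ (ext f) Ω) Ω p :=
    ((contDiffOn_ext f).fderivWithin (m := ∞) hΩ.uniqueDiffOn (by simp)).differentiableOn
      (by simp) p p.2
  have key : ∀ v w, ev p (der hΩ v (der hΩ w f)) =
      fderivWithin ℝ (fderivWithin ℝ (ext f) Ω) Ω p v w := by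
    intro v w
    change ev p (der hΩ v (ofFun _ (contDiffOn_fderivWithin_ext hΩ f w))) = _
    rw [ev_der_ofFun]
    have h3 := (h2.hasFDerivWithinAt.clm_apply
      (hasFDerivWithinAt_const w (p : V) Ω)).fderivWithin (hΩ.uniqueDiffOn p p.2)
    rw [h3]
    simp
  have hs : IsSymmSndFDerivWithinAt ℝ (ext f) Ω p :=
    ((contDiffOn_ext f) p p.2).isSymmSndFDerivWithinAt
      (by rw [minSmoothness_of_isRCLikeNormedField]; exact ENat.LEInfty.out) hΩ.uniqueDiffOn
      (hΩ.subset_closure p.2) p.2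
  rw [key, key]
  exact hs v w

/-- The pull-back of functions under a smooth map. -/
def pull (Φ : V' → V) (hΦ : ContDiffOn ℝ ∞ Φ Ω') (hm : MapsTo Φ Ω' Ω) :
    smoothRing Ω →ₐ[ℝ] smoothRing Ω' where
  toFun f := ofFun (fun p => ext f (Φ p)) ((contDiffOn_ext f).comp hΦ hm)
  map_one' := hom_ext fun p => by
    rw [ev_ofFun, ext_apply _ ⟨Φ p, hm p.2⟩, map_one, map_one]
  map_mul' f g := hom_ext fun p => by
    simp only [ev_ofFun, map_mul, ext_apply _ ⟨Φ p, hm p.2⟩]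
  map_zero' := hom_ext fun p => by
    rw [ev_ofFun, ext_apply _ ⟨Φ p, hm p.2⟩, map_zero, map_zero]
  map_add' f g := hom_ext fun p => by
    simp only [ev_ofFun, map_add, ext_apply _ ⟨Φ p, hm p.2⟩]
  commutes' r := hom_ext fun p => by
    rw [ev_ofFun, ext_apply _ ⟨Φ p, hm p.2⟩, AlgHom.commutes, AlgHom.commutes]

theorem ev_pull (Φ : V' → V) (hΦ : ContDiffOn ℝ ∞ Φ Ω') (hm : MapsTo Φ Ω' Ω)
    (f : smoothRing Ω) (p : Ω') : ev p (pull Φ hΦ hm f) = ev ⟨Φ p, hm p.2⟩ f :=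
  ext_apply f ⟨Φ p, hm p.2⟩

theorem exists_mul_eq_one (f : smoothRing Ω) (hf : ∀ p, ev p f ≠ 0) :
    ∃ g : smoothRing Ω, f * g = 1 := by
  refine ⟨ofFun (fun p => (ext f p)⁻¹) ((contDiffOn_ext f).inv fun p hp => ?_), ?_⟩
  · rw [ext_apply f ⟨p, hp⟩]; exact hf _
  · refine hom_ext fun p => ?_
    rw [map_mul, ev_ofFun, ext_apply, map_one, mul_inv_cancel₀ (hf p)]

/-- The square root of a positive function. -/
def sqrt (f : smoothRing Ω) (hf : ∀ p, 0 < ev p f) : smoothRing Ω :=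
  ofFun (fun p => √(ext f p)) ((contDiffOn_ext f).sqrt fun p hp => by
    rw [ext_apply f ⟨p, hp⟩]; exact (hf _).ne')

theorem ev_sqrt (f : smoothRing Ω) (hf : ∀ p, 0 < ev p f) (p : Ω) :
    ev p (sqrt f hf) = √(ev p f) := by rw [sqrt, ev_ofFun, ext_apply]

theorem sqrt_mul_sqrt (f : smoothRing Ω) (hf : ∀ p, 0 < ev p f) :
    sqrt f hf * sqrt f hf = f :=
  hom_ext fun p => by rw [map_mul, ev_sqrt, Real.mul_self_sqrt (hf p).le]

section Matrix

variable {ι : Type*} [Fintype ι] [DecidableEq ι]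

theorem ev_det (p : Ω) (G : Matrix ι ι (smoothRing Ω)) :
    ev p G.det = (G.map (ev p)).det := (ev p).map_det G

theorem exists_matrix_inverse (G : Matrix ι ι (smoothRing Ω))
    (hG : ∀ p, (G.map (ev p)).det ≠ 0) : ∃ H, G * H = 1 := by
  obtain ⟨g, hg⟩ := exists_mul_eq_one G.det fun p => by rw [ev_det]; exact hG p
  refine ⟨g • G.adjugate, ?_⟩
  rw [Matrix.mul_smul, Matrix.mul_adjugate, smul_smul, mul_comm, hg, one_smul]

theorem map_ev_inverse {G H : Matrix ι ι (smoothRing Ω)} (h : G * H = 1) (p : Ω) :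
    H.map (ev p) = (G.map (ev p))⁻¹ := by
  refine (Matrix.inv_eq_right_inv ?_).symm
  rw [← Matrix.map_mul, h, Matrix.map_one _ (map_zero _) (map_one _)]

end Matrix

section Product

variable {S : Set ℝ} {U : Set V} (hΩ : IsRegularDomain (S ×ˢ U)) (hU : IsOpen U)

include hU in
-- Since `U` is open, spatial derivatives are unrestricted even at the end times; only time
-- derivatives are taken within `S`.
theorem hasFDerivAt_slice (f : smoothRing (S ×ˢ U)) (p : ↥(S ×ˢ U)) :
    HasFDerivAt (fun y => ext f (p.1.1, y))
      ((fderivWithin ℝ (ext f) (S ×ˢ U) p).comp (ContinuousLinearMap.inr ℝ ℝ V)) p.1.2 := by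
  have h1 : HasFDerivAt (fun y : V => (p.1.1, y)) (ContinuousLinearMap.inr ℝ ℝ V) p.1.2 :=
    hasFDerivAt_prodMk_right _ _
  have h2 := (hasFDerivWithinAt_ext f p).comp p.1.2 (h1.hasFDerivWithinAt (s := U))
    (fun y (hy : y ∈ U) => mk_mem_prod p.2.1 hy)
  exact h2.hasFDerivAt (hU.mem_nhds p.2.2)

theorem hasDerivWithinAt_slice (f : smoothRing (S ×ˢ U)) (p : ↥(S ×ˢ U)) :
    HasDerivWithinAt (fun s => ext f (s, p.1.2)) (ev p (der hΩ (1, 0) f)) S p.1.1 := by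
  have h1 : HasDerivWithinAt (fun s : ℝ => (s, p.1.2)) ((1, 0) : ℝ × V) S p.1.1 :=
    (hasDerivWithinAt_id _ _).prodMk (hasDerivWithinAt_const _ _ _)
  exact (hasFDerivWithinAt_ext f p).comp_hasDerivWithinAt p.1.1 h1
    (fun s (hs : s ∈ S) => mk_mem_prod hs p.2.2)

end Product

end SmoothRing

/-! ### Coordinate fields, transition maps and smoothness in charts. -/

namespace LMinus

section Charts

set_option linter.unusedSectionVars false

variable {n : ℕ} {M : Type*} [TopologicalSpace M] [ChartedSpace (E n) M]
  [IsManifold (𝓡 n) ∞ M]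

/-- The tangent space at `x` is identified with ℝⁿ by the chart at `x`, so at the centre of that
chart the coordinate vectors are the standard basis. The agreement is not available at other points
of the chart. -/
theorem coordVec_self (x : M) (i : Fin n) :
    (coordVec x (extChartAt (𝓡 n) x x) i : E n) = EuclideanSpace.single i (1 : ℝ) := by
  have h := mfderivWithin_range_extChartAt_symm (I := 𝓡 n) (x := x)
  rw [ModelWithCorners.range_eq_univ, mfderivWithin_univ] at h
  have h2 := DFunLike.congr_fun h (EuclideanSpace.single i (1 : ℝ) : E n)
  exact h2

theorem coords_self (x : M) (v : TangentSpace (𝓡 n) x) (i : Fin n) :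
    coords x v i = (show E n from v) i := by
  have h := mfderiv_extChartAt_self (I := 𝓡 n) (x := x)
  have h2 := DFunLike.congr_fun h v
  unfold coords
  exact congrArg (fun u : E n => u i) h2

/-- All tangent spaces are the same type `E n`, so the base point can be replaced by an equal one
while the vectors stay untouched. -/
theorem inner_congr (g : Metric n M) {z z' : M} (h : z = z') (v w : E n) :
    g.inner z v w = g.inner z' v w := by subst h; rfl

/-- The domain of the change of coordinates from the chart at `x` to the chart at `x₀`. -/
def overlap (n : ℕ) {M : Type*} [TopologicalSpace M] [ChartedSpace (E n) M] (x x₀ : M) :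
    Set (E n) :=
  (extChartAt (𝓡 n) x).target ∩ (extChartAt (𝓡 n) x).symm ⁻¹' (extChartAt (𝓡 n) x₀).source

/-- The change of coordinates from the chart at `x` to the chart at `x₀`. -/
def transition (n : ℕ) {M : Type*} [TopologicalSpace M] [ChartedSpace (E n) M] (x x₀ : M)
    (y : E n) : E n :=
  extChartAt (𝓡 n) x₀ ((extChartAt (𝓡 n) x).symm y)

theorem isOpen_overlap (x x₀ : M) : IsOpen (overlap n x x₀) :=
  (continuousOn_extChartAt_symm x).isOpen_inter_preimage (isOpen_extChartAt_target x)
    (isOpen_extChartAt_source x₀)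

theorem contDiffOn_transition (x x₀ : M) :
    ContDiffOn ℝ ∞ (transition n x x₀) (overlap n x x₀) := by
  refine (contDiffOn_ext_coord_change (I := 𝓡 n) (n := ∞) x₀ x).mono ?_
  intro y hy
  rw [PartialEquiv.trans_source]
  exact hy

theorem mapsTo_transition (x x₀ : M) :
    MapsTo (transition n x x₀) (overlap n x x₀) (extChartAt (𝓡 n) x₀).target :=
  fun _ hy => (extChartAt (𝓡 n) x₀).map_source hy.2

theorem symm_transition (x x₀ : M) {y : E n} (hy : y ∈ overlap n x x₀) :
    (extChartAt (𝓡 n) x₀).symm (transition n x x₀ y) = (extChartAt (𝓡 n) x).symm y :=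
  (extChartAt (𝓡 n) x₀).left_inv hy.2

theorem transition_transition (x x₀ : M) {y : E n} (hy : y ∈ overlap n x x₀) :
    transition n x₀ x (transition n x x₀ y) = y := by
  rw [transition, symm_transition x x₀ hy, (extChartAt (𝓡 n) x).right_inv hy.1]

theorem mapsTo_transition_overlap (x x₀ : M) :
    MapsTo (transition n x x₀) (overlap n x x₀) (overlap n x₀ x) := fun y hy =>
  ⟨mapsTo_transition x x₀ hy, by
    rw [mem_preimage, symm_transition x x₀ hy]; exact (extChartAt (𝓡 n) x).map_target hy.1⟩

theorem mdifferentiableAt_symm (x₀ : M) {y : E n} (hy : y ∈ (extChartAt (𝓡 n) x₀).target) :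
    MDifferentiableAt 𝓘(ℝ, E n) (𝓡 n) (extChartAt (𝓡 n) x₀).symm y := by
  have h := mdifferentiableWithinAt_extChartAt_symm hy
  rwa [ModelWithCorners.range_eq_univ, mdifferentiableWithinAt_univ] at h

theorem differentiableAt_transition (x x₀ : M) {y : E n} (hy : y ∈ overlap n x x₀) :
    DifferentiableAt ℝ (transition n x x₀) y :=
  ((contDiffOn_transition x x₀).differentiableOn (by simp)).differentiableAt
    ((isOpen_overlap x x₀).mem_nhds hy)

theorem sum_smul_single (w : E n) : w = ∑ a, w a • (EuclideanSpace.single a (1 : ℝ) : E n) := by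
  ext j
  simp [Finset.sum_apply, Pi.single_apply]

theorem map_eq_sum (L : E n →L[ℝ] E n) (w : E n) :
    L w = ∑ a, w a • L (EuclideanSpace.single a (1 : ℝ)) := by
  conv_lhs => rw [sum_smul_single w, map_sum]
  exact Finset.sum_congr rfl fun a _ => map_smul _ _ _

theorem coordVec_change (x x₀ : M) {y : E n} (hy : y ∈ overlap n x x₀) (i : Fin n) :
    (coordVec x y i : E n) =
      ∑ a, (fderiv ℝ (transition n x x₀) y (EuclideanSpace.single i 1)) a •
        (coordVec x₀ (transition n x x₀ y) a : E n) := by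
  have h1 : (extChartAt (𝓡 n) x).symm =ᶠ[nhds y]
      (extChartAt (𝓡 n) x₀).symm ∘ transition n x x₀ := by
    filter_upwards [(isOpen_overlap x x₀).mem_nhds hy] with z hz
    exact (symm_transition x x₀ hz).symm
  have h2 : (mfderiv 𝓘(ℝ, E n) (𝓡 n) (extChartAt (𝓡 n) x).symm y : E n →L[ℝ] E n) =
      (mfderiv 𝓘(ℝ, E n) (𝓡 n) (extChartAt (𝓡 n) x₀).symm (transition n x x₀ y) :
        E n →L[ℝ] E n).comp (fderiv ℝ (transition n x x₀) y) := by
    have h3 := mfderiv_comp (I := 𝓘(ℝ, E n)) (I' := 𝓘(ℝ, E n)) (I'' := 𝓡 n) y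
      (mdifferentiableAt_symm x₀ (mapsTo_transition x x₀ hy))
      (differentiableAt_transition x x₀ hy).mdifferentiableAt
    rw [mfderiv_eq_fderiv] at h3
    exact h1.mfderiv_eq.trans h3
  have h4 := DFunLike.congr_fun h2 (EuclideanSpace.single i (1 : ℝ) : E n)
  exact h4.trans (map_eq_sum (mfderiv 𝓘(ℝ, E n) (𝓡 n) (extChartAt (𝓡 n) x₀).symm
    (transition n x x₀ y) : E n →L[ℝ] E n) _)

theorem dif_coordVec (f : M → ℝ) (x₀ : M) {y : E n} (hy : y ∈ (extChartAt (𝓡 n) x₀).target)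
    (hf : MDifferentiableAt (𝓡 n) 𝓘(ℝ, ℝ) f ((extChartAt (𝓡 n) x₀).symm y)) (i : Fin n) :
    dif f ((extChartAt (𝓡 n) x₀).symm y) (coordVec x₀ y i) =
      pd i (fun z => f ((extChartAt (𝓡 n) x₀).symm z)) y := by
  have h3 := mfderiv_comp (I := 𝓘(ℝ, E n)) (I' := 𝓡 n) (I'' := 𝓘(ℝ, ℝ)) y hf
    (mdifferentiableAt_symm x₀ hy)
  rw [mfderiv_eq_fderiv] at h3
  exact (DFunLike.congr_fun h3 (EuclideanSpace.single i (1 : ℝ) : E n)).symm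

theorem chartMetric_symm (g : Metric n M) (x₀ : M) (y : E n) (i j : Fin n) :
    chartMetric g x₀ y i j = chartMetric g x₀ y j i := g.symm _ _ _

theorem chartMetric_self (g : Metric n M) (x : M) :
    chartMetric g x (extChartAt (𝓡 n) x x) = gram g x := by
  ext i j
  have h := inner_congr g (extChartAt_to_inv (I := 𝓡 n) x)
    (EuclideanSpace.single i (1 : ℝ)) (EuclideanSpace.single j (1 : ℝ))
  refine Eq.trans ?_ h
  exact congrArg₂ (fun v w : E n => g.inner _ v w) (coordVec_self x i) (coordVec_self x j)

theorem chartMetric_change (g : Metric n M) (x x₀ : M) {y : E n} (hy : y ∈ overlap n x x₀)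
    (i j : Fin n) : chartMetric g x y i j =
      ∑ a, ∑ b, (fderiv ℝ (transition n x x₀) y (EuclideanSpace.single i 1)) a *
        (fderiv ℝ (transition n x x₀) y (EuclideanSpace.single j 1)) b *
        chartMetric g x₀ (transition n x x₀ y) a b := by
  have h0 : chartMetric g x y i j = g.inner ((extChartAt (𝓡 n) x₀).symm (transition n x x₀ y))
      (coordVec x y i : E n) (coordVec x y j : E n) :=
    inner_congr g (symm_transition x x₀ hy).symm _ _
  rw [h0, coordVec_change x x₀ hy i, coordVec_change x x₀ hy j]
  generalize (fderiv ℝ (transition n x x₀) y (EuclideanSpace.single i 1)) = u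
  generalize (fderiv ℝ (transition n x x₀) y (EuclideanSpace.single j 1)) = v
  let B : E n →L[ℝ] E n →L[ℝ] ℝ :=
    g.inner ((extChartAt (𝓡 n) x₀).symm (transition n x x₀ y))
  have h1 : ∀ p q : Fin n → E n, B (∑ a, u a • p a) (∑ b, v b • q b) =
      ∑ a, ∑ b, u a * v b * B (p a) (q b) := by
    intro p q
    simp only [map_sum, map_smul, sum_apply, smul_apply,
      smul_eq_mul, Finset.mul_sum]
    rw [Finset.sum_comm]
    exact Finset.sum_congr rfl fun _ _ => Finset.sum_congr rfl fun _ _ => by ring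
  exact h1 _ _

theorem coordVec_injective (x₀ : M) {y : E n} (hy : y ∈ (extChartAt (𝓡 n) x₀).target) :
    Function.Injective
      (mfderiv 𝓘(ℝ, E n) (𝓡 n) (extChartAt (𝓡 n) x₀).symm y : E n →L[ℝ] E n) := by
  have h := isInvertible_mfderivWithin_extChartAt_symm (I := 𝓡 n) hy
  rw [ModelWithCorners.range_eq_univ, mfderivWithin_univ] at h
  exact h.injective

open scoped Matrix in
theorem chartMetric_posDef (g : Metric n M) (x₀ : M) {y : E n}
    (hy : y ∈ (extChartAt (𝓡 n) x₀).target) : (chartMetric g x₀ y).PosDef := by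
  refine Matrix.PosDef.of_dotProduct_mulVec_pos ?_ fun v hv => ?_
  · ext i j
    exact chartMetric_symm g x₀ y j i
  · let L : E n →L[ℝ] E n := mfderiv 𝓘(ℝ, E n) (𝓡 n) (extChartAt (𝓡 n) x₀).symm y
    let B : E n →L[ℝ] E n →L[ℝ] ℝ := g.inner ((extChartAt (𝓡 n) x₀).symm y)
    let w : E n := WithLp.toLp 2 v
    have hw : L w ≠ 0 := by
      intro h0
      have : w = 0 := coordVec_injective x₀ hy (h0.trans (map_zero L).symm)
      exact hv (by simpa [w] using this)
    have hpos : 0 < B (L w) (L w) := g.pos _ _ hw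
    have h2 : B (L w) (L w) = star v ⬝ᵥ (chartMetric g x₀ y *ᵥ v) := by
      have h3 : L w = ∑ a, v a • L (EuclideanSpace.single a 1) := map_eq_sum L w
      rw [h3]
      simp only [map_sum, map_smul, sum_apply, smul_apply,
        smul_eq_mul, Finset.mul_sum, dotProduct, Matrix.mulVec, star_trivial]
      rw [Finset.sum_comm]
      refine Finset.sum_congr rfl fun a _ => Finset.sum_congr rfl fun b _ => ?_
      change _ = v a * (B (L (EuclideanSpace.single a 1)) (L (EuclideanSpace.single b 1)) * v b)
      ring
    rw [← h2]; exact hpos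

theorem contMDiffOn_coordVec (x₀ : M) (i : Fin n) :
    ContMDiffOn 𝓘(ℝ, E n) ((𝓡 n).prod 𝓘(ℝ, E n)) ∞
      (fun y => (TotalSpace.mk' (E n) ((extChartAt (𝓡 n) x₀).symm y) (coordVec x₀ y i) :
        TangentBundle (𝓡 n) M)) (extChartAt (𝓡 n) x₀).target := by
  have h1 : ContMDiffOn 𝓘(ℝ, E n) (𝓡 n) ∞ (extChartAt (𝓡 n) x₀).symm
      (extChartAt (𝓡 n) x₀).target := contMDiffOn_extChartAt_symm x₀
  have ho := isOpen_extChartAt_target (I := 𝓡 n) x₀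
  have h2 := h1.contMDiffOn_tangentMapWithin (m := ∞) (by simp) ho.uniqueMDiffOn
  have h3 : ContMDiffOn 𝓘(ℝ, E n) (𝓘(ℝ, E n).prod 𝓘(ℝ, E n)) ∞
      (fun y : E n => (TotalSpace.mk' (E n) y (EuclideanSpace.single i (1 : ℝ) : E n) :
        TangentBundle 𝓘(ℝ, E n) (E n))) (extChartAt (𝓡 n) x₀).target :=
    contMDiffOn_vectorSpace_iff_contDiffOn.2 contDiffOn_const
  refine (h2.comp h3 fun y hy => hy).congr fun y hy => ?_
  simp only [Function.comp_apply, tangentMapWithin, mfderivWithin_of_isOpen ho hy]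
  rfl

/-- `g` is a smooth family of metrics, parametrized by `τ ∈ S`. -/
def IsSmoothMetricFamily (g : ℝ → Metric n M) (S : Set ℝ) : Prop :=
  ContMDiffOn (𝓘(ℝ, ℝ).prod (𝓡 n)) ((𝓡 n).prod 𝓘(ℝ, E n →L[ℝ] E n →L[ℝ] ℝ)) ∞
    (fun p : ℝ × M => TotalSpace.mk' (E n →L[ℝ] E n →L[ℝ] ℝ)
      (E := fun x : M => TangentSpace (𝓡 n) x →L[ℝ] TangentSpace (𝓡 n) x →L[ℝ] ℝ)
      p.2 ((g p.1).inner p.2)) (S ×ˢ univ)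

theorem contDiffOn_chartMetric {g : ℝ → Metric n M} {S : Set ℝ} (hg : IsSmoothMetricFamily g S)
    (x₀ : M) (i j : Fin n) :
    ContDiffOn ℝ ∞ (fun p : ℝ × E n => chartMetric (g p.1) x₀ p.2 i j)
      (S ×ˢ (extChartAt (𝓡 n) x₀).target) := by
  have h1 : ContMDiffOn 𝓘(ℝ, E n) (𝓡 n) ∞ (extChartAt (𝓡 n) x₀).symm
      (extChartAt (𝓡 n) x₀).target := contMDiffOn_extChartAt_symm x₀
  have hsnd : ContMDiffOn 𝓘(ℝ, ℝ × E n) 𝓘(ℝ, E n) ∞ (fun p : ℝ × E n => p.2)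
      (S ×ˢ (extChartAt (𝓡 n) x₀).target) := contDiff_snd.contMDiff.contMDiffOn
  have hfst : ContMDiffOn 𝓘(ℝ, ℝ × E n) 𝓘(ℝ, ℝ) ∞ (fun p : ℝ × E n => p.1)
      (S ×ˢ (extChartAt (𝓡 n) x₀).target) := contDiff_fst.contMDiff.contMDiffOn
  have hb := h1.comp hsnd fun p hp => hp.2
  have h2 : ContMDiffOn 𝓘(ℝ, ℝ × E n) ((𝓡 n).prod 𝓘(ℝ, E n →L[ℝ] E n →L[ℝ] ℝ)) ∞
      (fun p : ℝ × E n => TotalSpace.mk' (E n →L[ℝ] E n →L[ℝ] ℝ)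
        (E := fun x : M => TangentSpace (𝓡 n) x →L[ℝ] TangentSpace (𝓡 n) x →L[ℝ] ℝ)
        ((extChartAt (𝓡 n) x₀).symm p.2) ((g p.1).inner ((extChartAt (𝓡 n) x₀).symm p.2)))
      (S ×ˢ (extChartAt (𝓡 n) x₀).target) :=
    ContMDiffOn.comp hg (hfst.prodMk hb) fun p hp => ⟨hp.1, mem_univ _⟩
  have hv : ∀ k, ContMDiffOn 𝓘(ℝ, ℝ × E n) ((𝓡 n).prod 𝓘(ℝ, E n)) ∞
      (fun p : ℝ × E n => (TotalSpace.mk' (E n) ((extChartAt (𝓡 n) x₀).symm p.2)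
        (coordVec x₀ p.2 k) : TangentBundle (𝓡 n) M))
      (S ×ˢ (extChartAt (𝓡 n) x₀).target) :=
    fun k => (contMDiffOn_coordVec x₀ k).comp hsnd fun p hp => hp.2
  rw [← contMDiffOn_iff_contDiffOn]
  intro p hp
  have h3 : ContMDiffWithinAt 𝓘(ℝ, ℝ × E n) ((𝓡 n).prod 𝓘(ℝ)) ∞
      (fun m : ℝ × E n => TotalSpace.mk' ℝ (E := Bundle.Trivial M ℝ)
        ((extChartAt (𝓡 n) x₀).symm m.2)
        ((g m.1).inner ((extChartAt (𝓡 n) x₀).symm m.2) (coordVec x₀ m.2 i) (coordVec x₀ m.2 j)))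
      (S ×ˢ (extChartAt (𝓡 n) x₀).target) p :=
    ContMDiffWithinAt.clm_bundle_apply₂ (F₁ := E n) (F₂ := E n) (h2 p hp) (hv i p hp) (hv j p hp)
  simp only [contMDiffWithinAt_totalSpace] at h3
  exact h3.2

theorem contDiffOn_chart_of_isSmoothFamily {f : ℝ → M → ℝ} {S : Set ℝ} (hf : IsSmoothFamily n f S)
    (x₀ : M) : ContDiffOn ℝ ∞ (fun p : ℝ × E n => f p.1 ((extChartAt (𝓡 n) x₀).symm p.2))
      (S ×ˢ (extChartAt (𝓡 n) x₀).target) := by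
  have h1 : ContMDiffOn 𝓘(ℝ, E n) (𝓡 n) ∞ (extChartAt (𝓡 n) x₀).symm
      (extChartAt (𝓡 n) x₀).target := contMDiffOn_extChartAt_symm x₀
  have hsnd : ContMDiffOn 𝓘(ℝ, ℝ × E n) 𝓘(ℝ, E n) ∞ (fun p : ℝ × E n => p.2)
      (S ×ˢ (extChartAt (𝓡 n) x₀).target) := contDiff_snd.contMDiff.contMDiffOn
  have hfst : ContMDiffOn 𝓘(ℝ, ℝ × E n) 𝓘(ℝ, ℝ) ∞ (fun p : ℝ × E n => p.1)
      (S ×ˢ (extChartAt (𝓡 n) x₀).target) := contDiff_fst.contMDiff.contMDiffOn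
  rw [← contMDiffOn_iff_contDiffOn]
  exact ContMDiffOn.comp hf (hfst.prodMk (h1.comp hsnd fun p hp => hp.2))
    fun p hp => ⟨hp.1, mem_univ _⟩

theorem isSmoothFamily_of_chart {f : ℝ → M → ℝ} {S : Set ℝ}
    (hf : ∀ x₀ : M, ContDiffOn ℝ ∞ (fun p : ℝ × E n => f p.1 ((extChartAt (𝓡 n) x₀).symm p.2))
      (S ×ˢ (extChartAt (𝓡 n) x₀).target)) : IsSmoothFamily n f S := by
  rintro ⟨τ, x⟩ hp
  have h1 : ContMDiffOn (𝓡 n) 𝓘(ℝ, E n) ∞ (extChartAt (𝓡 n) x) (extChartAt (𝓡 n) x).source := by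
    rw [extChartAt_source]; exact contMDiffOn_extChartAt
  have hsnd : ContMDiffOn (𝓘(ℝ, ℝ).prod (𝓡 n)) (𝓡 n) ∞ (fun p : ℝ × M => p.2)
      (S ×ˢ (extChartAt (𝓡 n) x).source) := contMDiff_snd.contMDiffOn
  have hfst : ContMDiffOn (𝓘(ℝ, ℝ).prod (𝓡 n)) 𝓘(ℝ, ℝ) ∞ (fun p : ℝ × M => p.1)
      (S ×ˢ (extChartAt (𝓡 n) x).source) := contMDiff_fst.contMDiffOn
  have h2 := ((contMDiffOn_iff_contDiffOn.2 (hf x)).comp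
    (hfst.prodMk_space (h1.comp hsnd fun p hp => hp.2)) fun p hp =>
      ⟨hp.1, (extChartAt (𝓡 n) x).map_source hp.2⟩)
  have h3 : ContMDiffOn (𝓘(ℝ, ℝ).prod (𝓡 n)) 𝓘(ℝ, ℝ) ∞ (fun p : ℝ × M => f p.1 p.2)
      (S ×ˢ (extChartAt (𝓡 n) x).source) := by
    refine h2.congr fun p hp => ?_
    simp only [Function.comp_apply, (extChartAt (𝓡 n) x).left_inv hp.2]
  refine (h3 (τ, x) ⟨hp.1, mem_extChartAt_source x⟩).mono_of_mem_nhdsWithin ?_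
  have : univ ×ˢ (extChartAt (𝓡 n) x).source ∈ nhds (τ, x) :=
    prod_mem_nhds Filter.univ_mem (extChartAt_source_mem_nhds x)
  filter_upwards [mem_nhdsWithin_of_mem_nhds this, self_mem_nhdsWithin] with p h4 h5
  exact ⟨h5.1, h4.2⟩

end Charts

end LMinus

/-! ### Dictionary between coordinate expressions and the ring of smooth functions. -/

namespace LMinus

open SmoothRing CoordGeom

section ChartRing

set_option linter.unusedSectionVars false

variable {n : ℕ} {M : Type*} [TopologicalSpace M] [ChartedSpace (E n) M]
  [IsManifold (𝓡 n) ∞ M] {a b : ℝ} {U : Set (E n)}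

/-- The partial derivatives of functions on `[a, b] × U`. -/
def dx (hab : a < b) (hU : IsOpen U) (i : Fin n) :
    Derivation ℝ (smoothRing (Icc a b ×ˢ U)) (smoothRing (Icc a b ×ˢ U)) :=
  der (isRegularDomain_Icc_prod hab hU) (0, EuclideanSpace.single i 1)

/-- The time derivative of functions on `[a, b] × U`. -/
def dτ (hab : a < b) (hU : IsOpen U) :
    Derivation ℝ (smoothRing (Icc a b ×ˢ U)) (smoothRing (Icc a b ×ˢ U)) :=
  der (isRegularDomain_Icc_prod hab hU) (1, 0)

/-- A point of `[a, b] × U`. -/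
def pt {τ : ℝ} {y : E n} (hτ : τ ∈ Icc a b) (hy : y ∈ U) : ↥(Icc a b ×ˢ U) := ⟨(τ, y), hτ, hy⟩

variable (hab : a < b) (hU : IsOpen U) {τ : ℝ} (hτ : τ ∈ Icc a b) {y : E n} (hy : y ∈ U)

include hU hy in
theorem hasFDerivAt_of_ev (f : smoothRing (Icc a b ×ˢ U)) (F : E n → ℝ)
    (hF : ∀ z (hz : z ∈ U), F z = ev (pt hτ hz) f) :
    HasFDerivAt F ((fderivWithin ℝ (ext f) (Icc a b ×ˢ U) (τ, y)).comp
      (ContinuousLinearMap.inr ℝ ℝ (E n))) y := by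
  refine (hasFDerivAt_slice hU f (pt hτ hy)).congr_of_eventuallyEq ?_
  filter_upwards [hU.mem_nhds hy] with z hz
  rw [hF z hz, ← ext_apply]; rfl

/-- The passage from the analytic `pd` to the algebraic derivations. Agreement on the open set `U`
suffices, so values outside the chart do no harm. -/
theorem pd_eq_ev (f : smoothRing (Icc a b ×ˢ U)) (F : E n → ℝ)
    (hF : ∀ z (hz : z ∈ U), F z = ev (pt hτ hz) f) (i : Fin n) :
    pd i F y = ev (pt hτ hy) (dx hab hU i f) := by
  rw [pd, (hasFDerivAt_of_ev hU hτ hy f F hF).fderiv, dx, ev_der]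
  rfl

theorem hasDerivWithinAt_of_ev (f : smoothRing (Icc a b ×ˢ U)) (F : ℝ → ℝ)
    (hF : ∀ s (hs : s ∈ Icc a b), F s = ev (pt hs hy) f) :
    HasDerivWithinAt F (ev (pt hτ hy) (dτ hab hU f)) (Icc a b) τ := by
  refine (hasDerivWithinAt_slice (isRegularDomain_Icc_prod hab hU) f (pt hτ hy)).congr
    (fun s hs => ?_) ?_
  · rw [hF s hs, ← ext_apply]; rfl
  · exact (hF τ hτ).trans (ext_apply f (pt hτ hy)).symm

variable {g : ℝ → Metric n M}
  (hg : IsSmoothMetricFamily g (Icc a b))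
  {x₀ : M} (hUx : U ⊆ (extChartAt (𝓡 n) x₀).target)

/-- The metric coefficients in a chart. -/
def chartG : Matrix (Fin n) (Fin n) (smoothRing (Icc a b ×ˢ U)) := Matrix.of fun i j =>
  ofFun (fun p => chartMetric (g p.1) x₀ p.2 i j)
    ((contDiffOn_chartMetric hg x₀ i j).mono (prod_mono_right hUx))

theorem map_ev_chartG (p : ↥(Icc a b ×ˢ U)) :
    (chartG hg hUx).map (ev p) = chartMetric (g p.1.1) x₀ p.1.2 := rfl

theorem det_chartG_pos (p : ↥(Icc a b ×ˢ U)) : 0 < ev p (chartG hg hUx).det := by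
  rw [ev_det, map_ev_chartG]
  exact (chartMetric_posDef _ _ (hUx p.2.2)).det_pos

theorem exists_chartH : ∃ H, chartG hg hUx * H = 1 :=
  exists_matrix_inverse _ fun p => by rw [← ev_det]; exact (det_chartG_pos hg hUx p).ne'

/-- The inverse metric coefficients in a chart. -/
def chartH : Matrix (Fin n) (Fin n) (smoothRing (Icc a b ×ˢ U)) := (exists_chartH hg hUx).choose

theorem chartG_mul_chartH : chartG hg hUx * chartH hg hUx = 1 := (exists_chartH hg hUx).choose_spec

theorem ev_chartH (i j : Fin n) :
    ev (pt hτ hy) (chartH hg hUx i j) = (chartMetric (g τ) x₀ y)⁻¹ i j := by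
  have h := map_ev_inverse (chartG_mul_chartH hg hUx) (pt hτ hy)
  exact congrFun (congrFun h i) j

theorem isMetric_chart : IsMetric (dx hab hU) (chartG hg hUx) (chartH hg hUx) where
  comm _ _ _ := der_comm _ _ _ _
  symm _ _ := hom_ext fun _ => chartMetric_symm _ _ _ _ _
  inv := chartG_mul_chartH hg hUx

theorem christoffel_eq (k i j : Fin n) : christoffel (chartMetric (g τ) x₀) k i j y =
    ev (pt hτ hy) (chr (dx hab hU) (chartG hg hUx) (chartH hg hUx) k i j) := by
  have h : ∀ l i j, pd l (fun z => chartMetric (g τ) x₀ z i j) y =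
      ev (pt hτ hy) (dx hab hU l (chartG hg hUx i j)) := fun l i j =>
    pd_eq_ev hab hU hτ hy _ _ (fun z hz => rfl) l
  simp only [christoffel, chr, map_mul, map_sum, map_sub, map_add, ev_chartH, h, AlgHom.commutes]
  rfl

theorem ricciCoord_eq (i j : Fin n) : ricciCoord (chartMetric (g τ) x₀) i j y =
    ev (pt hτ hy) (ric (dx hab hU) (chartG hg hUx) (chartH hg hUx) i j) := by
  have h : ∀ l k i j, pd l (christoffel (chartMetric (g τ) x₀) k i j) y =
      ev (pt hτ hy) (dx hab hU l (chr (dx hab hU) (chartG hg hUx) (chartH hg hUx) k i j)) :=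
    fun l k i j => pd_eq_ev hab hU hτ hy _ _ (fun z hz => christoffel_eq hab hU hτ hz hg hUx k i j) l
  simp only [ricciCoord, ric, Matrix.of_apply, map_sum, map_add, map_sub, map_mul, h,
    christoffel_eq hab hU hτ hy hg hUx]

theorem covDerivCoord_eq (α : Fin n → smoothRing (Icc a b ×ˢ U)) (α' : Fin n → E n → ℝ)
    (h : ∀ k z (hz : z ∈ U), α' k z = ev (pt hτ hz) (α k)) (i j : Fin n) :
    covDerivCoord (chartMetric (g τ) x₀) α' i j y =
      ev (pt hτ hy) (covForm (dx hab hU) (chartG hg hUx) (chartH hg hUx) α i j) := by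
  simp only [covDerivCoord, covForm, Matrix.of_apply, map_sub, map_sum, map_mul,
    pd_eq_ev hab hU hτ hy _ _ (h j) i, christoffel_eq hab hU hτ hy hg hUx, h _ y hy]

/-- A smooth family of functions in a chart. -/
def chartF {f : ℝ → M → ℝ} (hf : IsSmoothFamily n f (Icc a b)) :
    smoothRing (Icc a b ×ˢ U) :=
  ofFun (fun p => f p.1 ((extChartAt (𝓡 n) x₀).symm p.2))
    ((contDiffOn_chart_of_isSmoothFamily hf x₀).mono (prod_mono_right hUx))

theorem ev_chartF {f : ℝ → M → ℝ} (hf : IsSmoothFamily n f (Icc a b)) :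
    ev (pt hτ hy) (chartF hUx hf) = f τ ((extChartAt (𝓡 n) x₀).symm y) := rfl

theorem mdifferentiable_of_isSmoothFamily {f : ℝ → M → ℝ} (hf : IsSmoothFamily n f (Icc a b))
    (hτ : τ ∈ Icc a b) : MDifferentiable (𝓡 n) 𝓘(ℝ, ℝ) (f τ) := by
  have h0 : ContMDiffOn (𝓘(ℝ, ℝ).prod (𝓡 n)) 𝓘(ℝ, ℝ) ∞ (fun p : ℝ × M => f p.1 p.2)
    (Icc a b ×ˢ univ) := hf
  have h1 : ContMDiffOn (𝓡 n) 𝓘(ℝ, ℝ) ∞ (f τ) univ :=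
    h0.comp (contMDiff_const.prodMk contMDiff_id).contMDiffOn
      fun x _ => mk_mem_prod hτ (mem_univ _)
  exact (contMDiffOn_univ.1 h1).mdifferentiable (by simp)

theorem dif_eq {f : ℝ → M → ℝ} (hf : IsSmoothFamily n f (Icc a b)) (i : Fin n) :
    dif (f τ) ((extChartAt (𝓡 n) x₀).symm y) (coordVec x₀ y i) =
      ev (pt hτ hy) (dx hab hU i (chartF hUx hf)) := by
  rw [dif_coordVec _ _ (hUx hy) (mdifferentiable_of_isSmoothFamily hf hτ _)]
  exact pd_eq_ev hab hU hτ hy _ _ (fun z hz => rfl) i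

end ChartRing

/-! ### The tensors of the statement at the centre of a chart. -/

section Center

set_option linter.unusedSectionVars false

variable {n : ℕ} {M : Type*} [TopologicalSpace M] [ChartedSpace (E n) M]
  [IsManifold (𝓡 n) ∞ M] {a b : ℝ} {U : Set (E n)}
  (hab : a < b) (hU : IsOpen U) {τ : ℝ} (hτ : τ ∈ Icc a b) {g : ℝ → Metric n M}
  (hg : IsSmoothMetricFamily g (Icc a b))
  {x : M} (hUx : U ⊆ (extChartAt (𝓡 n) x).target) (hx : extChartAt (𝓡 n) x x ∈ U)

/-- The component of a vector of `ℝⁿ`. -/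
def entry (v : E n) (i : Fin n) : ℝ := v i

theorem coords_eq_entry (v : TangentSpace (𝓡 n) x) (i : Fin n) : coords x v i = entry v i :=
  coords_self x v i

theorem coords_frame (i j : Fin n) : coords x (frame x i) j = if j = i then 1 else 0 := by
  rw [coords_self]
  simp [frame]

theorem sum_coords_frame (B : Fin n → Fin n → ℝ) (k l : Fin n) :
    ∑ i, ∑ j, B i j * coords x (frame x k) i * coords x (frame x l) j = B k l := by
  simp [coords_frame]

theorem inv_gram_eq (i j : Fin n) : (gram (g τ) x)⁻¹ i j = ev (pt hτ hx) (chartH hg hUx i j) := by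
  rw [ev_chartH, chartMetric_self]

theorem inner_frame (i j : Fin n) :
    (g τ).inner x (frame x i) (frame x j) = ev (pt hτ hx) (chartG hg hUx i j) :=
  (congrFun (congrFun (chartMetric_self (g τ) x) i) j).symm

theorem Ric_eq (v w : TangentSpace (𝓡 n) x) : Ric (g τ) x v w =
    ∑ i, ∑ j, ev (pt hτ hx) (ric (dx hab hU) (chartG hg hUx) (chartH hg hUx) i j) *
      entry v i * entry w j := by
  simp only [Ric, coords_eq_entry, ricciCoord_eq hab hU hτ hx hg hUx]

theorem Ric_frame (i j : Fin n) : Ric (g τ) x (frame x i) (frame x j) =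
    ev (pt hτ hx) (ric (dx hab hU) (chartG hg hUx) (chartH hg hUx) i j) := by
  rw [Ric, sum_coords_frame, ricciCoord_eq hab hU hτ hx hg hUx]

theorem trace_eq_ev (B : TangentSpace (𝓡 n) x → TangentSpace (𝓡 n) x → ℝ)
    (T : Matrix (Fin n) (Fin n) (smoothRing (Icc a b ×ˢ U)))
    (hB : ∀ i j, B (frame x i) (frame x j) = ev (pt hτ hx) (T j i)) :
    trace (g τ) x B = ev (pt hτ hx) (chartH hg hUx * T).trace := by
  simp only [trace, Matrix.trace, Matrix.diag, Matrix.mul_apply, map_sum, map_mul, hB,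
    inv_gram_eq hτ hg hUx hx]

/-- `trace` pairs Hᵢⱼ with Ricᵢⱼ, the matrix trace pairs it with Ricⱼᵢ. Symmetry of Ricci is a
consequence of the flow and is therefore an assumption at this stage. -/
theorem scal_eq_ev (hr : ∀ i j, ev (pt hτ hx) (ric (dx hab hU) (chartG hg hUx) (chartH hg hUx) i j) =
      ev (pt hτ hx) (ric (dx hab hU) (chartG hg hUx) (chartH hg hUx) j i)) :
    LMinus.scal (g τ) x =
      ev (pt hτ hx) (CoordGeom.scal (dx hab hU) (chartG hg hUx) (chartH hg hUx)) :=
  trace_eq_ev hτ hg hUx hx _ _ fun i j => by rw [Ric_frame hab hU hτ hg hUx hx, hr]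

theorem dif_frame {f : ℝ → M → ℝ} (hf : IsSmoothFamily n f (Icc a b)) (i : Fin n) :
    dif (f τ) x (frame x i) = ev (pt hτ hx) (dx hab hU i (chartF hUx hf)) := by
  rw [← dif_eq hab hU hτ hx hUx hf]
  -- The chart inverse returns `x` only up to a proved equality, so point and vector are generalized
  -- before substitution.
  have key : ∀ z : M, z = x → ∀ v : E n, v = EuclideanSpace.single i (1 : ℝ) →
      dif (f τ) x (frame x i) = dif (f τ) z v := by
    rintro z rfl v rfl; rfl
  exact key _ (extChartAt_to_inv (I := 𝓡 n) x) _ (coordVec_self x i)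

theorem divGrad_eq_ev {ρ φ : ℝ → M → ℝ} (hρ : IsSmoothFamily n ρ (Icc a b))
    (hφ : IsSmoothFamily n φ (Icc a b)) : divGrad (g τ) (ρ τ) (φ τ) x =
      ev (pt hτ hx) (dvGrad (dx hab hU) (chartG hg hUx) (chartH hg hUx)
        (chartF hUx hρ) (chartF hUx hφ)) := by
  refine trace_eq_ev hτ hg hUx hx _ _ fun i j => ?_
  rw [covDeriv, sum_coords_frame, Matrix.transpose_apply]
  exact covDerivCoord_eq hab hU hτ hx hg hUx
    (fun k => chartF hUx hρ * dx hab hU k (chartF hUx hφ)) _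
    (fun k z hz => by rw [map_mul, dif_eq hab hU hτ hz hUx hφ, ev_chartF]) i j

theorem Hess_frame {φ : ℝ → M → ℝ} (hφ : IsSmoothFamily n φ (Icc a b)) (i j : Fin n) :
    Hess (g τ) (φ τ) x (frame x i) (frame x j) =
      ev (pt hτ hx) (hess (dx hab hU) (chartG hg hUx) (chartH hg hUx) (chartF hUx hφ) i j) := by
  rw [Hess, covDeriv, sum_coords_frame]
  exact covDerivCoord_eq hab hU hτ hx hg hUx
    (fun k => dx hab hU k (chartF hUx hφ)) _
    (fun k z hz => dif_eq hab hU hτ hz hUx hφ k) i j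

theorem grad_eq_ev {φ : ℝ → M → ℝ} (hφ : IsSmoothFamily n φ (Icc a b)) (i : Fin n) :
    entry (grad (g τ) (φ τ) x) i =
      ev (pt hτ hx) (CoordGeom.gradient (dx hab hU) (chartH hg hUx) (chartF hUx hφ) i) := by
  have h : (grad (g τ) (φ τ) x : E n) = ∑ k, ev (pt hτ hx)
      (CoordGeom.gradient (dx hab hU) (chartH hg hUx) (chartF hUx hφ) k) •
      (EuclideanSpace.single k (1 : ℝ) : E n) := by
    refine Finset.sum_congr rfl fun k _ => ?_
    simp only [CoordGeom.gradient, map_sum, map_mul, ← inv_gram_eq hτ hg hUx hx,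
      ← dif_frame hab hU hτ hUx hx hφ]
    rfl
  refine (congrArg (fun w => entry w i) h).trans ?_
  simp [entry, Pi.single_apply]

theorem inner_eq_ev (v w : TangentSpace (𝓡 n) x) : (g τ).inner x v w =
    ∑ i, ∑ j, entry v i * entry w j * ev (pt hτ hx) (chartG hg hUx i j) := by
  let B : E n →L[ℝ] E n →L[ℝ] ℝ := (g τ).inner x
  have h : ∀ v w : E n, B v w = ∑ i, ∑ j, v i * w j *
      B (EuclideanSpace.single i 1) (EuclideanSpace.single j 1) := by
    intro v w
    conv_lhs => rw [sum_smul_single v, sum_smul_single w]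
    simp only [map_sum, map_smul, sum_apply, smul_apply, smul_eq_mul, Finset.mul_sum]
    rw [Finset.sum_comm]
    exact Finset.sum_congr rfl fun _ _ => Finset.sum_congr rfl fun _ _ => by ring
  simp only [← inner_frame hτ hg hUx hx]
  exact h v w

theorem inner_grad_eq_ev {u v : ℝ → M → ℝ} (hu : IsSmoothFamily n u (Icc a b))
    (hv : IsSmoothFamily n v (Icc a b)) :
    (g τ).inner x (grad (g τ) (u τ) x) (grad (g τ) (v τ) x) =
      ev (pt hτ hx) (innerGrad (dx hab hU) (chartH hg hUx) (chartF hUx hu) (chartF hUx hv)) := by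
  have hm := isMetric_chart hab hU hg hUx
  set D := dx hab hU
  set H := chartH hg hUx
  set f := chartF hUx hu
  set k := chartF hUx hv
  have h1 : ∀ i, ∑ j, chartG hg hUx i j * CoordGeom.gradient D H k j = D i k := by
    intro i
    have : ∑ j, chartG hg hUx i j * CoordGeom.gradient D H k j = ∑ j, (chartG hg hUx * H) i j * D j k := by
      simp only [CoordGeom.gradient, Finset.mul_sum, Matrix.mul_apply, Finset.sum_mul]
      rw [Finset.sum_comm]
      exact Finset.sum_congr rfl fun _ _ => Finset.sum_congr rfl fun _ _ => by ring
    rw [this, hm.inv]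
    simp [Matrix.one_apply]
  have h2 : innerGrad D H f k = ∑ i, ∑ j, CoordGeom.gradient D H f i * CoordGeom.gradient D H k j *
      chartG hg hUx i j := by
    rw [hm.innerGrad_comm, innerGrad_eq_sum]
    refine Finset.sum_congr rfl fun i _ => ?_
    rw [← h1, Finset.sum_mul]
    exact Finset.sum_congr rfl fun _ _ => by ring
  have hgu : ∀ i, entry (grad (g τ) (u τ) x) i = ev (pt hτ hx) (CoordGeom.gradient D H f i) :=
    grad_eq_ev hab hU hτ hg hUx hx hu
  have hgv : ∀ i, entry (grad (g τ) (v τ) x) i = ev (pt hτ hx) (CoordGeom.gradient D H k i) :=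
    grad_eq_ev hab hU hτ hg hUx hx hv
  rw [inner_eq_ev hτ hg hUx hx, h2]
  simp only [map_sum, map_mul, hgu, hgv]

theorem Ric_grad_eq_ev {φ : ℝ → M → ℝ} (hφ : IsSmoothFamily n φ (Icc a b)) :
    Ric (g τ) x (grad (g τ) (φ τ) x) (grad (g τ) (φ τ) x) =
      ev (pt hτ hx) (ricGrad (dx hab hU) (chartG hg hUx) (chartH hg hUx)
        (chartF hUx hφ) (chartF hUx hφ)) := by
  have hg' := grad_eq_ev hab hU hτ hg hUx hx hφ
  rw [Ric_eq hab hU hτ hg hUx hx]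
  simp only [ricGrad, map_sum, map_mul, hg', mul_assoc]

include hab hU in
theorem normSq_eq_ev (B : TangentSpace (𝓡 n) x → TangentSpace (𝓡 n) x → ℝ)
    (T : Matrix (Fin n) (Fin n) (smoothRing (Icc a b ×ˢ U)))
    (hB : ∀ i j, B (frame x i) (frame x j) = ev (pt hτ hx) (T i j))
    (hT : ∀ i j, ev (pt hτ hx) (T i j) = ev (pt hτ hx) (T j i)) :
    normSq (g τ) x B = ev (pt hτ hx) (pair (chartH hg hUx) T T) := by
  have hs : ∀ i j, ev (pt hτ hx) (chartH hg hUx i j) = ev (pt hτ hx) (chartH hg hUx j i) :=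
    fun i j => by rw [(isMetric_chart hab hU hg hUx).symm_inv]
  simp only [normSq, inv_gram_eq hτ hg hUx hx, hB, pair, Matrix.trace, Matrix.diag,
    Matrix.mul_apply, map_sum, map_mul]
  have h1 : ∀ c j : Fin n, (∑ i, ev (pt hτ hx) (chartH hg hUx c i) * ev (pt hτ hx) (T i j)) *
      (∑ d, ev (pt hτ hx) (chartH hg hUx j d) * ev (pt hτ hx) (T d c)) =
      ∑ i, ∑ d, ev (pt hτ hx) (chartH hg hUx i c) * ev (pt hτ hx) (chartH hg hUx j d) *
        ev (pt hτ hx) (T i j) * ev (pt hτ hx) (T c d) := by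
    intro c j
    rw [Finset.sum_mul_sum]
    refine Finset.sum_congr rfl fun i _ => Finset.sum_congr rfl fun d _ => ?_
    rw [hs c i, hT d c]; ring
  simp only [h1]
  rw [Finset.sum_congr rfl fun i _ => Finset.sum_comm, Finset.sum_comm]
  exact Finset.sum_congr rfl fun c _ => Finset.sum_comm

end Center

end LMinus

/-! ### Independence of the chart, and the flow equation throughout a chart. -/

namespace CoordGeom

open scoped Matrix

/-- If the flow equation holds at a point in one coordinate system, then it holds there in every
other one. -/
theorem IsChange.flow_eq {ι A B : Type*} [Fintype ι] [DecidableEq ι] [CommRing A] [Algebra ℝ A]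
    [CommRing B] [Algebra ℝ B] {D : ι → Derivation ℝ A A} {D' : ι → Derivation ℝ B B}
    {G H : Matrix ι ι A} {G' H' : Matrix ι ι B} {ψ : A →ₐ[ℝ] B} {J K : Matrix ι ι B}
    (c : IsChange D D' ψ J K) (h : IsMetric D G H) (h' : IsMetric D' G' H')
    (hG : G' = Jᵀ * G.map ψ * J) {Dt : Derivation ℝ A A} {Dt' : Derivation ℝ B B}
    (ht : ∀ f, Dt' (ψ f) = ψ (Dt f)) (hJ : ∀ i j, Dt' (J i j) = 0) (e : B →ₐ[ℝ] ℝ)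
    (he : ∀ i j, e (Dt' (G' i j)) = 2 * e (ric D' G' H' i j)) (i j : ι) :
    e (ψ (Dt (G i j))) = e (ψ (2 * ric D G H i j)) := by
  -- The defect of the flow equation. As the Jacobian does not depend on time, the defect is a
  -- tensor, and its vanishing at a point does not depend on the coordinates.
  set X := dm Dt G - 2 • ric D G H with hX
  have hJ' : dm Dt' J = 0 := by ext1 k l; exact hJ k l
  have h1 : Jᵀ * X.map ψ * J = dm Dt' G' - 2 • ric D' G' H' := by
    have h2 : X.map ψ = dm Dt' (G.map ψ) - 2 • (ric D G H).map ψ := by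
      refine Matrix.ext fun k l => ?_
      simp only [hX, Matrix.map_apply, Matrix.sub_apply, Matrix.smul_apply, map_sub, map_nsmul,
        dm_apply, ht]
    rw [h2, c.ric_eq h h' hG, hG, dm_mul, dm_mul, dm_transpose, hJ']
    simp only [Matrix.transpose_zero, Matrix.zero_mul, Matrix.mul_zero, zero_add, add_zero,
      Matrix.mul_sub, Matrix.sub_mul, Matrix.mul_smul, Matrix.smul_mul]
  have h3 : X.map ψ = Kᵀ * (Jᵀ * X.map ψ * J) * K := by
    have e : Kᵀ * Jᵀ = 1 := by rw [← Matrix.transpose_mul, c.inv, Matrix.transpose_one]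
    calc X.map ψ = (Kᵀ * Jᵀ) * X.map ψ * (J * K) := by
          rw [e, c.inv, Matrix.one_mul, Matrix.mul_one]
      _ = _ := by simp only [Matrix.mul_assoc]
  have h4 : (Jᵀ * X.map ψ * J).map e = 0 := by
    rw [h1]
    refine Matrix.ext fun k l => ?_
    rw [Matrix.map_apply, Matrix.sub_apply, Matrix.smul_apply, map_sub, dm_apply, he, two_nsmul,
      map_add, Matrix.zero_apply]
    ring
  have h5 : (X.map ψ).map e = 0 := by
    rw [h3, Matrix.map_mul, Matrix.map_mul, h4, Matrix.mul_zero, Matrix.zero_mul]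
  have h6 : e (ψ (X i j)) = 0 := congrFun (congrFun h5 i) j
  rw [hX, Matrix.sub_apply, Matrix.smul_apply, map_sub, map_sub, dm_apply] at h6
  rw [sub_eq_zero.1 h6, two_nsmul, two_mul]

end CoordGeom

namespace LMinus

open SmoothRing CoordGeom
open scoped Matrix

section Change

set_option linter.unusedSectionVars false

variable {n : ℕ} {M : Type*} [TopologicalSpace M] [ChartedSpace (E n) M]
  [IsManifold (𝓡 n) ∞ M] {a b : ℝ} (hab : a < b) {τ : ℝ} (hτ : τ ∈ Icc a b)
  {g : ℝ → Metric n M} (hg : IsSmoothMetricFamily g (Icc a b)) (x x₀ : M)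

theorem overlap_subset {n : ℕ} {M : Type*} [TopologicalSpace M] [ChartedSpace (E n) M] (x x₀ : M) :
    overlap n x x₀ ⊆ (extChartAt (𝓡 n) x).target :=
  inter_subset_left

variable (a b) in
/-- Composition with a change of coordinates. -/
def changeHom : smoothRing (Icc a b ×ˢ (extChartAt (𝓡 n) x₀).target) →ₐ[ℝ]
    smoothRing (Icc a b ×ˢ overlap n x x₀) :=
  pull (Prod.map id (transition n x x₀))
    (contDiffOn_id.prodMap (contDiffOn_transition x x₀))
    (fun _ hp => ⟨hp.1, mapsTo_transition x x₀ hp.2⟩)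

theorem ev_changeHom {y : E n} (hy : y ∈ overlap n x x₀)
    (f : smoothRing (Icc a b ×ˢ (extChartAt (𝓡 n) x₀).target)) :
    ev (pt hτ hy) (changeHom a b x x₀ f) = ev (pt hτ (mapsTo_transition x x₀ hy)) f :=
  ev_pull _ _ _ f _

variable (a b) in
/-- The coordinates of the chart at `x₀`, as functions in the chart at `x`. -/
def newCoord (i : Fin n) : smoothRing (Icc a b ×ˢ overlap n x x₀) :=
  ofFun (fun p => transition n x x₀ p.2 i)
    (((contDiff_euclidean.1 contDiff_id i).comp_contDiffOn (contDiffOn_transition x x₀)).comp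
      contDiffOn_snd fun _ hp => hp.2)

/-- The Jacobian matrix of a change of coordinates. -/
def jacobian : Matrix (Fin n) (Fin n) (smoothRing (Icc a b ×ˢ overlap n x x₀)) :=
  Matrix.of fun k i => dx hab (isOpen_overlap x x₀) i (newCoord a b x x₀ k)

theorem ev_jacobian {y : E n} (hy : y ∈ overlap n x x₀) (k i : Fin n) :
    ev (pt hτ hy) (jacobian hab x x₀ k i) =
      (fderiv ℝ (transition n x x₀) y (EuclideanSpace.single i 1)) k := by
  rw [jacobian, Matrix.of_apply, ← pd_eq_ev hab (isOpen_overlap x x₀) hτ hy (newCoord a b x x₀ k)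
    (fun z => transition n x x₀ z k) (fun z hz => rfl), pd]
  have h := ((EuclideanSpace.proj k : E n →L[ℝ] ℝ).hasFDerivAt.comp y
    (differentiableAt_transition x x₀ hy).hasFDerivAt).fderiv
  change fderiv ℝ ((EuclideanSpace.proj k : E n →L[ℝ] ℝ) ∘ transition n x x₀) y _ = _
  rw [h]; rfl

theorem hom_ext_pt {U : Set (E n)} {f k : smoothRing (Icc a b ×ˢ U)}
    (h : ∀ τ (hτ : τ ∈ Icc a b) y (hy : y ∈ U), ev (pt hτ hy) f = ev (pt hτ hy) k) : f = k :=
  hom_ext fun p => h p.1.1 p.2.1 p.1.2 p.2.2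

theorem chartG_change : chartG hg (U := overlap n x x₀) (x₀ := x) (overlap_subset x x₀) =
    (jacobian hab x x₀)ᵀ * (chartG hg (x₀ := x₀) Subset.rfl).map (changeHom a b x x₀) *
      jacobian hab x x₀ := by
  refine Matrix.ext fun i j => hom_ext_pt fun τ hτ y hy => ?_
  simp only [Matrix.mul_apply, map_sum, map_mul, Matrix.transpose_apply, Matrix.map_apply,
    ev_changeHom, ev_jacobian, Finset.sum_mul]
  rw [Finset.sum_comm]
  refine (chartMetric_change (g τ) x x₀ hy i j).trans ?_
  refine Finset.sum_congr rfl fun k _ => Finset.sum_congr rfl fun l _ => ?_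
  change _ = _ * chartMetric (g τ) x₀ (transition n x x₀ y) k l * _
  ring

include hg in
-- Taking determinants in `chartG_change` gives a positive left side, while the right side contains
-- the factor det J.
theorem det_jacobian_ne_zero (p : ↥(Icc a b ×ˢ overlap n x x₀)) :
    ev p (jacobian hab x x₀).det ≠ 0 := by
  intro h0
  have h1 := det_chartG_pos hg (U := overlap n x x₀) (x₀ := x) (overlap_subset x x₀) p
  rw [chartG_change hab, Matrix.det_mul, map_mul, h0, mul_zero] at h1
  exact lt_irrefl _ h1

include hg in
theorem exists_jacobian_inverse : ∃ K : Matrix (Fin n) (Fin n) (smoothRing (Icc a b ×ˢ overlap n x x₀)),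
    jacobian hab x x₀ * K = 1 :=
  exists_matrix_inverse _ fun p => by
    rw [← ev_det]; exact det_jacobian_ne_zero hab hg x x₀ p

theorem dx_changeHom (i : Fin n)
    (f : smoothRing (Icc a b ×ˢ (extChartAt (𝓡 n) x₀).target)) :
    dx hab (isOpen_overlap x x₀) i (changeHom a b x x₀ f) =
      ∑ k, jacobian hab x x₀ k i *
        changeHom a b x x₀ (dx hab (isOpen_extChartAt_target x₀) k f) := by
  refine hom_ext_pt fun τ hτ y hy => ?_
  set F : E n → ℝ := fun z => ext f (τ, z) with hF
  have hF' : ∀ z (hz : z ∈ (extChartAt (𝓡 n) x₀).target), F z = ev (pt hτ hz) f :=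
    fun z hz => ext_apply f (pt hτ hz)
  have h1 := pd_eq_ev hab (isOpen_overlap x x₀) hτ hy (changeHom a b x x₀ f)
    (F ∘ transition n x x₀) (fun z hz => by rw [ev_changeHom, ← hF']; rfl) i
  have h2 := hasFDerivAt_of_ev (isOpen_extChartAt_target x₀) hτ (mapsTo_transition x x₀ hy) f F hF'
  rw [← h1, pd, (h2.differentiableAt.hasFDerivAt.comp y
    (differentiableAt_transition x x₀ hy).hasFDerivAt).fderiv]
  simp only [map_sum, map_mul, ev_jacobian, ev_changeHom]
  have h3 : ∀ k, ev (pt hτ (mapsTo_transition x x₀ hy))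
      (dx hab (isOpen_extChartAt_target x₀) k f) = pd k F (transition n x x₀ y) := fun k =>
    (pd_eq_ev hab (isOpen_extChartAt_target x₀) hτ (mapsTo_transition x x₀ hy) f F hF' k).symm
  simp only [h3, pd]
  rw [ContinuousLinearMap.comp_apply]
  generalize fderiv ℝ (transition n x x₀) y (EuclideanSpace.single i 1) = w
  change fderiv ℝ F (transition n x x₀ y) w = _
  conv_lhs => rw [sum_smul_single w, map_sum]
  exact Finset.sum_congr rfl fun k _ => map_smul _ _ _

theorem dτ_changeHom (f : smoothRing (Icc a b ×ˢ (extChartAt (𝓡 n) x₀).target)) :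
    dτ hab (isOpen_overlap x x₀) (changeHom a b x x₀ f) =
      changeHom a b x x₀ (dτ hab (isOpen_extChartAt_target x₀) f) := by
  refine hom_ext_pt fun τ hτ y hy => ?_
  have h1 := hasDerivWithinAt_of_ev hab (isOpen_extChartAt_target x₀) hτ
    (mapsTo_transition x x₀ hy) f (fun s => ext f (s, transition n x x₀ y))
    (fun s hs => ext_apply f (pt hs (mapsTo_transition x x₀ hy)))
  have h2 := hasDerivWithinAt_of_ev hab (isOpen_overlap x x₀) hτ hy (changeHom a b x x₀ f)
    (fun s => ext f (s, transition n x x₀ y)) (fun s hs => by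
      rw [ev_changeHom]; exact ext_apply f (pt hs (mapsTo_transition x x₀ hy)))
  rw [ev_changeHom]
  exact (uniqueDiffOn_Icc hab τ hτ).eq_deriv _ h2 h1

theorem dτ_jacobian (k i : Fin n) :
    dτ hab (isOpen_overlap x x₀) (jacobian hab x x₀ k i) = 0 := by
  have h : dτ hab (isOpen_overlap x x₀) (newCoord a b x x₀ k) = 0 := by
    refine hom_ext_pt fun τ hτ y hy => ?_
    have h2 := hasDerivWithinAt_of_ev hab (isOpen_overlap x x₀) hτ hy (newCoord a b x x₀ k)
      (fun s => transition n x x₀ y k) (fun s hs => rfl)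
    rw [map_zero]
    exact (uniqueDiffOn_Icc hab τ hτ).eq_deriv _ h2 (hasDerivWithinAt_const _ _ _)
  rw [jacobian, Matrix.of_apply, dx, dτ, der_comm]
  rw [dτ] at h
  rw [h, map_zero]

/-- The inverse Jacobian matrix. -/
def jacobianInv : Matrix (Fin n) (Fin n) (smoothRing (Icc a b ×ˢ overlap n x x₀)) :=
  (exists_jacobian_inverse hab hg x x₀).choose

theorem isChange : IsChange (ι := Fin n)
    (A := smoothRing (Icc a b ×ˢ (extChartAt (𝓡 n) x₀).target))
    (B := smoothRing (Icc a b ×ˢ overlap n x x₀)) (dx hab (isOpen_extChartAt_target x₀))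
    (dx hab (isOpen_overlap x x₀)) (changeHom a b x x₀) (jacobian hab x x₀)
    (jacobianInv hab hg x x₀) where
  chain := dx_changeHom hab x x₀
  symm i j k := by
    simp only [jacobian, Matrix.of_apply, dx]
    exact der_comm _ _ _ _
  inv := (exists_jacobian_inverse hab hg x x₀).choose_spec

end Change

section Flow

set_option linter.unusedSectionVars false

variable {n : ℕ} {M : Type*} [TopologicalSpace M] [ChartedSpace (E n) M]
  [IsManifold (𝓡 n) ∞ M] {a b : ℝ} (hab : a < b) {τ : ℝ} (hτ : τ ∈ Icc a b)
  {g : ℝ → Metric n M} (hg : IsBackwardRicciFlow g (Icc a b)) (x x₀ : M)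

include hg in
theorem IsBackwardRicciFlow.isSmoothMetricFamily : IsSmoothMetricFamily g (Icc a b) := hg.smooth

include hab hτ hg in
theorem Ric_symm (v w : TangentSpace (𝓡 n) x) : Ric (g τ) x v w = Ric (g τ) x w v := by
  have h1 := hg.flow τ hτ x v w
  have h2 := hg.flow τ hτ x w v
  simp only [(g _).symm x w v] at h2
  have h3 := (uniqueDiffOn_Icc hab τ hτ).eq_deriv _ h1 h2
  linarith

/-- The flow hypothesis concerns the fixed basis `frame x`, which matches the coordinate basis of
the chart at the centre; there the coordinate form of the equation can be read off. -/
theorem flow_center {U : Set (E n)} (hU : IsOpen U) (hUx : U ⊆ (extChartAt (𝓡 n) x).target)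
    (hx : extChartAt (𝓡 n) x x ∈ U) (i j : Fin n) :
    ev (pt hτ hx) (dτ hab hU (chartG hg.isSmoothMetricFamily hUx i j)) =
      2 * ev (pt hτ hx) (ric (dx hab hU) (chartG hg.isSmoothMetricFamily hUx)
        (chartH hg.isSmoothMetricFamily hUx) i j) := by
  have h1 := hg.flow τ hτ x (frame x i) (frame x j)
  rw [Ric_frame hab hU hτ hg.isSmoothMetricFamily hUx hx] at h1
  have h2 := hasDerivWithinAt_of_ev hab hU hτ hx (chartG hg.isSmoothMetricFamily hUx i j)
    (fun s => (g s).inner x (frame x i) (frame x j))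
    (fun s hs => inner_frame hs hg.isSmoothMetricFamily hUx hx i j)
  exact (uniqueDiffOn_Icc hab τ hτ).eq_deriv _ h2 h1

theorem center_mem_overlap {x : M} (hx : x ∈ (extChartAt (𝓡 n) x₀).source) :
    extChartAt (𝓡 n) x x ∈ overlap n x x₀ :=
  ⟨mem_extChartAt_target x, by rwa [mem_preimage, extChartAt_to_inv]⟩

theorem transition_center (x : M) :
    transition n x x₀ (extChartAt (𝓡 n) x x) = extChartAt (𝓡 n) x₀ x := by
  rw [transition, extChartAt_to_inv]

include hτ in
/-- Every point of a chart may be assumed to be the center of another chart. -/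
theorem eq_ev_of_center (F : M → ℝ) (k : smoothRing (Icc a b ×ˢ (extChartAt (𝓡 n) x₀).target))
    (h : ∀ (x : M) (hx : x ∈ (extChartAt (𝓡 n) x₀).source),
      F x = ev (pt hτ (mapsTo_transition x x₀ (center_mem_overlap x₀ hx))) k)
    {y : E n} (hy : y ∈ (extChartAt (𝓡 n) x₀).target) :
    F ((extChartAt (𝓡 n) x₀).symm y) = ev (pt hτ hy) k := by
  rw [h _ ((extChartAt (𝓡 n) x₀).map_target hy)]
  have h2 : transition n ((extChartAt (𝓡 n) x₀).symm y) x₀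
      (extChartAt (𝓡 n) ((extChartAt (𝓡 n) x₀).symm y) ((extChartAt (𝓡 n) x₀).symm y)) = y := by
    rw [transition_center, (extChartAt (𝓡 n) x₀).right_inv hy]
  have h3 : ∀ z (hz : z ∈ (extChartAt (𝓡 n) x₀).target), z = y →
      ev (pt hτ hz) k = ev (pt hτ hy) k := by
    rintro z hz rfl; rfl
  exact h3 _ _ h2

/-- Every point of the chart at `x₀` is the centre of its own chart, where `flow_center` applies;
`IsChange.flow_eq` carries the equation back to the chart at `x₀`. -/
theorem isFlow_chart : IsFlow (dx hab (isOpen_extChartAt_target x₀))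
    (chartG hg.isSmoothMetricFamily (x₀ := x₀) Subset.rfl)
    (chartH hg.isSmoothMetricFamily (x₀ := x₀) Subset.rfl)
    (dτ hab (isOpen_extChartAt_target x₀)) where
  toIsMetric := isMetric_chart hab (isOpen_extChartAt_target x₀) hg.isSmoothMetricFamily Subset.rfl
  comm_time _ _ := der_comm _ _ _ _
  flow i j := by
    refine hom_ext_pt fun τ hτ y hy => sub_eq_zero.1 ?_
    rw [← map_sub]
    -- The difference of the two sides is compared with the zero function on `M`, which reduces the
    -- claim to centres of charts.
    refine (eq_ev_of_center hτ x₀ (fun _ => 0) _ (fun x hx => ?_) hy).symm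
    rw [map_sub, eq_comm, sub_eq_zero]
    have hs := hg.isSmoothMetricFamily
    set hx' := center_mem_overlap x₀ hx
    have c := isChange hab hs x x₀
    have hm := isMetric_chart hab (isOpen_extChartAt_target x₀) hs (x₀ := x₀) Subset.rfl
    have hm' := isMetric_chart hab (isOpen_overlap x x₀) hs (x₀ := x) (overlap_subset x x₀)
    have hG := chartG_change hab hs x x₀
    have hc := flow_center hab hτ hg x (isOpen_overlap x x₀) (overlap_subset x x₀) hx'
    have h1 := c.flow_eq hm hm' hG (Dt := dτ hab (isOpen_extChartAt_target x₀))
      (Dt' := dτ hab (isOpen_overlap x x₀)) (dτ_changeHom hab x x₀) (dτ_jacobian hab x x₀)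
      (ev (pt hτ hx')) hc i j
    rw [ev_changeHom, ev_changeHom] at h1
    exact h1

theorem changeHom_chartF {f : ℝ → M → ℝ} (hf : IsSmoothFamily n f (Icc a b)) :
    changeHom a b x x₀ (chartF (x₀ := x₀) Subset.rfl hf) =
      chartF (U := overlap n x x₀) (x₀ := x) (overlap_subset x x₀) hf :=
  hom_ext_pt fun τ hτ y hy => by
    rw [ev_changeHom, ev_chartF, ev_chartF, symm_transition x x₀ hy]

theorem scal_chart {y : E n} (hy : y ∈ (extChartAt (𝓡 n) x₀).target) :
    LMinus.scal (g τ) ((extChartAt (𝓡 n) x₀).symm y) = ev (pt hτ hy)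
      (CoordGeom.scal (dx hab (isOpen_extChartAt_target x₀))
        (chartG hg.isSmoothMetricFamily (x₀ := x₀) Subset.rfl)
        (chartH hg.isSmoothMetricFamily (x₀ := x₀) Subset.rfl)) := by
  refine eq_ev_of_center hτ x₀ (LMinus.scal (g τ)) _ (fun x hx => ?_) hy
  have hs := hg.isSmoothMetricFamily
  have hx' := center_mem_overlap x₀ hx
  have h1 := (isChange hab hs x x₀).scal_eq
    (isMetric_chart hab (isOpen_extChartAt_target x₀) hs (x₀ := x₀) Subset.rfl)
    (isMetric_chart hab (isOpen_overlap x x₀) hs (x₀ := x) (overlap_subset x x₀))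
    (chartG_change hab hs x x₀)
  have h2 := scal_eq_ev hab (isOpen_overlap x x₀) hτ hs (overlap_subset x x₀) hx' fun i j => by
    rw [← Ric_frame, ← Ric_frame, Ric_symm hab hτ hg]
  rw [h2, h1, ev_changeHom]

theorem divGrad_chart {ρ φ : ℝ → M → ℝ} (hρ : IsSmoothFamily n ρ (Icc a b))
    (hφ : IsSmoothFamily n φ (Icc a b)) {y : E n} (hy : y ∈ (extChartAt (𝓡 n) x₀).target) :
    divGrad (g τ) (ρ τ) (φ τ) ((extChartAt (𝓡 n) x₀).symm y) = ev (pt hτ hy)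
      (dvGrad (dx hab (isOpen_extChartAt_target x₀))
        (chartG hg.isSmoothMetricFamily (x₀ := x₀) Subset.rfl)
        (chartH hg.isSmoothMetricFamily (x₀ := x₀) Subset.rfl)
        (chartF (x₀ := x₀) Subset.rfl hρ) (chartF (x₀ := x₀) Subset.rfl hφ)) := by
  refine eq_ev_of_center hτ x₀ (divGrad (g τ) (ρ τ) (φ τ)) _ (fun x hx => ?_) hy
  have hs := hg.isSmoothMetricFamily
  have hx' := center_mem_overlap x₀ hx
  have h1 := (isChange hab hs x x₀).dvGrad_eq
    (isMetric_chart hab (isOpen_extChartAt_target x₀) hs (x₀ := x₀) Subset.rfl)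
    (isMetric_chart hab (isOpen_overlap x x₀) hs (x₀ := x) (overlap_subset x x₀))
    (chartG_change hab hs x x₀) (chartF (x₀ := x₀) Subset.rfl hρ) (chartF (x₀ := x₀) Subset.rfl hφ)
  rw [changeHom_chartF, changeHom_chartF] at h1
  rw [divGrad_eq_ev hab (isOpen_overlap x x₀) hτ hs (overlap_subset x x₀) hx' hρ hφ, h1, ev_changeHom]

theorem inner_grad_chart {ρ φ : ℝ → M → ℝ} (hρ : IsSmoothFamily n ρ (Icc a b))
    (hφ : IsSmoothFamily n φ (Icc a b)) {y : E n} (hy : y ∈ (extChartAt (𝓡 n) x₀).target) :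
    (g τ).inner ((extChartAt (𝓡 n) x₀).symm y) (grad (g τ) (ρ τ) _) (grad (g τ) (φ τ) _) =
      ev (pt hτ hy) (innerGrad (dx hab (isOpen_extChartAt_target x₀))
        (chartH hg.isSmoothMetricFamily (x₀ := x₀) Subset.rfl)
        (chartF (x₀ := x₀) Subset.rfl hρ) (chartF (x₀ := x₀) Subset.rfl hφ)) := by
  refine eq_ev_of_center hτ x₀
    (fun x => (g τ).inner x (grad (g τ) (ρ τ) x) (grad (g τ) (φ τ) x)) _ (fun x hx => ?_) hy
  have hs := hg.isSmoothMetricFamily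
  have hx' := center_mem_overlap x₀ hx
  have h1 := (isChange hab hs x x₀).innerGrad_eq
    (isMetric_chart hab (isOpen_extChartAt_target x₀) hs (x₀ := x₀) Subset.rfl)
    (isMetric_chart hab (isOpen_overlap x x₀) hs (x₀ := x) (overlap_subset x x₀))
    (chartG_change hab hs x x₀) (chartF (x₀ := x₀) Subset.rfl hρ) (chartF (x₀ := x₀) Subset.rfl hφ)
  rw [changeHom_chartF, changeHom_chartF] at h1
  rw [inner_grad_eq_ev hab (isOpen_overlap x x₀) hτ hs (overlap_subset x x₀) hx' hρ hφ, h1,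
    ev_changeHom]

end Flow

end LMinus

/-! ### Smooth families of functions and of geometric quantities. -/

namespace LMinus

open SmoothRing CoordGeom

section Families

set_option linter.unusedSectionVars false

variable {n : ℕ} {M : Type*} [TopologicalSpace M] [ChartedSpace (E n) M] {S : Set ℝ}
  {u v : ℝ → M → ℝ}

theorem IsSmoothFamily.comp₂ (hu : IsSmoothFamily n u S) (hv : IsSmoothFamily n v S)
    {F : ℝ × ℝ → ℝ} (hF : ContDiff ℝ ∞ F) : IsSmoothFamily n (fun τ x => F (u τ x, v τ x)) S :=
  fun p hp => (hF.contMDiff _).comp_contMDiffWithinAt p ((hu p hp).prodMk_space (hv p hp))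

theorem IsSmoothFamily.add (hu : IsSmoothFamily n u S) (hv : IsSmoothFamily n v S) :
    IsSmoothFamily n (fun τ x => u τ x + v τ x) S := by
  have h := hu.comp₂ hv (F := fun p => p.1 + p.2) (by fun_prop)
  exact h

theorem IsSmoothFamily.mul (hu : IsSmoothFamily n u S) (hv : IsSmoothFamily n v S) :
    IsSmoothFamily n (fun τ x => u τ x * v τ x) S := by
  have h := hu.comp₂ hv (F := fun p => p.1 * p.2) (by fun_prop)
  exact h

theorem isSmoothFamily_time {c : ℝ → ℝ} (hc : ContDiffOn ℝ ∞ c S) :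
    IsSmoothFamily n (fun τ (_ : M) => c τ) S :=
  (contMDiffOn_iff_contDiffOn.2 hc).comp contMDiff_fst.contMDiffOn fun _ hp => hp.1

theorem isSmoothFamily_space {f : M → ℝ} (hf : ContMDiff (𝓡 n) 𝓘(ℝ, ℝ) ∞ f) :
    IsSmoothFamily n (fun (_ : ℝ) x => f x) S :=
  (hf.comp contMDiff_snd).contMDiffOn

theorem IsSmoothFamily.log (hu : IsSmoothFamily n u S) (h : ∀ τ ∈ S, ∀ x, 0 < u τ x) :
    IsSmoothFamily n (fun τ x => Real.log (u τ x)) S := by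
  intro p hp
  have h1 : ContDiffAt ℝ ∞ Real.log (u p.1 p.2) := Real.contDiffAt_log.2 (h p.1 hp.1 p.2).ne'
  exact h1.contMDiffAt.comp_contMDiffWithinAt p (hu p hp)

theorem IsSmoothFamily.continuous (hu : IsSmoothFamily n u S) {τ : ℝ} (hτ : τ ∈ S) :
    Continuous (u τ) := by
  have h1 : ContinuousOn (fun p : ℝ × M => u p.1 p.2) (S ×ˢ univ) := ContMDiffOn.continuousOn hu
  exact h1.comp_continuous (Continuous.prodMk_right τ) fun x => ⟨hτ, mem_univ x⟩

end Families

section Geometry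

set_option linter.unusedSectionVars false

variable {n : ℕ} {M : Type*} [TopologicalSpace M] [ChartedSpace (E n) M]
  [IsManifold (𝓡 n) ∞ M] {a b : ℝ} (hab : a < b) {τ : ℝ} (hτ : τ ∈ Icc a b)
  {g : ℝ → Metric n M} (hg : IsBackwardRicciFlow g (Icc a b)) (x₀ : M)

/-- The coordinate derivations of a chart. -/
abbrev chD (x₀ : M) (i : Fin n) :
    Derivation ℝ (smoothRing (Icc a b ×ˢ (extChartAt (𝓡 n) x₀).target))
      (smoothRing (Icc a b ×ˢ (extChartAt (𝓡 n) x₀).target)) :=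
  dx hab (isOpen_extChartAt_target x₀) i

/-- The time derivation in a chart. -/
abbrev chT (x₀ : M) :
    Derivation ℝ (smoothRing (Icc a b ×ˢ (extChartAt (𝓡 n) x₀).target))
      (smoothRing (Icc a b ×ˢ (extChartAt (𝓡 n) x₀).target)) :=
  dτ hab (isOpen_extChartAt_target x₀)

/-- The metric in a chart. -/
abbrev chG (x₀ : M) :
    Matrix (Fin n) (Fin n) (smoothRing (Icc a b ×ˢ (extChartAt (𝓡 n) x₀).target)) :=
  chartG hg.isSmoothMetricFamily (x₀ := x₀) Subset.rfl

/-- The inverse metric in a chart. -/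
abbrev chH (x₀ : M) :
    Matrix (Fin n) (Fin n) (smoothRing (Icc a b ×ˢ (extChartAt (𝓡 n) x₀).target)) :=
  chartH hg.isSmoothMetricFamily (x₀ := x₀) Subset.rfl

/-- A smooth family of functions in a chart. -/
abbrev chF (x₀ : M) {f : ℝ → M → ℝ} (hf : IsSmoothFamily n f (Icc a b)) :
    smoothRing (Icc a b ×ˢ (extChartAt (𝓡 n) x₀).target) :=
  chartF (x₀ := x₀) Subset.rfl hf

theorem ev_chF_center (x : M) {f : ℝ → M → ℝ} (hf : IsSmoothFamily n f (Icc a b)) :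
    ev (pt hτ (mem_extChartAt_target x)) (chF x hf) = f τ x := by
  rw [ev_chartF, extChartAt_to_inv]

theorem isSmoothFamily_of_ev {f : ℝ → M → ℝ}
    (k : ∀ x₀ : M, smoothRing (Icc a b ×ˢ (extChartAt (𝓡 n) x₀).target))
    (h : ∀ x₀ τ (hτ : τ ∈ Icc a b) y (hy : y ∈ (extChartAt (𝓡 n) x₀).target),
      f τ ((extChartAt (𝓡 n) x₀).symm y) = ev (pt hτ hy) (k x₀)) :
    IsSmoothFamily n f (Icc a b) :=
  isSmoothFamily_of_chart fun x₀ => (contDiffOn_ext (k x₀)).congr fun p hp => by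
    rw [h x₀ p.1 hp.1 p.2 hp.2]; exact (ext_apply (k x₀) ⟨p, hp⟩).symm

theorem chF_eq {f : ℝ → M → ℝ} (hf : IsSmoothFamily n f (Icc a b))
    {k : smoothRing (Icc a b ×ˢ (extChartAt (𝓡 n) x₀).target)}
    (h : ∀ τ (hτ : τ ∈ Icc a b) y (hy : y ∈ (extChartAt (𝓡 n) x₀).target),
      f τ ((extChartAt (𝓡 n) x₀).symm y) = ev (pt hτ hy) k) : chF x₀ hf = k :=
  hom_ext_pt h

variable {u v : ℝ → M → ℝ} (hu : IsSmoothFamily n u (Icc a b)) (hv : IsSmoothFamily n v (Icc a b))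

/-- The time derivative of a family of functions. -/
def timeDeriv (S : Set ℝ) (f : ℝ → M → ℝ) (τ : ℝ) (x : M) : ℝ :=
  derivWithin (fun s => f s x) S τ

theorem timeDeriv_chart {y : E n} (hy : y ∈ (extChartAt (𝓡 n) x₀).target) :
    timeDeriv (Icc a b) u τ ((extChartAt (𝓡 n) x₀).symm y) =
      ev (pt hτ hy) (chT hab x₀ (chF x₀ hu)) :=
  (hasDerivWithinAt_of_ev hab (isOpen_extChartAt_target x₀) hτ hy (chF x₀ hu)
    (fun s => u s ((extChartAt (𝓡 n) x₀).symm y)) fun _ _ => rfl).derivWithin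
      (uniqueDiffOn_Icc hab τ hτ)

include hab hu in
theorem isSmoothFamily_timeDeriv : IsSmoothFamily n (timeDeriv (Icc a b) u) (Icc a b) :=
  isSmoothFamily_of_ev (fun x₀ => chT hab x₀ (chF x₀ hu))
    fun x₀ _ hτ _ hy => timeDeriv_chart hab hτ x₀ hu hy

theorem chF_timeDeriv : chF x₀ (isSmoothFamily_timeDeriv hab hu) = chT hab x₀ (chF x₀ hu) :=
  chF_eq x₀ _ fun _ hτ _ hy => timeDeriv_chart hab hτ x₀ hu hy

include hab hτ hu in
theorem IsSmoothFamily.hasDerivWithinAt (x : M) :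
    HasDerivWithinAt (fun s => u s x) (timeDeriv (Icc a b) u τ x) (Icc a b) τ := by
  have h := hasDerivWithinAt_of_ev hab (isOpen_extChartAt_target x) hτ (mem_extChartAt_target x)
    (chF x hu) (fun s => u s x) fun s hs => (ev_chF_center hs x hu).symm
  rw [timeDeriv, h.derivWithin (uniqueDiffOn_Icc hab τ hτ)]
  exact h

include hab hg in
theorem isSmoothFamily_scal : IsSmoothFamily n (fun τ => LMinus.scal (g τ)) (Icc a b) :=
  isSmoothFamily_of_ev (fun x₀ => CoordGeom.scal (chD hab x₀) (chG hg x₀) (chH hg x₀))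
    fun x₀ _ hτ _ hy => scal_chart hab hτ hg x₀ hy

theorem chF_scal : chF x₀ (isSmoothFamily_scal hab hg) =
    CoordGeom.scal (chD hab x₀) (chG hg x₀) (chH hg x₀) :=
  chF_eq x₀ _ fun _ hτ _ hy => scal_chart hab hτ hg x₀ hy

include hab hg hu hv in
theorem isSmoothFamily_divGrad :
    IsSmoothFamily n (fun τ => divGrad (g τ) (u τ) (v τ)) (Icc a b) :=
  isSmoothFamily_of_ev (fun x₀ => dvGrad (chD hab x₀) (chG hg x₀) (chH hg x₀)
    (chF x₀ hu) (chF x₀ hv)) fun x₀ _ hτ _ hy => divGrad_chart hab hτ hg x₀ hu hv hy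

theorem chF_divGrad : chF x₀ (isSmoothFamily_divGrad hab hg hu hv) =
    dvGrad (chD hab x₀) (chG hg x₀) (chH hg x₀) (chF x₀ hu) (chF x₀ hv) :=
  chF_eq x₀ _ fun _ hτ _ hy => divGrad_chart hab hτ hg x₀ hu hv hy

/-- The inner product of the gradients of two functions. -/
def innerGradFun (g : Metric n M) (u v : M → ℝ) (x : M) : ℝ :=
  g.inner x (grad g u x) (grad g v x)

include hab hg hu hv in
theorem isSmoothFamily_innerGradFun :
    IsSmoothFamily n (fun τ => innerGradFun (g τ) (u τ) (v τ)) (Icc a b) :=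
  isSmoothFamily_of_ev (fun x₀ => innerGrad (chD hab x₀) (chH hg x₀) (chF x₀ hu) (chF x₀ hv))
    fun x₀ _ hτ _ hy => inner_grad_chart hab hτ hg x₀ hu hv hy

theorem chF_innerGradFun : chF x₀ (isSmoothFamily_innerGradFun hab hg hu hv) =
    innerGrad (chD hab x₀) (chH hg x₀) (chF x₀ hu) (chF x₀ hv) :=
  chF_eq x₀ _ fun _ hτ _ hy => inner_grad_chart hab hτ hg x₀ hu hv hy

theorem chF_mul : chF x₀ (hu.mul hv) = chF x₀ hu * chF x₀ hv := rfl

theorem chD_time {c : ℝ → ℝ} (hc : ContDiffOn ℝ ∞ c (Icc a b)) (i : Fin n) :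
    chD hab x₀ i (chF x₀ (isSmoothFamily_time hc)) = 0 :=
  hom_ext_pt fun τ hτ y hy => by
    rw [← pd_eq_ev hab (isOpen_extChartAt_target x₀) hτ hy (chF x₀ (isSmoothFamily_time hc))
      (fun _ => c τ) fun z hz => rfl, map_zero, pd, fderiv_const_apply]
    rfl

end Geometry

end LMinus

namespace CoordGeom

variable {ι A : Type*} [Fintype ι] [DecidableEq ι] [CommRing A] [Algebra ℝ A]
  {D : ι → Derivation ℝ A A} {G H : Matrix ι ι A} {Dt : Derivation ℝ A A} (h : IsFlow D G H Dt)
include h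

theorem IsFlow.ric_add_hess_symm (u : A) (i j : ι) :
    (ric D G H + hess D G H u) i j = (ric D G H + hess D G H u) j i := by
  rw [Matrix.add_apply, Matrix.add_apply, h.ric_symm i j]
  exact congrArg _ (congrFun (congrFun (h.hess_transpose u) j) i)

theorem IsFlow.ric_add_hess_sub_symm (u c : A) (i j : ι) :
    (ric D G H + hess D G H u - c • G) i j = (ric D G H + hess D G H u - c • G) j i := by
  rw [Matrix.sub_apply, Matrix.sub_apply, h.ric_add_hess_symm, Matrix.smul_apply,
    Matrix.smul_apply, h.symm i j]

theorem IsFlow.trace_ric_add_hess (u : A) :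
    (H * (ric D G H + hess D G H u)).trace = dvGrad D G H 1 u + scal D G H := by
  rw [Matrix.mul_add, Matrix.trace_add, dvGrad, add_comm, scal]
  simp only [one_mul]
  congr 3
  exact (h.hess_transpose _).symm

end CoordGeom

/-! ### The pointwise identities on the manifold. -/

namespace LMinus

open SmoothRing CoordGeom

section Identities

set_option linter.unusedSectionVars false

variable {n : ℕ} {M : Type*} [TopologicalSpace M] [ChartedSpace (E n) M]
  [IsManifold (𝓡 n) ∞ M] {a b : ℝ} (hab : a < b) {τ : ℝ} (hτ : τ ∈ Icc a b)
  {g : ℝ → Metric n M} (hg : IsBackwardRicciFlow g (Icc a b)) {ρ φ : ℝ → M → ℝ}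
  (hρ : IsSmoothFamily n ρ (Icc a b)) (hφ : IsSmoothFamily n φ (Icc a b))

include hab hτ hg hρ hφ in
theorem divGrad_mul {f : ℝ → M → ℝ} (hf : IsSmoothFamily n f (Icc a b)) (x : M) :
    divGrad (g τ) (fun x => f τ x * ρ τ x) (φ τ) x =
      f τ x * divGrad (g τ) (ρ τ) (φ τ) x + ρ τ x * innerGradFun (g τ) (f τ) (φ τ) x := by
  have h := congrArg (ev (pt hτ (mem_extChartAt_target x)))
    ((isFlow_chart hab hg x).dvGrad_mul (chF x hf) (chF x hρ) (chF x hφ))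
  rw [← chF_mul, ← chF_divGrad hab hg, ← chF_divGrad hab hg, ← chF_innerGradFun hab hg, map_add,
    map_mul, map_mul] at h
  simpa only [ev_chF_center] using h

include hab hg in
theorem chT_hamiltonJacobi (hHJ : HamiltonJacobiEq g φ (Icc a b)) (x : M)
    (hc : IsSmoothFamily n (fun τ (_ : M) => 1 / (2 * τ)) (Icc a b)) :
    chT hab x (chF x hφ) = -(algebraMap ℝ _ (1 / 2) *
      innerGrad (chD hab x) (chH hg x) (chF x hφ) (chF x hφ)) +
      algebraMap ℝ _ (1 / 2) * CoordGeom.scal (chD hab x) (chG hg x) (chH hg x) -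
      chF x hc * chF x hφ := by
  rw [← chF_timeDeriv, ← chF_innerGradFun hab hg, ← chF_scal hab hg]
  refine hom_ext_pt fun τ hτ y hy => ?_
  simp only [map_sub, map_add, map_neg, map_mul, AlgHom.commutes, ev_chartF, timeDeriv]
  rw [(hHJ τ hτ _).derivWithin (uniqueDiffOn_Icc hab τ hτ)]
  simp only [innerGradFun, Algebra.algebraMap_self_apply]
  ring

variable (g φ) in
/-- The function `Δφ + R`. -/
def lapScal (τ : ℝ) (x : M) : ℝ :=
  divGrad (g τ) (fun _ => 1) (φ τ) x + LMinus.scal (g τ) x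

variable (g φ) in
/-- The function `½ (|∇φ|² + R)`. -/
def energyDensity (τ : ℝ) (x : M) : ℝ :=
  1 / 2 * (innerGradFun (g τ) (φ τ) (φ τ) x + LMinus.scal (g τ) x)

variable (g φ) in
/-- The derivative `f_τ + ⟨∇f, ∇φ⟩` along the flow lines of `∇φ`. -/
def flowDeriv (S : Set ℝ) (f : ℝ → M → ℝ) (τ : ℝ) (x : M) : ℝ :=
  timeDeriv S f τ x + innerGradFun (g τ) (f τ) (φ τ) x

theorem isSmoothFamily_const (r : ℝ) {S : Set ℝ} : IsSmoothFamily n (fun _ (_ : M) => r) S :=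
  isSmoothFamily_time contDiffOn_const

include hab hg hφ in
theorem isSmoothFamily_lapScal : IsSmoothFamily n (lapScal g φ) (Icc a b) :=
  (isSmoothFamily_divGrad hab hg (isSmoothFamily_const 1) hφ).add (isSmoothFamily_scal hab hg)

include hab hg hφ in
theorem isSmoothFamily_energyDensity : IsSmoothFamily n (energyDensity g φ) (Icc a b) :=
  (isSmoothFamily_const (1 / 2)).mul
    ((isSmoothFamily_innerGradFun hab hg hφ hφ).add (isSmoothFamily_scal hab hg))

include hab hg hφ in
theorem isSmoothFamily_flowDeriv {f : ℝ → M → ℝ} (hf : IsSmoothFamily n f (Icc a b)) :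
    IsSmoothFamily n (flowDeriv g φ (Icc a b) f) (Icc a b) :=
  (isSmoothFamily_timeDeriv hab hf).add (isSmoothFamily_innerGradFun hab hg hf hφ)

theorem chF_lapScal (x : M) : chF x (isSmoothFamily_lapScal hab hg hφ) =
    dvGrad (chD hab x) (chG hg x) (chH hg x) 1 (chF x hφ) +
      CoordGeom.scal (chD hab x) (chG hg x) (chH hg x) := by
  have h : dvGrad (chD hab x) (chG hg x) (chH hg x) 1 (chF x hφ) =
      chF x (isSmoothFamily_divGrad hab hg (isSmoothFamily_const 1) hφ) :=
    (chF_divGrad hab hg x (isSmoothFamily_const 1) hφ).symm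
  rw [← chF_scal hab hg, h]; rfl

theorem chF_energyDensity (x : M) : chF x (isSmoothFamily_energyDensity hab hg hφ) =
    algebraMap ℝ _ (1 / 2) * (innerGrad (chD hab x) (chH hg x) (chF x hφ) (chF x hφ) +
      CoordGeom.scal (chD hab x) (chG hg x) (chH hg x)) := by
  rw [← chF_scal hab hg, ← chF_innerGradFun hab hg]; rfl

theorem chF_flowDeriv (x : M) {f : ℝ → M → ℝ} (hf : IsSmoothFamily n f (Icc a b)) :
    chF x (isSmoothFamily_flowDeriv hab hg hφ hf) = chT hab x (chF x hf) +
      innerGrad (chD hab x) (chH hg x) (chF x hf) (chF x hφ) := by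
  rw [← chF_innerGradFun hab hg, ← chF_timeDeriv]; rfl

include hab hτ hg hφ in
theorem normSq_Ric_add_Hess (x : M) :
    normSq (g τ) x (fun v w => Ric (g τ) x v w + Hess (g τ) (φ τ) x v w) =
      ev (pt hτ (mem_extChartAt_target x)) (pair (chH hg x)
        (ric (chD hab x) (chG hg x) (chH hg x) + hess (chD hab x) (chG hg x) (chH hg x) (chF x hφ))
        (ric (chD hab x) (chG hg x) (chH hg x) +
          hess (chD hab x) (chG hg x) (chH hg x) (chF x hφ))) := by
  have hf := isFlow_chart hab hg x
  refine normSq_eq_ev hab (isOpen_extChartAt_target x) hτ hg.isSmoothMetricFamily Subset.rfl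
    (mem_extChartAt_target x) _ _ (fun i j => ?_) fun i j => ?_
  · exact (congrArg₂ (· + ·)
      (Ric_frame hab (isOpen_extChartAt_target x) hτ hg.isSmoothMetricFamily Subset.rfl
        (mem_extChartAt_target x) i j)
      (Hess_frame hab (isOpen_extChartAt_target x) hτ hg.isSmoothMetricFamily Subset.rfl
        (mem_extChartAt_target x) hφ i j)).trans (map_add _ _ _).symm
  · rw [hf.ric_add_hess_symm]

include hab hτ hg hφ in
theorem normSq_Ric_add_Hess_sub (x : M) (hτ0 : τ ≠ 0) :
    normSq (g τ) x (fun v w => Ric (g τ) x v w + Hess (g τ) (φ τ) x v w -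
      (g τ).inner x v w / (2 * τ)) =
      normSq (g τ) x (fun v w => Ric (g τ) x v w + Hess (g τ) (φ τ) x v w) -
        1 / τ * lapScal g φ τ x + n / (4 * τ ^ 2) := by
  have hf := isFlow_chart hab hg x
  have h1 := normSq_eq_ev hab (isOpen_extChartAt_target x) hτ hg.isSmoothMetricFamily Subset.rfl
    (mem_extChartAt_target x) (fun v w => Ric (g τ) x v w + Hess (g τ) (φ τ) x v w -
      (g τ).inner x v w / (2 * τ))
    (ric (chD hab x) (chG hg x) (chH hg x) + hess (chD hab x) (chG hg x) (chH hg x) (chF x hφ) -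
      algebraMap ℝ (smoothRing (Icc a b ×ˢ (extChartAt (𝓡 n) x).target)) (1 / (2 * τ)) •
        chG hg x) (fun i j => ?_) fun i j => ?_
  · have h2 := hf.trace_ric_add_hess (chF x hφ)
    rw [← chF_lapScal hab hg hφ] at h2
    rw [h1, normSq_Ric_add_Hess hab hτ hg hφ, hf.pair_sub_smul, h2]
    simp only [map_sub, map_add, map_mul, map_pow, map_natCast, map_ofNat, AlgHom.commutes,
      Fintype.card_fin, ev_chF_center, Algebra.algebraMap_self_apply]
    field_simp
    ring
  · have h3 := Ric_frame hab (isOpen_extChartAt_target x) hτ hg.isSmoothMetricFamily Subset.rfl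
      (mem_extChartAt_target x) i j
    have h4 := Hess_frame hab (isOpen_extChartAt_target x) hτ hg.isSmoothMetricFamily Subset.rfl
      (mem_extChartAt_target x) hφ i j
    have h5 := inner_frame hτ hg.isSmoothMetricFamily Subset.rfl (mem_extChartAt_target x) i j
    rw [Matrix.sub_apply, Matrix.smul_apply, Matrix.add_apply, map_sub, map_add, smul_eq_mul,
      map_mul, AlgHom.commutes, ← h3, ← h4, ← h5, Algebra.algebraMap_self_apply]
    ring
  · rw [hf.ric_add_hess_sub_symm]

variable (ha : 0 < a) (hHJ : HamiltonJacobiEq g φ (Icc a b))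

include ha in
theorem contDiffOn_one_div_two_mul : ContDiffOn ℝ ∞ (fun τ : ℝ => 1 / (2 * τ)) (Icc a b) :=
  contDiffOn_const.div (contDiffOn_const.mul contDiffOn_id) fun _ hτ =>
    mul_ne_zero two_ne_zero (ha.trans_le hτ.1).ne'

theorem harnack_grad (x : M) : harnack g (Icc a b) τ x (grad (g τ) (φ τ) x) =
    -timeDeriv (Icc a b) (fun τ => LMinus.scal (g τ)) τ x -
      2 * innerGradFun (g τ) (LMinus.scal (g τ)) (φ τ) x +
      2 * Ric (g τ) x (grad (g τ) (φ τ) x) (grad (g τ) (φ τ) x) - LMinus.scal (g τ) x / τ := rfl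

include hab hτ hg hφ ha hHJ in
theorem flowDeriv_lapScal (x : M) : flowDeriv g φ (Icc a b) (lapScal g φ) τ x =
    -normSq (g τ) x (fun v w => Ric (g τ) x v w + Hess (g τ) (φ τ) x v w) +
      1 / 2 * timeDeriv (Icc a b) (fun τ => LMinus.scal (g τ)) τ x +
      innerGradFun (g τ) (LMinus.scal (g τ)) (φ τ) x -
      Ric (g τ) x (grad (g τ) (φ τ) x) (grad (g τ) (φ τ) x) -
      1 / (2 * τ) * divGrad (g τ) (fun _ => 1) (φ τ) x := by
  have hc := contDiffOn_one_div_two_mul (b := b) ha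
  have h := (isFlow_chart hab hg x).time_laplacian_add_scal (fun i => chD_time hab x hc i)
    (chT_hamiltonJacobi hab hg hφ hHJ x (isSmoothFamily_time hc))
  have h4 := normSq_Ric_add_Hess hab hτ hg hφ x
  rw [← chF_lapScal hab hg hφ, ← chF_flowDeriv hab hg hφ x (isSmoothFamily_lapScal hab hg hφ),
    ← chF_scal hab hg, ← chF_timeDeriv, ← chF_innerGradFun hab hg] at h
  have h2 := congrArg (ev (pt hτ (mem_extChartAt_target x))) h
  have h3 : dvGrad (chD hab x) (chG hg x) (chH hg x) 1 (chF x hφ) =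
      chF x (isSmoothFamily_divGrad hab hg (isSmoothFamily_const 1) hφ) :=
    (chF_divGrad hab hg x (isSmoothFamily_const 1) hφ).symm
  rw [h3] at h2
  simp only [map_sub, map_add, map_neg, map_mul, AlgHom.commutes, ev_chF_center,
    ← h4, Algebra.algebraMap_self_apply,
    ← Ric_grad_eq_ev hab (isOpen_extChartAt_target x) hτ hg.isSmoothMetricFamily Subset.rfl
      (mem_extChartAt_target x) hφ] at h2
  exact h2

include hab hτ hg hφ ha hHJ in
theorem flowDeriv_energyDensity (x : M) : flowDeriv g φ (Icc a b) (energyDensity g φ) τ x =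
    1 / 2 * timeDeriv (Icc a b) (fun τ => LMinus.scal (g τ)) τ x +
      innerGradFun (g τ) (LMinus.scal (g τ)) (φ τ) x -
      Ric (g τ) x (grad (g τ) (φ τ) x) (grad (g τ) (φ τ) x) -
      1 / (2 * τ) * innerGradFun (g τ) (φ τ) (φ τ) x := by
  have hc := contDiffOn_one_div_two_mul (b := b) ha
  have h := (isFlow_chart hab hg x).time_energy (fun i => chD_time hab x hc i)
    (chT_hamiltonJacobi hab hg hφ hHJ x (isSmoothFamily_time hc))
  rw [← chF_energyDensity hab hg hφ,
    ← chF_flowDeriv hab hg hφ x (isSmoothFamily_energyDensity hab hg hφ),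
    ← chF_scal hab hg, ← chF_timeDeriv, ← chF_innerGradFun hab hg, ← chF_innerGradFun hab hg] at h
  have h2 := congrArg (ev (pt hτ (mem_extChartAt_target x))) h
  simp only [map_sub, map_add, map_mul, AlgHom.commutes, ev_chF_center,
    Algebra.algebraMap_self_apply,
    ← Ric_grad_eq_ev hab (isOpen_extChartAt_target x) hτ hg.isSmoothMetricFamily Subset.rfl
      (mem_extChartAt_target x) hφ] at h2
  exact h2

end Identities

end LMinus

/-! ### Differentiation under the integral and integration by parts in ℝⁿ. -/

/-- Differentiation under the integral sign, within an interval. -/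
theorem hasDerivWithinAt_integral_of_bound {α : Type*} [MeasurableSpace α] {μ : Measure α}
    [IsFiniteMeasure μ] {a b : ℝ} {F F' : ℝ → α → ℝ} {C : ℝ}
    (hF : ∀ s ∈ Icc a b, Integrable (F s) μ)
    (hF' : ∀ᵐ x ∂μ, ∀ s ∈ Icc a b, HasDerivWithinAt (fun s => F s x) (F' s x) (Icc a b) s)
    (hC : ∀ᵐ x ∂μ, ∀ s ∈ Icc a b, |F' s x| ≤ C) {τ : ℝ} (hτ : τ ∈ Icc a b) :
    HasDerivWithinAt (fun s => ∫ x, F s x ∂μ) (∫ x, F' τ x ∂μ) (Icc a b) τ := by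
  rw [hasDerivWithinAt_iff_tendsto_slope]
  have h1 : ∀ s ∈ Icc a b, slope (fun s => ∫ x, F s x ∂μ) τ s =
      ∫ x, slope (fun s => F s x) τ s ∂μ := by
    intro s hs
    simp only [slope_def_module, smul_eq_mul]
    rw [integral_const_mul, integral_sub (hF s hs) (hF τ hτ)]
  have hmem : ∀ᶠ s in nhdsWithin τ (Icc a b \ {τ}), s ∈ Icc a b \ {τ} := self_mem_nhdsWithin
  have h2 : Filter.Tendsto (fun s => ∫ x, slope (fun s => F s x) τ s ∂μ)
      (nhdsWithin τ (Icc a b \ {τ})) (nhds (∫ x, F' τ x ∂μ)) := by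
    refine tendsto_integral_filter_of_dominated_convergence (fun _ => C) ?_ ?_
      (integrable_const C) ?_
    · filter_upwards [hmem] with s hs
      simp only [slope_def_module]
      exact (((hF s hs.1).sub (hF τ hτ)).smul (s - τ)⁻¹).aestronglyMeasurable
    · filter_upwards [hmem] with s hs
      filter_upwards [hF', hC] with x hx hx'
      -- The mean value inequality bounds every difference quotient by `C`, the dominating constant.
      have h3 := (convex_Icc a b).norm_image_sub_le_of_norm_hasDerivWithin_le hx
        (fun s hs => (Real.norm_eq_abs _).le.trans (hx' s hs)) hτ hs.1
      have h4 : 0 < ‖s - τ‖ := norm_pos_iff.2 (sub_ne_zero.2 hs.2)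
      rw [slope_def_module, norm_smul, norm_inv, inv_mul_le_iff₀ h4, mul_comm]
      exact h3
    · filter_upwards [hF'] with x hx
      exact hasDerivWithinAt_iff_tendsto_slope.1 (hx τ hτ)
  refine h2.congr' ?_
  filter_upwards [hmem] with s hs
  exact (h1 s hs.1).symm

namespace LMinus

section Euclidean

variable {n : ℕ} {U K : Set (E n)}

/-- Extended by zero, `G` is a C¹ function of compact support on ℝⁿ; integrating its partial
derivative by parts against the constant 1 gives zero. -/
theorem integral_pd_eq_zero (hU : IsOpen U) (hK : IsCompact K) (hKU : K ⊆ U) {G : E n → ℝ}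
    (hG : ContDiffOn ℝ ∞ G U) (h0 : ∀ y ∈ U, y ∉ K → G y = 0) (i : Fin n) :
    IntegrableOn (pd i G) U ∧ ∫ y in U, pd i G y = 0 := by
  set F : E n → ℝ := U.indicator G with hF
  have hF0 : ∀ y, y ∉ K → F y = 0 := by
    intro y hy
    by_cases hyU : y ∈ U
    · rw [hF, indicator_of_mem hyU, h0 y hyU hy]
    · exact indicator_of_notMem hyU _
  have hFG : ∀ y ∈ U, F =ᶠ[nhds y] G := fun y hy => by
    filter_upwards [hU.mem_nhds hy] with z hz
    exact indicator_of_mem hz _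
  have hFK : ∀ y, y ∉ K → F =ᶠ[nhds y] fun _ => 0 := fun y hy => by
    filter_upwards [hK.isClosed.isOpen_compl.mem_nhds hy] with z hz
    exact hF0 z hz
  have hcd : ContDiff ℝ 1 F := by
    refine contDiff_iff_contDiffAt.2 fun y => ?_
    by_cases hy : y ∈ U
    · exact ((hG.contDiffAt (hU.mem_nhds hy)).of_le (by simp)).congr_of_eventuallyEq (hFG y hy)
    · exact contDiffAt_const.congr_of_eventuallyEq (hFK y fun h => hy (hKU h))
  have hsupp : HasCompactSupport F := HasCompactSupport.intro hK fun y hy => hF0 y hy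
  have hd0 : ∀ y, y ∉ K → fderiv ℝ F y = 0 := fun y hy => by
    rw [(hFK y hy).fderiv_eq, fderiv_const_apply]
  have h3 : EqOn (fun y => fderiv ℝ F y (EuclideanSpace.single i 1)) (pd i G) U := fun y hy => by
    simp only [pd, (hFG y hy).fderiv_eq]
  have h1 : ∫ y in U, pd i G y = ∫ y, fderiv ℝ F y (EuclideanSpace.single i 1) := by
    rw [← setIntegral_eq_integral_of_forall_compl_eq_zero (s := U)
      (f := fun y => fderiv ℝ F y (EuclideanSpace.single i 1))
      fun y hy => by rw [hd0 y fun h => hy (hKU h)]; rfl]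
    exact setIntegral_congr_fun hU.measurableSet h3.symm
  have hd : Integrable (fun y => fderiv ℝ F y (EuclideanSpace.single i 1)) := by
    refine Continuous.integrable_of_hasCompactSupport
      ((hcd.continuous_fderiv one_ne_zero).clm_apply continuous_const) ?_
    exact HasCompactSupport.intro hK fun y hy => by rw [hd0 y hy]; rfl
  have h2 := integral_mul_fderiv_eq_neg_fderiv_mul_of_integrable (μ := volume) (𝕜 := ℝ)
    (f := fun _ : E n => (1 : ℝ)) (g := F) (v := EuclideanSpace.single i 1)
    (by simp) (by simpa using hd)
    (by simpa using hcd.continuous.integrable_of_hasCompactSupport hsupp)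
    (fun y _ => differentiableAt_const _) fun y _ => hcd.differentiable one_ne_zero y
  refine ⟨hd.integrableOn.congr_fun h3 hU.measurableSet, ?_⟩
  rw [h1]
  simpa using h2

/-- Differentiation under the integral sign for functions with compact support in a domain. -/
theorem hasDerivWithinAt_setIntegral {a b : ℝ} (hab : a < b) (hU : IsOpen U) (hK : IsCompact K)
    (hKU : K ⊆ U) (k : SmoothRing.smoothRing (Icc a b ×ˢ U)) (F : ℝ → E n → ℝ)
    (hF : ∀ s (hs : s ∈ Icc a b) y (hy : y ∈ U), F s y = SmoothRing.ev (pt hs hy) k)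
    (F' : ℝ → E n → ℝ)
    (hF' : ∀ s (hs : s ∈ Icc a b) y (hy : y ∈ U), F' s y =
      SmoothRing.ev (pt hs hy) (dτ hab hU k))
    (h0 : ∀ s ∈ Icc a b, ∀ y ∈ U, y ∉ K → F s y = 0) {τ : ℝ} (hτ : τ ∈ Icc a b) :
    HasDerivWithinAt (fun s => ∫ y in U, F s y) (∫ y in U, F' τ y) (Icc a b) τ := by
  have hd : ∀ y ∈ U, ∀ s ∈ Icc a b, HasDerivWithinAt (fun s => F s y) (F' s y) (Icc a b) s := by
    intro y hy s hs
    rw [hF' s hs y hy]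
    exact hasDerivWithinAt_of_ev hab hU hs hy k _ fun r hr => hF r hr y hy
  have h0' : ∀ s ∈ Icc a b, ∀ y ∈ U, y ∉ K → F' s y = 0 := by
    intro s hs y hy hyK
    refine (uniqueDiffOn_Icc hab s hs).eq_deriv _ (hd y hy s hs) ?_
    exact (hasDerivWithinAt_const s _ (0 : ℝ)).congr (fun r hr => h0 r hr y hy hyK)
      (h0 s hs y hy hyK)
  have hc : ∀ k : SmoothRing.smoothRing (Icc a b ×ˢ U),
      ContinuousOn (SmoothRing.ext k) (Icc a b ×ˢ K) := fun k =>
    (SmoothRing.contDiffOn_ext k).continuousOn.mono (prod_mono_right hKU)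
  -- Off `K` nothing is integrated, so both integrals live on the compact set `K`, where continuity
  -- on [a, b] × K provides a uniform bound for the time derivative.
  have hr : ∀ H : E n → ℝ, (∀ y ∈ U, y ∉ K → H y = 0) → ∫ y in U, H y = ∫ y in K, H y := by
    intro H hH
    exact setIntegral_eq_of_subset_of_forall_sdiff_eq_zero hU.measurableSet hKU
      fun y hy => hH y hy.1 hy.2
  obtain ⟨C, hC⟩ := (isCompact_Icc.prod hK).exists_bound_of_continuousOn (hc (dτ hab hU k))
  have : IsFiniteMeasure (volume.restrict K) := ⟨by
    rw [Measure.restrict_apply_univ]; exact hK.measure_lt_top⟩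
  have h1 : HasDerivWithinAt (fun s => ∫ y in K, F s y) (∫ y in K, F' τ y) (Icc a b) τ := by
    refine hasDerivWithinAt_integral_of_bound (C := C) (fun s hs => ?_) ?_ ?_ hτ
    · have h2 : ContinuousOn (F s) K := by
        refine ((hc k).comp (f := fun y => (s, y)) (by fun_prop) fun y hy => ⟨hs, hy⟩).congr
          fun y hy => ?_
        rw [hF s hs y (hKU hy)]
        exact (SmoothRing.ext_apply k (pt hs (hKU hy))).symm
      exact h2.integrableOn_compact hK
    · exact (ae_restrict_mem hK.measurableSet).mono fun y hy s hs => hd y (hKU hy) s hs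
    · refine (ae_restrict_mem hK.measurableSet).mono fun y hy s hs => ?_
      have := hC (s, y) ⟨hs, hy⟩
      rw [hF' s hs y (hKU hy), ← SmoothRing.ext_apply]
      exact this
  rw [hr _ (h0' τ hτ)]
  exact h1.congr (fun s hs => hr _ (h0 s hs)) (hr _ (h0 τ hτ))

end Euclidean

end LMinus

/-! ### The Riemannian measure: finiteness and independence of the charts. -/

namespace LMinus

section Volume

set_option linter.unusedSectionVars false

variable {n : ℕ} {M : Type*} [TopologicalSpace M] [ChartedSpace (E n) M]
  [IsManifold (𝓡 n) ∞ M]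

theorem continuousOn_sqrt_det (g : Metric n M) (x₀ : M) :
    ContinuousOn (fun y => √(chartMetric g x₀ y).det) (extChartAt (𝓡 n) x₀).target := by
  -- A single metric viewed as a constant family, so that the smoothness result for families
  -- applies.
  have hg : IsSmoothMetricFamily (fun _ : ℝ => g) (Icc 0 1) :=
    (g.contMDiff.comp contMDiff_snd).contMDiffOn
  have h1 : ∀ i j, ContinuousOn (fun y => chartMetric g x₀ y i j) (extChartAt (𝓡 n) x₀).target :=
    fun i j => (contDiffOn_chartMetric hg x₀ i j).continuousOn.comp (f := fun y => ((0 : ℝ), y))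
      (by fun_prop) fun y hy => ⟨left_mem_Icc.2 zero_le_one, hy⟩
  refine Real.continuous_sqrt.comp_continuousOn ?_
  simp only [Matrix.det_apply]
  exact continuousOn_finsetSum _ fun σ _ =>
    (continuousOn_finsetProd _ fun i _ => h1 _ _).const_smul _

/-- The weight may be unbounded near the edge of the chart, but the support of `h` is compact and
contained in the chart, hence the integrand vanishes off a compact subset of the target. -/
theorem integrableOn_chart [CompactSpace M] {x₀ : M} {h : M → ℝ} (hh : Continuous h)
    (hs : tsupport h ⊆ (extChartAt (𝓡 n) x₀).source) {w : E n → ℝ}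
    (hw : ContinuousOn w (extChartAt (𝓡 n) x₀).target) :
    IntegrableOn (fun y => h ((extChartAt (𝓡 n) x₀).symm y) * w y)
      (extChartAt (𝓡 n) x₀).target := by
  set K := extChartAt (𝓡 n) x₀ '' tsupport h with hK
  have hKc : IsCompact K :=
    (isClosed_tsupport h).isCompact.image_of_continuousOn ((continuousOn_extChartAt x₀).mono hs)
  have hKU : K ⊆ (extChartAt (𝓡 n) x₀).target := by
    rintro _ ⟨x, hx, rfl⟩; exact (extChartAt (𝓡 n) x₀).map_source (hs hx)
  have h1 : IntegrableOn (fun y => h ((extChartAt (𝓡 n) x₀).symm y) * w y) K :=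
    (((hh.comp_continuousOn (continuousOn_extChartAt_symm x₀)).mul hw).mono
      hKU).integrableOn_compact hKc
  refine h1.of_forall_sdiff_eq_zero (isOpen_extChartAt_target x₀).measurableSet fun y hy => ?_
  have : (extChartAt (𝓡 n) x₀).symm y ∉ tsupport h := fun hx =>
    hy.2 ⟨_, hx, (extChartAt (𝓡 n) x₀).right_inv hy.1⟩
  rw [image_eq_zero_of_notMem_tsupport this, zero_mul]

variable [T2Space M] [CompactSpace M]

theorem tsupport_chartPartition (x₀ : M) :
    tsupport (chartPartition n M x₀) ⊆ (extChartAt (𝓡 n) x₀).source := by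
  rw [extChartAt_source]
  exact (SmoothPartitionOfUnity.exists_isSubordinate_chartAt_source (𝓡 n) M).choose_spec x₀

theorem finite_chartPartition :
    {x₀ : M | (Function.support (chartPartition n M x₀)).Nonempty}.Finite :=
  (chartPartition n M).locallyFinite.finite_nonempty_of_compact

variable (n M) in
/-- The indices of the nonzero functions of the partition of unity. -/
def chartIndices : Finset M := (finite_chartPartition (n := n) (M := M)).toFinset

theorem chartPartition_eq_zero {x₀ : M} (h : x₀ ∉ chartIndices n M) (x : M) :
    chartPartition n M x₀ x = 0 := by
  by_contra h0
  exact h ((finite_chartPartition).mem_toFinset.2 ⟨x, h0⟩)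

theorem sum_chartPartition (x : M) : ∑ x₀ ∈ chartIndices n M, chartPartition n M x₀ x = 1 := by
  rw [← (chartPartition n M).sum_eq_one (mem_univ x)]
  refine (finsum_eq_sum_of_support_subset _ fun x₀ hx => ?_).symm
  by_contra h
  exact hx (chartPartition_eq_zero h x)

/-- The integral of a function over a chart. -/
def chartIntegral (g : Metric n M) (x₀ : M) (h : M → ℝ) : ℝ :=
  ∫ y in (extChartAt (𝓡 n) x₀).target, h ((extChartAt (𝓡 n) x₀).symm y) * √(chartMetric g x₀ y).det

variable [MeasurableSpace M] [BorelSpace M]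

/-- The contribution of a chart to the Riemannian measure. -/
def chartVol (g : Metric n M) (x₀ : M) : Measure M :=
  ((volume.restrict (extChartAt (𝓡 n) x₀).target).withDensity fun y =>
    ENNReal.ofReal (chartPartition n M x₀ ((extChartAt (𝓡 n) x₀).symm y) *
      √(chartMetric g x₀ y).det)).map (extChartAt (𝓡 n) x₀).symm

theorem continuous_chartPartition (x₀ : M) : Continuous (chartPartition n M x₀) :=
  (chartPartition n M x₀).contMDiff.continuous

theorem integrableOn_density (g : Metric n M) (x₀ : M) :
    IntegrableOn (fun y => chartPartition n M x₀ ((extChartAt (𝓡 n) x₀).symm y) *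
      √(chartMetric g x₀ y).det) (extChartAt (𝓡 n) x₀).target :=
  integrableOn_chart (continuous_chartPartition x₀) (tsupport_chartPartition x₀)
    (continuousOn_sqrt_det g x₀)

theorem aemeasurable_symm (g : Metric n M) (x₀ : M) :
    AEMeasurable (extChartAt (𝓡 n) x₀).symm
      ((volume.restrict (extChartAt (𝓡 n) x₀).target).withDensity fun y =>
        ENNReal.ofReal (chartPartition n M x₀ ((extChartAt (𝓡 n) x₀).symm y) *
          √(chartMetric g x₀ y).det)) :=
  ((continuousOn_extChartAt_symm x₀).aemeasurable
    (isOpen_extChartAt_target x₀).measurableSet).mono_ac (withDensity_absolutelyContinuous _ _)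

instance isFiniteMeasure_chartVol (g : Metric n M) (x₀ : M) : IsFiniteMeasure (chartVol g x₀) := by
  constructor
  rw [chartVol, Measure.map_apply_of_aemeasurable (aemeasurable_symm g x₀) MeasurableSet.univ,
    preimage_univ, withDensity_apply _ MeasurableSet.univ, Measure.restrict_univ]
  exact (integrableOn_density g x₀).lintegral_lt_top

theorem integral_chartVol (g : Metric n M) (x₀ : M) {f : M → ℝ} (hf : Continuous f) :
    ∫ x, f x ∂chartVol g x₀ = chartIntegral g x₀ fun x => chartPartition n M x₀ x * f x := by
  rw [chartVol, integral_map (aemeasurable_symm g x₀) hf.aestronglyMeasurable,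
    integral_withDensity_eq_integral_toReal_smul₀
      (integrableOn_density g x₀).aemeasurable.ennreal_ofReal (by simp)]
  refine setIntegral_congr_fun (isOpen_extChartAt_target x₀).measurableSet fun y _ => ?_
  simp only [smul_eq_mul]
  rw [ENNReal.toReal_ofReal (mul_nonneg ((chartPartition n M).nonneg _ _) (Real.sqrt_nonneg _))]
  ring

/-- On a compact manifold a locally finite partition of unity has only finitely many nonzero
members, so the sum over all points of `M` is finite. -/
theorem dvol_eq_sum (g : Metric n M) : dvol g = ∑ x₀ ∈ chartIndices n M, chartVol g x₀ := by
  have h0 : ∀ x₀ ∉ chartIndices n M, chartVol g x₀ = 0 := by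
    intro x₀ hx₀
    simp only [chartVol, chartPartition_eq_zero hx₀, zero_mul, ENNReal.ofReal_zero]
    simp
  refine Measure.ext fun s hs => ?_
  rw [dvol, Measure.sum_apply _ hs, Measure.finsetSum_apply]
  exact tsum_eq_sum fun x₀ hx₀ => by
    have := h0 x₀ hx₀
    rw [chartVol] at this
    rw [this]; rfl

instance isFiniteMeasure_dvol (g : Metric n M) : IsFiniteMeasure (dvol g) := by
  rw [dvol_eq_sum]; infer_instance

theorem integrable_dvol (g : Metric n M) {f : M → ℝ} (hf : Continuous f) :
    Integrable f (dvol g) :=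
  hf.integrable_of_hasCompactSupport (HasCompactSupport.of_compactSpace f)

theorem integral_dvol (g : Metric n M) {f : M → ℝ} (hf : Continuous f) :
    ∫ x, f x ∂dvol g = ∑ x₀ ∈ chartIndices n M,
      chartIntegral g x₀ fun x => chartPartition n M x₀ x * f x := by
  rw [dvol_eq_sum, integral_finsetSum_measure fun x₀ _ =>
    hf.integrable_of_hasCompactSupport (HasCompactSupport.of_compactSpace f)]
  exact Finset.sum_congr rfl fun x₀ _ => integral_chartVol g x₀ hf

/-- Change of variables. -/
theorem chartIntegral_eq (g : Metric n M) (x x₀ : M) {h : M → ℝ}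
    (hx : ∀ z ∉ (extChartAt (𝓡 n) x).source, h z = 0)
    (hx₀ : ∀ z ∉ (extChartAt (𝓡 n) x₀).source, h z = 0) :
    chartIntegral g x h = chartIntegral g x₀ h := by
  have h1 : ∀ x x₀ : M, (∀ z ∉ (extChartAt (𝓡 n) x₀).source, h z = 0) →
      chartIntegral g x h = ∫ y in overlap n x x₀,
        h ((extChartAt (𝓡 n) x).symm y) * √(chartMetric g x y).det := by
    intro x x₀ hx₀
    refine setIntegral_eq_of_subset_of_forall_sdiff_eq_zero
      (isOpen_extChartAt_target x).measurableSet inter_subset_left fun y hy => ?_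
    rw [hx₀ _ fun hz => hy.2 ⟨hy.1, hz⟩, zero_mul]
  have himage : transition n x x₀ '' overlap n x x₀ = overlap n x₀ x := by
    refine Subset.antisymm (image_subset_iff.2 (mapsTo_transition_overlap x x₀)) fun y hy => ?_
    exact ⟨_, mapsTo_transition_overlap x₀ x hy, transition_transition x₀ x hy⟩
  rw [h1 x x₀ hx₀, h1 x₀ x hx, ← himage,
    integral_image_eq_integral_abs_det_fderiv_smul volume (isOpen_overlap x x₀).measurableSet
      (fun y hy => (differentiableAt_transition x x₀ hy).hasFDerivAt.hasFDerivWithinAt)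
      (fun y hy z hz hyz => by
        rw [← transition_transition x x₀ hy, hyz, transition_transition x x₀ hz])]
  refine setIntegral_congr_fun (isOpen_overlap x x₀).measurableSet fun y hy => ?_
  set J : Matrix (Fin n) (Fin n) ℝ := Matrix.of fun k i =>
    (fderiv ℝ (transition n x x₀) y (EuclideanSpace.single i 1)) k with hJ
  -- The metric changes by congruence, so √det acquires the factor |det J|, which is the factor in
  -- the change of variables formula.
  have h2 : chartMetric g x y = J.transpose * chartMetric g x₀ (transition n x x₀ y) * J := by
    ext i j
    rw [chartMetric_change g x x₀ hy]
    simp only [Matrix.mul_apply, Matrix.transpose_apply, hJ, Matrix.of_apply, Finset.sum_mul]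
    rw [Finset.sum_comm]
    exact Finset.sum_congr rfl fun _ _ => Finset.sum_congr rfl fun _ _ => by ring
  have h3 : (fderiv ℝ (transition n x x₀) y).det = J.det := by
    rw [ContinuousLinearMap.det,
      ← LinearMap.det_toMatrix (EuclideanSpace.basisFun (Fin n) ℝ).toBasis]
    congr 1
  simp only [smul_eq_mul]
  rw [symm_transition x x₀ hy, h2, Matrix.det_mul, Matrix.det_mul, Matrix.det_transpose, h3,
    mul_right_comm, Real.sqrt_mul' _ (chartMetric_posDef g x₀ (mapsTo_transition x x₀ hy)).det_pos.le,
    Real.sqrt_mul_self_eq_abs]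
  ring

/-- Each piece cut off by the partition of unity can be computed in the chart at `x₀` instead, and
there the cut-offs add up to 1. -/
theorem integral_eq_chartIntegral (g : Metric n M) {x₀ : M} {h : M → ℝ} (hh : Continuous h)
    (hs : tsupport h ⊆ (extChartAt (𝓡 n) x₀).source) :
    ∫ x, h x ∂dvol g = chartIntegral g x₀ h := by
  have h0 : ∀ z ∉ (extChartAt (𝓡 n) x₀).source, h z = 0 := fun z hz =>
    image_eq_zero_of_notMem_tsupport fun h => hz (hs h)
  have h1 : ∀ k ∈ chartIndices n M, chartIntegral g k (fun x => chartPartition n M k x * h x) =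
      chartIntegral g x₀ fun x => chartPartition n M k x * h x := fun k _ =>
    chartIntegral_eq g k x₀
      (fun z hz => by
        rw [image_eq_zero_of_notMem_tsupport fun h => hz (tsupport_chartPartition k h), zero_mul])
      (fun z hz => by rw [h0 z hz, mul_zero])
  rw [integral_dvol g hh, Finset.sum_congr rfl h1]
  simp only [chartIntegral]
  rw [← integral_finsetSum]
  · refine setIntegral_congr_fun (isOpen_extChartAt_target x₀).measurableSet fun y _ => ?_
    simp only [← Finset.sum_mul, sum_chartPartition, one_mul]
  · intro k _
    exact integrableOn_chart ((continuous_chartPartition k).mul hh)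
      ((tsupport_mul_subset_right).trans hs) (continuousOn_sqrt_det g x₀)

end Volume

end LMinus

/-! ### The divergence theorem and the derivative of integrals in time. -/

namespace LMinus

open SmoothRing CoordGeom

section Divergence

set_option linter.unusedSectionVars false

variable {n : ℕ} {M : Type*} [TopologicalSpace M] [ChartedSpace (E n) M]
  [IsManifold (𝓡 n) ∞ M] {a b : ℝ} (hab : a < b) {τ : ℝ} (hτ : τ ∈ Icc a b)
  {g : ℝ → Metric n M} (hg : IsBackwardRicciFlow g (Icc a b)) {u v : ℝ → M → ℝ}
  (hu : IsSmoothFamily n u (Icc a b)) (hv : IsSmoothFamily n v (Icc a b))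

/-- The Riemannian density in a chart. -/
def chQ (x₀ : M) : smoothRing (Icc a b ×ˢ (extChartAt (𝓡 n) x₀).target) :=
  SmoothRing.sqrt (chG hg x₀).det (det_chartG_pos _ _)

theorem chQ_mul_chQ (x₀ : M) : chQ hg x₀ * chQ hg x₀ = (chG hg x₀).det := sqrt_mul_sqrt _ _

theorem ev_chQ (x₀ : M) {y : E n} (hy : y ∈ (extChartAt (𝓡 n) x₀).target) :
    ev (pt hτ hy) (chQ hg x₀) = √(chartMetric (g τ) x₀ y).det := by
  rw [chQ, ev_sqrt, ev_det, map_ev_chartG]; rfl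

theorem exists_chQ_inverse (x₀ : M) : ∃ r, r * chQ hg x₀ = 1 := by
  obtain ⟨r, hr⟩ := exists_mul_eq_one (chQ hg x₀) fun p => by
    rw [chQ, ev_sqrt]; exact (Real.sqrt_pos.2 (det_chartG_pos _ _ p)).ne'
  exact ⟨r, by rw [mul_comm, hr]⟩

include hab hτ hg hu hv in
/-- The divergence theorem for a vector field with support in a chart. -/
theorem chartIntegral_divGrad [CompactSpace M] {x₀ : M} {K : Set M} (hK : IsClosed K)
    (hKs : K ⊆ (extChartAt (𝓡 n) x₀).source) (h0 : ∀ x ∉ K, u τ x = 0) :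
    chartIntegral (g τ) x₀ (divGrad (g τ) (u τ) (v τ)) = 0 := by
  obtain ⟨r, hr⟩ := exists_chQ_inverse hg x₀
  have hd := (isFlow_chart hab hg x₀).density_mul_dvGrad (chQ_mul_chQ hg x₀) hr
    (chF x₀ hu) (chF x₀ hv)
  set U : Set (E n) := (extChartAt (𝓡 n) x₀).target with hUdef
  set f : Fin n → smoothRing (Icc a b ×ˢ (extChartAt (𝓡 n) x₀).target) := fun i =>
    chQ hg x₀ * (chF x₀ hu * CoordGeom.gradient (chD hab x₀) (chH hg x₀) (chF x₀ hv) i) with hf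
  have hU : IsOpen U := isOpen_extChartAt_target x₀
  have hKc : IsCompact (extChartAt (𝓡 n) x₀ '' K) :=
    hK.isCompact.image_of_continuousOn ((continuousOn_extChartAt x₀).mono hKs)
  have hKU : extChartAt (𝓡 n) x₀ '' K ⊆ U := by
    rintro _ ⟨x, hx, rfl⟩; exact (extChartAt (𝓡 n) x₀).map_source (hKs hx)
  have h1 : ∀ i, IntegrableOn (pd i fun z => ext (f i) (τ, z)) U ∧
      ∫ y in U, pd i (fun z => ext (f i) (τ, z)) y = 0 := fun i => by
    refine integral_pd_eq_zero hU hKc hKU ?_ (fun y hy hyK => ?_) i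
    · exact (contDiffOn_ext (f i)).comp (contDiff_prodMk_right τ).contDiffOn fun y hy => ⟨hτ, hy⟩
    · have hx : (extChartAt (𝓡 n) x₀).symm y ∉ K := fun hx =>
        hyK ⟨_, hx, (extChartAt (𝓡 n) x₀).right_inv hy⟩
      have h4 : ev (pt hτ hy) (chF x₀ hu) = 0 := h0 _ hx
      refine (ext_apply (f i) (pt hτ hy)).trans ?_
      rw [hf, map_mul, map_mul, h4, zero_mul, mul_zero]
  have h2 : chartIntegral (g τ) x₀ (divGrad (g τ) (u τ) (v τ)) =
      ∫ y in U, ∑ i, pd i (fun z => ext (f i) (τ, z)) y := by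
    refine setIntegral_congr_fun hU.measurableSet fun y hy => ?_
    have h3 := congrArg (ev (pt hτ hy)) hd
    rw [map_mul, ev_chQ, map_sum] at h3
    rw [divGrad_chart hab hτ hg x₀ hu hv hy, mul_comm, h3]
    exact Finset.sum_congr rfl fun i _ => (pd_eq_ev hab hU hτ hy (f i) _
      (fun z hz => ext_apply (f i) (pt hτ hz)) i).symm
  rw [h2, integral_finsetSum _ fun i _ => (h1 i).1]
  exact Finset.sum_eq_zero fun i _ => (h1 i).2

theorem innerGradFun_eq_zero {x : M} {f : M → ℝ} (w : M → ℝ) (hf : x ∉ tsupport f) (g : Metric n M) :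
    innerGradFun g f w x = 0 := by
  have h1 : f =ᶠ[nhds x] fun _ => 0 := notMem_tsupport_iff_eventuallyEq.1 hf
  have h2 : ∀ v, dif f x v = 0 := fun v => by
    change mfderiv (𝓡 n) 𝓘(ℝ, ℝ) f x v = 0
    rw [h1.mfderiv_eq, mfderiv_const]; rfl
  have h3 : grad g f x = 0 := by simp [grad, h2]
  rw [innerGradFun, h3, map_zero]; rfl

variable [T2Space M] [CompactSpace M] [MeasurableSpace M] [BorelSpace M]

theorem isSmoothFamily_chartPartition (k : M) {S : Set ℝ} :
    IsSmoothFamily n (fun _ => chartPartition n M k) S :=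
  isSmoothFamily_space (chartPartition n M k).contMDiff

include hab hτ hg hv in
-- The sum is the inner product with the gradient of the constant function 1.
theorem sum_innerGradFun_chartPartition (x : M) : ∑ k ∈ chartIndices n M,
    innerGradFun (g τ) (chartPartition n M k) (v τ) x = 0 := by
  have h1 : ∀ k ∈ chartIndices n M, innerGradFun (g τ) (chartPartition n M k) (v τ) x =
      ev (pt hτ (mem_extChartAt_target x)) (innerGrad (chD hab x) (chH hg x)
        (chF x (isSmoothFamily_chartPartition k)) (chF x hv)) := fun k _ => by
    rw [← chF_innerGradFun hab hg, ev_chF_center]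
  have h2 : ∑ k ∈ chartIndices n M, chF (a := a) (b := b) x (isSmoothFamily_chartPartition k) = 1 :=
    hom_ext_pt fun τ hτ y hy => by
      rw [map_sum, map_one]
      exact sum_chartPartition _
  have h3 : ∑ k ∈ chartIndices n M, innerGrad (chD hab x) (chH hg x)
      (chF x (isSmoothFamily_chartPartition k)) (chF x hv) =
      innerGrad (chD hab x) (chH hg x)
        (∑ k ∈ chartIndices n M, chF x (isSmoothFamily_chartPartition k)) (chF x hv) := by
    simp only [innerGrad_eq_sum, map_sum, Finset.sum_mul]
    exact Finset.sum_comm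
  rw [Finset.sum_congr rfl h1, ← map_sum, h3, h2]
  rw [innerGrad_eq_sum, Finset.sum_eq_zero fun i _ => by
    rw [Derivation.map_one_eq_zero, zero_mul], map_zero]

include hab hτ hg hu hv in
/-- The divergence theorem. -/
theorem integral_divGrad : ∫ x, divGrad (g τ) (u τ) (v τ) x ∂dvol (g τ) = 0 := by
  have hp : ∀ k, IsSmoothFamily n (fun τ x => chartPartition n M k x * u τ x) (Icc a b) :=
    fun k => (isSmoothFamily_chartPartition k).mul hu
  have hm : ∀ k x, divGrad (g τ) (fun x => chartPartition n M k x * u τ x) (v τ) x =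
      chartPartition n M k x * divGrad (g τ) (u τ) (v τ) x +
        u τ x * innerGradFun (g τ) (chartPartition n M k) (v τ) x := fun k x =>
    divGrad_mul hab hτ hg hu hv (isSmoothFamily_chartPartition k) x
  have hc : ∀ k, Continuous (divGrad (g τ) (fun x => chartPartition n M k x * u τ x) (v τ)) :=
    fun k => (isSmoothFamily_divGrad hab hg (hp k) hv).continuous hτ
  -- The terms in which the cut-off functions are differentiated add up to zero, so the divergence
  -- is a sum of divergences of fields supported in single charts.
  have h1 : ∀ x, divGrad (g τ) (u τ) (v τ) x = ∑ k ∈ chartIndices n M,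
      divGrad (g τ) (fun x => chartPartition n M k x * u τ x) (v τ) x := by
    intro x
    simp only [hm, Finset.sum_add_distrib, ← Finset.sum_mul, ← Finset.mul_sum]
    rw [sum_chartPartition, sum_innerGradFun_chartPartition hab hτ hg hv]; ring
  simp only [h1]
  rw [integral_finsetSum _ fun k _ => integrable_dvol (g τ) (hc k)]
  refine Finset.sum_eq_zero fun k _ => ?_
  have h2 : tsupport (divGrad (g τ) (fun x => chartPartition n M k x * u τ x) (v τ)) ⊆
      tsupport (chartPartition n M k) := by
    refine closure_minimal (fun x hx => ?_) (isClosed_tsupport _)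
    by_contra h
    refine hx ?_
    rw [hm, innerGradFun_eq_zero _ h, image_eq_zero_of_notMem_tsupport h]; ring
  rw [integral_eq_chartIntegral (g τ) (hc k) (h2.trans (tsupport_chartPartition k))]
  exact chartIntegral_divGrad hab hτ hg (hp k) hv (isClosed_tsupport _)
    (tsupport_chartPartition k) fun x hx => by
      rw [image_eq_zero_of_notMem_tsupport hx, zero_mul]

include hab hτ hg hu in
/-- The time derivative of the integral of a function. -/
theorem hasDerivWithinAt_integral_dvol :
    HasDerivWithinAt (fun s => ∫ x, u s x ∂dvol (g s))
      (∫ x, (timeDeriv (Icc a b) u τ x + LMinus.scal (g τ) x * u τ x) ∂dvol (g τ))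
      (Icc a b) τ := by
  have hw : IsSmoothFamily n
      (fun τ x => timeDeriv (Icc a b) u τ x + LMinus.scal (g τ) x * u τ x) (Icc a b) :=
    (isSmoothFamily_timeDeriv hab hu).add ((isSmoothFamily_scal hab hg).mul hu)
  rw [integral_dvol (g τ) (hw.continuous hτ)]
  have h1 : ∀ s ∈ Icc a b, ∫ x, u s x ∂dvol (g s) = ∑ k ∈ chartIndices n M,
      chartIntegral (g s) k fun x => chartPartition n M k x * u s x := fun s hs =>
    integral_dvol (g s) (hu.continuous hs)
  refine HasDerivWithinAt.congr ?_ h1 (h1 τ hτ)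
  refine HasDerivWithinAt.fun_sum fun k _ => ?_
  have hp := isSmoothFamily_chartPartition (n := n) k (S := Icc a b)
  obtain ⟨r, hr⟩ := exists_chQ_inverse hg k
  have hq := (isFlow_chart hab hg k).time_density (chQ_mul_chQ hg k) hr
  have hp0 : chT hab k (chF k hp) = 0 := hom_ext_pt fun s hs y hy => by
    rw [← timeDeriv_chart hab hs k hp hy, map_zero]
    exact (hasDerivWithinAt_const s (Icc a b) _).derivWithin (uniqueDiffOn_Icc hab s hs)
  have hKc : IsCompact (extChartAt (𝓡 n) k '' tsupport (chartPartition n M k)) :=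
    (isClosed_tsupport _).isCompact.image_of_continuousOn
      ((continuousOn_extChartAt k).mono (tsupport_chartPartition k))
  have hKU : extChartAt (𝓡 n) k '' tsupport (chartPartition n M k) ⊆
      (extChartAt (𝓡 n) k).target := by
    rintro _ ⟨x, hx, rfl⟩; exact (extChartAt (𝓡 n) k).map_source (tsupport_chartPartition k hx)
  refine hasDerivWithinAt_setIntegral hab (isOpen_extChartAt_target k) hKc hKU
    (chF k hp * chF k hu * chQ hg k) _ (fun s hs y hy => ?_)
    (fun s y => chartPartition n M k ((extChartAt (𝓡 n) k).symm y) *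
      (timeDeriv (Icc a b) u s ((extChartAt (𝓡 n) k).symm y) +
        LMinus.scal (g s) ((extChartAt (𝓡 n) k).symm y) * u s ((extChartAt (𝓡 n) k).symm y)) *
          √(chartMetric (g s) k y).det) (fun s hs y hy => ?_) (fun s hs y hy hyK => ?_) hτ
  · rw [map_mul, map_mul, ev_chQ]; rfl
  -- The cut-off does not depend on time, and under the flow the density grows at rate R.
  · have e : chT hab k (chF k hp * chF k hu * chQ hg k) =
        chF k hp * (chT hab k (chF k hu) + CoordGeom.scal (chD hab k) (chG hg k) (chH hg k) *
          chF k hu) * chQ hg k := by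
      rw [Derivation.leibniz, Derivation.leibniz, hq, hp0]
      simp only [smul_eq_mul]; ring
    rw [e, map_mul, map_mul, map_add, map_mul, ev_chQ, ← timeDeriv_chart hab hs k hu hy,
      ← scal_chart hab hs hg k hy]
    rfl
  · have hx : (extChartAt (𝓡 n) k).symm y ∉ tsupport (chartPartition n M k) := fun hx =>
      hyK ⟨_, hx, (extChartAt (𝓡 n) k).right_inv hy⟩
    change _ * u s _ * _ = 0
    rw [image_eq_zero_of_notMem_tsupport hx, zero_mul, zero_mul]

end Divergence

end LMinus

/-! ### Integrals against the transported measure. -/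

namespace LMinus

section Transport

set_option linter.unusedSectionVars false

variable {n : ℕ} {M : Type*} [TopologicalSpace M] [ChartedSpace (E n) M]
  [IsManifold (𝓡 n) ∞ M] {a b : ℝ} (hab : a < b) {τ : ℝ} (hτ : τ ∈ Icc a b)
  {g : ℝ → Metric n M} (hg : IsBackwardRicciFlow g (Icc a b)) {ρ φ : ℝ → M → ℝ}
  (hρ : IsSmoothFamily n ρ (Icc a b)) (hφ : IsSmoothFamily n φ (Icc a b))
  (hT : TransportEq g ρ φ (Icc a b))

theorem dif_log {f : M → ℝ} {x : M} (hf : MDifferentiableAt (𝓡 n) 𝓘(ℝ, ℝ) f x) (h0 : f x ≠ 0)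
    (v : TangentSpace (𝓡 n) x) : dif (fun x => Real.log (f x)) x v = (f x)⁻¹ * dif f x v := by
  have h1 : HasFDerivAt Real.log _ (f x) := (Real.hasDerivAt_log h0).hasFDerivAt
  have h2 := mfderiv_comp (I := 𝓡 n) (I' := 𝓘(ℝ, ℝ)) (I'' := 𝓘(ℝ, ℝ)) x
    h1.differentiableAt.mdifferentiableAt hf
  rw [mfderiv_eq_fderiv, h1.fderiv] at h2
  refine (DFunLike.congr_fun h2 v).trans ?_
  exact mul_comm (dif f x v) (f x)⁻¹

theorem grad_log (g : Metric n M) {f : M → ℝ} {x : M}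
    (hf : MDifferentiableAt (𝓡 n) 𝓘(ℝ, ℝ) f x) (h0 : f x ≠ 0) :
    grad g (fun x => Real.log (f x)) x = (f x)⁻¹ • grad g f x := by
  simp only [grad, Finset.smul_sum, smul_smul, dif_log hf h0, Finset.mul_sum]
  refine Finset.sum_congr rfl fun i _ => ?_
  congr 1
  exact Finset.sum_congr rfl fun j _ => by ring

theorem innerGradFun_log (g : Metric n M) {f : M → ℝ} (w : M → ℝ) {x : M}
    (hf : MDifferentiableAt (𝓡 n) 𝓘(ℝ, ℝ) f x) (h0 : f x ≠ 0) :
    innerGradFun g (fun x => Real.log (f x)) w x = (f x)⁻¹ * innerGradFun g f w x := by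
  rw [innerGradFun, grad_log g hf h0, map_smul]; rfl

include hab hτ hT in
theorem TransportEq.timeDeriv (x : M) : timeDeriv (Icc a b) ρ τ x =
    -divGrad (g τ) (ρ τ) (φ τ) x - LMinus.scal (g τ) x * ρ τ x :=
  (hT τ hτ x).derivWithin (uniqueDiffOn_Icc hab τ hτ)

include hab hτ hg hρ hφ hT in
-- Expanding the divergence by the product rule, the transport equation says that ρ decays at rate
-- Δφ + R along the flow lines of ∇φ.
theorem flowDeriv_log (hpos : ∀ τ ∈ Icc a b, ∀ x, 0 < ρ τ x) (x : M) :
    flowDeriv g φ (Icc a b) (fun τ x => Real.log (ρ τ x)) τ x = -lapScal g φ τ x := by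
  have h0 := (hpos τ hτ x).ne'
  have h1 := ((hT τ hτ x).log h0).derivWithin (uniqueDiffOn_Icc hab τ hτ)
  have h2 := divGrad_mul hab hτ hg (isSmoothFamily_const 1) hφ hρ x
  simp only [mul_one, one_mul] at h2
  rw [flowDeriv, LMinus.timeDeriv, h1,
    innerGradFun_log _ _ (mdifferentiable_of_isSmoothFamily hρ hτ x) h0, h2, lapScal]
  field_simp
  ring

variable [T2Space M] [CompactSpace M] [MeasurableSpace M] [BorelSpace M]

variable (g ρ) in
/-- The integral of `f` against `ρ dvol`. -/
def weightedIntegral (f : ℝ → M → ℝ) (τ : ℝ) : ℝ := ∫ x, f τ x * ρ τ x ∂dvol (g τ)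

include hτ hρ in
theorem integrable_weighted {f : ℝ → M → ℝ} (hf : IsSmoothFamily n f (Icc a b)) :
    Integrable (fun x => f τ x * ρ τ x) (dvol (g τ)) :=
  integrable_dvol (g τ) ((hf.continuous hτ).mul (hρ.continuous hτ))

include hab hτ hg hρ hφ hT in
-- The term R f ρ from the growth of the volume cancels -Rρ in the transport equation. Moving ∇φ
-- onto `f` costs only the divergence of f ρ ∇φ, whose integral vanishes.
theorem hasDerivWithinAt_weightedIntegral {f : ℝ → M → ℝ} (hf : IsSmoothFamily n f (Icc a b)) :
    HasDerivWithinAt (weightedIntegral g ρ f)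
      (weightedIntegral g ρ (flowDeriv g φ (Icc a b) f) τ) (Icc a b) τ := by
  have h1 := hasDerivWithinAt_integral_dvol hab hτ hg (hf.mul hρ)
  have h2 : ∀ x, timeDeriv (Icc a b) (fun τ x => f τ x * ρ τ x) τ x +
      LMinus.scal (g τ) x * (f τ x * ρ τ x) = flowDeriv g φ (Icc a b) f τ x * ρ τ x -
        divGrad (g τ) (fun x => f τ x * ρ τ x) (φ τ) x := by
    intro x
    have h3 : timeDeriv (Icc a b) (fun τ x => f τ x * ρ τ x) τ x =
        timeDeriv (Icc a b) f τ x * ρ τ x + f τ x * timeDeriv (Icc a b) ρ τ x :=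
      ((hf.hasDerivWithinAt hab hτ x).mul (hρ.hasDerivWithinAt hab hτ x)).derivWithin
        (uniqueDiffOn_Icc hab τ hτ)
    rw [h3, hT.timeDeriv hab hτ, divGrad_mul hab hτ hg hρ hφ hf, flowDeriv]
    ring
  simp only [h2] at h1
  rw [integral_sub (integrable_weighted hτ hρ (isSmoothFamily_flowDeriv hab hg hφ hf))
    (integrable_dvol (g τ) ((isSmoothFamily_divGrad hab hg (hf.mul hρ) hφ).continuous hτ)),
    integral_divGrad hab hτ hg (hf.mul hρ) hφ, sub_zero] at h1
  exact h1

end Transport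

section Norm

variable {n : ℕ} {M : Type*} [TopologicalSpace M] [ChartedSpace (E n) M]
  [IsManifold (𝓡 n) ∞ M]

/-- The squared norm is the quadratic form of the Kronecker square of the inverse Gram matrix, which
is positive semidefinite. -/
theorem normSq_nonneg (g : Metric n M) (x : M)
    (B : TangentSpace (𝓡 n) x → TangentSpace (𝓡 n) x → ℝ) : 0 ≤ normSq g x B := by
  have h1 : (gram g x)⁻¹.PosSemidef := by
    rw [← chartMetric_self]
    exact (chartMetric_posDef g x (mem_extChartAt_target x)).inv.posSemidef
  have h2 := (h1.kronecker h1).dotProduct_mulVec_nonneg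
    (fun p : Fin n × Fin n => B (frame x p.1) (frame x p.2))
  refine h2.trans_eq ?_
  simp only [normSq, dotProduct, Matrix.mulVec, Fintype.sum_prod_type, Pi.star_apply,
    star_trivial, Matrix.kronecker_apply, Finset.mul_sum]
  refine Finset.sum_congr rfl fun i _ => Finset.sum_congr rfl fun j _ =>
    Finset.sum_congr rfl fun p _ => Finset.sum_congr rfl fun q _ => by ring

end Norm

end LMinus

/-! ### Calculus of the operators τ^a d/dτ, and convexity in s = τ^(-1/2). -/

namespace LMinus

section Calculus

variable {S : Set ℝ} {F F₁ F₂ : ℝ → ℝ}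

theorem scaledDeriv_scaledDeriv (hS : UniqueDiffOn ℝ S) (hpos : ∀ τ ∈ S, 0 < τ)
    (h1 : ∀ τ ∈ S, HasDerivWithinAt F (F₁ τ) S τ)
    (h2 : ∀ τ ∈ S, HasDerivWithinAt F₁ (F₂ τ) S τ) (a : ℝ) {τ : ℝ} (hτ : τ ∈ S) :
    scaledDeriv a S (scaledDeriv a S F) τ = τ ^ (2 * a) * (F₂ τ + a / τ * F₁ τ) := by
  have h0 := hpos τ hτ
  have h3 : ∀ t ∈ S, scaledDeriv a S F t = t ^ a * F₁ t := fun t ht => by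
    rw [scaledDeriv, (h1 t ht).derivWithin (hS t ht)]
  have h4 : HasDerivWithinAt (fun t : ℝ => t ^ a * F₁ t)
      (a * τ ^ (a - 1) * F₁ τ + τ ^ a * F₂ τ) S τ :=
    (Real.hasDerivAt_rpow_const (Or.inl h0.ne')).hasDerivWithinAt.mul (h2 τ hτ)
  rw [scaledDeriv, (h4.congr h3 (h3 τ hτ)).derivWithin (hS τ hτ), Real.rpow_sub_one h0.ne',
    two_mul, Real.rpow_add h0]
  field_simp
  ring

theorem contDiffOn_two_of_hasDerivWithinAt (hS : UniqueDiffOn ℝ S)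
    (h1 : ∀ τ ∈ S, HasDerivWithinAt F (F₁ τ) S τ)
    (h2 : ∀ τ ∈ S, HasDerivWithinAt F₁ (F₂ τ) S τ) (h3 : ContinuousOn F₂ S) :
    ContDiffOn ℝ 2 F S := by
  have h4 : ContDiffOn ℝ 1 F₁ S := by
    rw [show (1 : WithTop ℕ∞) = 0 + 1 from (zero_add 1).symm, contDiffOn_succ_iff_derivWithin hS]
    exact ⟨fun τ hτ => (h2 τ hτ).differentiableWithinAt, by simp, contDiffOn_zero.2
      (h3.congr fun τ hτ => (h2 τ hτ).derivWithin (hS τ hτ))⟩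
  rw [← one_add_one_eq_two, contDiffOn_succ_iff_derivWithin hS]
  exact ⟨fun τ hτ => (h1 τ hτ).differentiableWithinAt, by simp,
    h4.congr fun τ hτ => (h1 τ hτ).derivWithin (hS τ hτ)⟩

theorem inv_sq_mem_Icc {a b s : ℝ} (ha : 0 < a) (hab : a ≤ b)
    (hs : s ∈ Icc (b ^ (-(1 / 2) : ℝ)) (a ^ (-(1 / 2) : ℝ))) :
    0 < s ∧ (s ^ 2)⁻¹ ∈ Icc a b := by
  have hb := ha.trans_le hab
  have h1 : ∀ {c : ℝ}, 0 < c → (c ^ (-(1 / 2) : ℝ)) ^ 2 = c⁻¹ := fun {c} hc => by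
    rw [← Real.rpow_natCast, ← Real.rpow_mul hc.le]
    norm_num
    exact Real.rpow_neg_one c
  have h2 : 0 < s := (Real.rpow_pos_of_pos hb _).trans_le hs.1
  have h3 := pow_le_pow_left₀ (Real.rpow_pos_of_pos hb _).le hs.1 2
  have h4 := pow_le_pow_left₀ h2.le hs.2 2
  rw [h1 hb] at h3
  rw [h1 ha] at h4
  exact ⟨h2, (le_inv_comm₀ (by positivity) ha).1 h4, (inv_le_comm₀ hb (by positivity)).1 h3⟩

/-- For s = τ^(-1/2) one has d/ds = -2 τ^(3/2) d/dτ, so the second derivative in s is 4τ³ times the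
expression assumed nonnegative, with τ³ = (s ^ 6)⁻¹. -/
theorem convexOn_comp_inv_sq {a b : ℝ} (ha : 0 < a) (hab : a ≤ b)
    (h1 : ∀ τ ∈ Icc a b, HasDerivWithinAt F (F₁ τ) (Icc a b) τ)
    (h2 : ∀ τ ∈ Icc a b, HasDerivWithinAt F₁ (F₂ τ) (Icc a b) τ)
    (h3 : ∀ τ ∈ Icc a b, 0 ≤ F₂ τ + 3 / 2 / τ * F₁ τ) :
    ConvexOn ℝ (Icc (b ^ (-(1 / 2) : ℝ)) (a ^ (-(1 / 2) : ℝ))) fun s => F (s ^ 2)⁻¹ := by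
  set D := Icc (b ^ (-(1 / 2) : ℝ)) (a ^ (-(1 / 2) : ℝ))
  have hm : MapsTo (fun s : ℝ => (s ^ 2)⁻¹) D (Icc a b) := fun s hs =>
    (inv_sq_mem_Icc ha hab hs).2
  have hd : ∀ s ∈ D, HasDerivWithinAt (fun s : ℝ => (s ^ 2)⁻¹) (-2 * (s ^ 3)⁻¹) D s := by
    intro s hs
    have h0 := (inv_sq_mem_Icc ha hab hs).1.ne'
    refine (((hasDerivAt_pow 2 s).fun_inv (pow_ne_zero 2 h0)).congr_deriv ?_).hasDerivWithinAt
    field_simp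
    norm_num [mul_comm]
  have hF : ∀ s ∈ D, HasDerivWithinAt (fun s => F (s ^ 2)⁻¹)
      (F₁ (s ^ 2)⁻¹ * (-2 * (s ^ 3)⁻¹)) D s := fun s hs =>
    (h1 _ (hm hs)).comp s (hd s hs) hm
  have hF' : ∀ s ∈ D, HasDerivWithinAt (fun s => F₁ (s ^ 2)⁻¹ * (-2 * (s ^ 3)⁻¹))
      (4 * (s ^ 6)⁻¹ * (F₂ (s ^ 2)⁻¹ + 3 / 2 / (s ^ 2)⁻¹ * F₁ (s ^ 2)⁻¹)) D s := by
    intro s hs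
    have h0 := (inv_sq_mem_Icc ha hab hs).1.ne'
    refine (((h2 _ (hm hs)).comp s (hd s hs) hm).mul
      (((hasDerivAt_pow 3 s).fun_inv (pow_ne_zero 3 h0)).const_mul (-2)).hasDerivWithinAt).congr_deriv
      ?_
    simp only [Function.comp_apply]
    field_simp
    push_cast
    ring
  refine convexOn_of_hasDerivWithinAt2_nonneg (convex_Icc _ _)
    (fun s hs => (hF s hs).continuousWithinAt)
    (fun s hs => (hF s (interior_subset hs)).mono interior_subset)
    (fun s hs => (hF' s (interior_subset hs)).mono interior_subset) fun s hs => ?_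
  have := (inv_sq_mem_Icc ha hab (interior_subset hs)).1
  exact mul_nonneg (by positivity) (h3 _ (hm (interior_subset hs)))

end Calculus

/-! ### First and second derivatives of the two entropies. -/

section Entropy

set_option linter.unusedSectionVars false

variable {n : ℕ} {M : Type*} [TopologicalSpace M] [ChartedSpace (E n) M]
  [IsManifold (𝓡 n) ∞ M] {a b : ℝ} (hab : a < b) {τ : ℝ} (hτ : τ ∈ Icc a b)
  {g : ℝ → Metric n M} (hg : IsBackwardRicciFlow g (Icc a b)) {ρ φ : ℝ → M → ℝ}
  (hρ : IsSmoothFamily n ρ (Icc a b)) (hφ : IsSmoothFamily n φ (Icc a b))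
  (ha : 0 < a) (hHJ : HamiltonJacobiEq g φ (Icc a b))

include hab hτ hg hφ ha hHJ in
-- The term Δφ/(2τ), left over from the Hamilton-Jacobi equation, combines with -(Δφ + R)/(2τ) to
-- -R/(2τ), which is half of the last Harnack term. The weight 1/2 in τ^(1/2) d/dτ is what makes
-- this fit.
theorem normSq_add_harnack (x : M) :
    normSq (g τ) x (fun v w => Ric (g τ) x v w + Hess (g τ) (φ τ) x v w) +
        1 / 2 * harnack g (Icc a b) τ x (grad (g τ) (φ τ) x) =
      -flowDeriv g φ (Icc a b) (lapScal g φ) τ x - 1 / 2 / τ * lapScal g φ τ x := by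
  have h0 : τ ≠ 0 := (ha.trans_le hτ.1).ne'
  rw [flowDeriv_lapScal hab hτ hg hφ ha hHJ, harnack_grad, lapScal]
  field_simp
  ring

include hab hτ hg hφ ha hHJ in
-- The curvature terms common to the two flow derivatives cancel, and the energy with factor 1/τ
-- absorbs |∇φ|²/(2τ). What is left besides |Ric + Hess φ|² is -(Δφ + R)/τ, the cross term of the
-- square, and n/(4τ²), the squared norm of g/(2τ).
theorem normSq_sub_inner (x : M) :
    normSq (g τ) x (fun v w => Ric (g τ) x v w + Hess (g τ) (φ τ) x v w -
        (g τ).inner x v w / (2 * τ)) =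
      -flowDeriv g φ (Icc a b) (lapScal g φ) τ x +
        flowDeriv g φ (Icc a b) (energyDensity g φ) τ x + 1 / τ * energyDensity g φ τ x -
          3 / 2 / τ * lapScal g φ τ x + n / (4 * τ ^ 2) := by
  have h0 : τ ≠ 0 := (ha.trans_le hτ.1).ne'
  rw [normSq_Ric_add_Hess_sub hab hτ hg hφ x h0, flowDeriv_lapScal hab hτ hg hφ ha hHJ,
    flowDeriv_energyDensity hab hτ hg hφ ha hHJ, energyDensity, lapScal]
  field_simp
  ring

include hab hτ hHJ in
-- The transport term adds |∇φ|² to the -½|∇φ|² of the Hamilton-Jacobi equation.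
theorem flowDeriv_potential (x : M) :
    flowDeriv g φ (Icc a b) φ τ x = energyDensity g φ τ x - 1 / (2 * τ) * φ τ x := by
  have h1 : timeDeriv (Icc a b) φ τ x = _ :=
    (hHJ τ hτ x).derivWithin (uniqueDiffOn_Icc hab τ hτ)
  rw [flowDeriv, h1, energyDensity, innerGradFun]
  ring

variable [T2Space M] [CompactSpace M] [MeasurableSpace M] [BorelSpace M]

theorem entropy_eq_weightedIntegral :
    entropy g ρ = weightedIntegral g ρ fun τ x => Real.log (ρ τ x) := by
  funext τ
  simp only [entropy, weightedIntegral, mul_comm]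

variable (hT : TransportEq g ρ φ (Icc a b)) (hpos : ∀ τ ∈ Icc a b, ∀ x, 0 < ρ τ x)

include hab hτ hg hρ hφ hT hpos in
theorem hasDerivWithinAt_entropy :
    HasDerivWithinAt (entropy g ρ) (-weightedIntegral g ρ (lapScal g φ) τ) (Icc a b) τ := by
  have h1 := hasDerivWithinAt_weightedIntegral hab hτ hg hρ hφ hT (hρ.log hpos)
  rw [entropy_eq_weightedIntegral]
  convert h1 using 1
  simp only [weightedIntegral, flowDeriv_log hab hτ hg hρ hφ hT hpos, neg_mul, integral_neg]

include hab hg hρ hφ hT in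
theorem continuousOn_weightedIntegral {f : ℝ → M → ℝ} (hf : IsSmoothFamily n f (Icc a b)) :
    ContinuousOn (weightedIntegral g ρ f) (Icc a b) := fun _ hτ =>
  (hasDerivWithinAt_weightedIntegral hab hτ hg hρ hφ hT hf).continuousWithinAt

variable (g ρ φ) in
/-- The first derivative of the modified entropy. -/
def modEntropyDeriv (τ : ℝ) : ℝ :=
  -weightedIntegral g ρ (lapScal g φ) τ + (weightedIntegral g ρ (energyDensity g φ) τ -
    1 / (2 * τ) * weightedIntegral g ρ φ τ) + n / 2 * τ⁻¹

variable (a b g ρ φ) in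
/-- The second derivative of the modified entropy. -/
def modEntropyDeriv₂ (τ : ℝ) : ℝ :=
  -weightedIntegral g ρ (flowDeriv g φ (Icc a b) (lapScal g φ)) τ +
    (weightedIntegral g ρ (flowDeriv g φ (Icc a b) (energyDensity g φ)) τ -
      (1 / (2 * τ) * (weightedIntegral g ρ (energyDensity g φ) τ -
        1 / (2 * τ) * weightedIntegral g ρ φ τ) -
          1 / (2 * τ ^ 2) * weightedIntegral g ρ φ τ)) - n / 2 * (τ ^ 2)⁻¹

include hab hτ hg hρ hφ hT hHJ in
theorem hasDerivWithinAt_weightedIntegral_potential :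
    HasDerivWithinAt (weightedIntegral g ρ φ) (weightedIntegral g ρ (energyDensity g φ) τ -
      1 / (2 * τ) * weightedIntegral g ρ φ τ) (Icc a b) τ := by
  convert hasDerivWithinAt_weightedIntegral hab hτ hg hρ hφ hT hφ using 1
  simp only [weightedIntegral, flowDeriv_potential hab hτ hHJ, sub_mul, mul_assoc]
  rw [integral_sub (integrable_weighted hτ hρ (isSmoothFamily_energyDensity hab hg hφ))
    ((integrable_weighted hτ hρ hφ).const_mul _), integral_const_mul]

include hρ hφ hpos in
theorem modEntropy_eq {τ : ℝ} (hτ : τ ∈ Icc a b) :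
    modEntropy g ρ φ τ = entropy g ρ τ + weightedIntegral g ρ φ τ + n / 2 * Real.log τ := by
  rw [modEntropy, integral_add ?_ (integrable_weighted hτ hρ hφ)]
  · rfl
  · simpa only [mul_comm] using integrable_weighted (g := g) hτ hρ (hρ.log hpos)

include hab hτ hg hρ hφ ha hHJ hT hpos in
theorem hasDerivWithinAt_modEntropy :
    HasDerivWithinAt (modEntropy g ρ φ) (modEntropyDeriv g ρ φ τ) (Icc a b) τ := by
  have h0 : τ ≠ 0 := (ha.trans_le hτ.1).ne'
  have h1 := ((hasDerivWithinAt_entropy hab hτ hg hρ hφ hT hpos).add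
    (hasDerivWithinAt_weightedIntegral_potential hab hτ hg hρ hφ hHJ hT)).add
      ((Real.hasDerivAt_log h0).const_mul ((n : ℝ) / 2)).hasDerivWithinAt
  exact h1.congr (fun t ht => modEntropy_eq hρ hφ hpos ht) (modEntropy_eq hρ hφ hpos hτ)

include hab hτ hg hρ hφ ha hHJ hT in
theorem hasDerivWithinAt_modEntropyDeriv :
    HasDerivWithinAt (modEntropyDeriv g ρ φ) (modEntropyDeriv₂ a b g ρ φ τ) (Icc a b) τ := by
  have h0 : τ ≠ 0 := (ha.trans_le hτ.1).ne'
  have h1 : HasDerivAt (fun t : ℝ => 1 / (2 * t)) (-(1 / (2 * τ ^ 2))) τ := by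
    have := ((hasDerivAt_id τ).const_mul 2).fun_inv (mul_ne_zero two_ne_zero h0)
    simp only [id, ← one_div] at this
    refine this.congr_deriv ?_
    field_simp
  have h2 := ((hasDerivWithinAt_weightedIntegral hab hτ hg hρ hφ hT
    (isSmoothFamily_lapScal hab hg hφ)).neg.add
      ((hasDerivWithinAt_weightedIntegral hab hτ hg hρ hφ hT
        (isSmoothFamily_energyDensity hab hg hφ)).sub (h1.hasDerivWithinAt.mul
          (hasDerivWithinAt_weightedIntegral_potential hab hτ hg hρ hφ hHJ hT)))).add
            ((hasDerivAt_inv h0).const_mul ((n : ℝ) / 2)).hasDerivWithinAt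
  refine h2.congr_deriv ?_
  rw [modEntropyDeriv₂]
  ring

include hab hτ hg hρ hφ ha hHJ in
-- The multiples of ∫ φρ cancel: 1/(2τ²) + 1/(4τ²) from the second derivative against -3/(4τ²) from
-- the first. The logarithm contributes -n/(2τ²) + 3n/(4τ²) = n/(4τ²), which matches the constant in
-- the integrand because ρ has total mass 1.
theorem integral_normSq_sub_inner (hprob : ∫ x, ρ τ x ∂dvol (g τ) = 1) :
    ∫ x, normSq (g τ) x (fun v w => Ric (g τ) x v w + Hess (g τ) (φ τ) x v w -
        (g τ).inner x v w / (2 * τ)) * ρ τ x ∂dvol (g τ) =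
      modEntropyDeriv₂ a b g ρ φ τ + 3 / 2 / τ * modEntropyDeriv g ρ φ τ := by
  have h0 : τ ≠ 0 := (ha.trans_le hτ.1).ne'
  have hL := isSmoothFamily_lapScal hab hg hφ
  have hE := isSmoothFamily_energyDensity hab hg hφ
  have i1 := integrable_weighted (g := g) hτ hρ (isSmoothFamily_flowDeriv hab hg hφ hL)
  have i2 := integrable_weighted (g := g) hτ hρ (isSmoothFamily_flowDeriv hab hg hφ hE)
  have i3 := (integrable_weighted (g := g) hτ hρ hE).const_mul (1 / τ)
  have i4 := (integrable_weighted (g := g) hτ hρ hL).const_mul (3 / 2 / τ)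
  have i5 : Integrable (fun x => (n : ℝ) / (4 * τ ^ 2) * ρ τ x) (dvol (g τ)) :=
    (integrable_dvol (g τ) (hρ.continuous hτ)).const_mul _
  simp only [normSq_sub_inner hab hτ hg hφ ha hHJ, add_mul, sub_mul, neg_mul, mul_assoc]
    at i3 i4 ⊢
  simp only [sub_eq_add_neg]
  rw [integral_add (((i1.fun_neg.fun_add i2).fun_add i3).fun_add i4.fun_neg) i5,
    integral_add ((i1.fun_neg.fun_add i2).fun_add i3) i4.fun_neg,
    integral_add (i1.fun_neg.fun_add i2) i3, integral_add i1.fun_neg i2, integral_neg, integral_neg, integral_const_mul,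
    integral_const_mul, integral_const_mul, hprob, modEntropyDeriv₂, modEntropyDeriv]
  simp only [weightedIntegral]
  field_simp
  ring

include hab hτ hg hρ hφ ha hHJ in
theorem integral_normSq_add_harnack :
    ∫ x, (normSq (g τ) x (fun v w => Ric (g τ) x v w + Hess (g τ) (φ τ) x v w) +
        1 / 2 * harnack g (Icc a b) τ x (grad (g τ) (φ τ) x)) * ρ τ x ∂dvol (g τ) =
      -weightedIntegral g ρ (flowDeriv g φ (Icc a b) (lapScal g φ)) τ +
        1 / 2 / τ * -weightedIntegral g ρ (lapScal g φ) τ := by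
  have hL := isSmoothFamily_lapScal hab hg hφ
  have i1 := integrable_weighted (g := g) hτ hρ (isSmoothFamily_flowDeriv hab hg hφ hL)
  have i2 := (integrable_weighted (g := g) hτ hρ hL).const_mul (1 / 2 / τ)
  simp only [normSq_add_harnack hab hτ hg hφ ha hHJ, sub_mul, neg_mul, mul_assoc]
  rw [integral_sub i1.fun_neg i2, integral_neg, integral_const_mul]
  simp only [weightedIntegral]
  ring

include hab hτ hg hρ hφ ha hHJ in
theorem integrable_normSq_add_harnack :
    Integrable (fun x => (normSq (g τ) x (fun v w =>
      Ric (g τ) x v w + Hess (g τ) (φ τ) x v w) +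
        1 / 2 * harnack g (Icc a b) τ x (grad (g τ) (φ τ) x)) * ρ τ x) (dvol (g τ)) := by
  have hL := isSmoothFamily_lapScal hab hg hφ
  have i1 := integrable_weighted (g := g) hτ hρ (isSmoothFamily_flowDeriv hab hg hφ hL)
  have i2 := (integrable_weighted (g := g) hτ hρ hL).const_mul (1 / 2 / τ)
  simp only [normSq_add_harnack hab hτ hg hφ ha hHJ, sub_mul, neg_mul, mul_assoc]
  exact i1.neg.sub i2

include hab hτ hg hρ hφ ha hHJ in
theorem integrable_normSq_sub_inner :
    Integrable (fun x => normSq (g τ) x (fun v w =>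
      Ric (g τ) x v w + Hess (g τ) (φ τ) x v w - (g τ).inner x v w / (2 * τ)) * ρ τ x)
        (dvol (g τ)) := by
  have hL := isSmoothFamily_lapScal hab hg hφ
  have hE := isSmoothFamily_energyDensity hab hg hφ
  have i1 := integrable_weighted (g := g) hτ hρ (isSmoothFamily_flowDeriv hab hg hφ hL)
  have i2 := integrable_weighted (g := g) hτ hρ (isSmoothFamily_flowDeriv hab hg hφ hE)
  have i3 := (integrable_weighted (g := g) hτ hρ hE).const_mul (1 / τ)
  have i4 := (integrable_weighted (g := g) hτ hρ hL).const_mul (3 / 2 / τ)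
  have i5 : Integrable (fun x => (n : ℝ) / (4 * τ ^ 2) * ρ τ x) (dvol (g τ)) :=
    (integrable_dvol (g τ) (hρ.continuous hτ)).const_mul _
  simp only [normSq_sub_inner hab hτ hg hφ ha hHJ, add_mul, sub_mul, neg_mul, mul_assoc]
  exact (((i1.neg.add i2).add i3).sub i4).add i5

include hab hg hρ hφ ha hT in
theorem continuousOn_modEntropyDeriv₂ : ContinuousOn (modEntropyDeriv₂ a b g ρ φ) (Icc a b) := by
  have hL := isSmoothFamily_lapScal hab hg hφ
  have hE := isSmoothFamily_energyDensity hab hg hφ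
  have c1 := continuousOn_weightedIntegral hab hg hρ hφ hT (isSmoothFamily_flowDeriv hab hg hφ hL)
  have c2 := continuousOn_weightedIntegral hab hg hρ hφ hT (isSmoothFamily_flowDeriv hab hg hφ hE)
  have c3 := continuousOn_weightedIntegral hab hg hρ hφ hT hE
  have c4 := continuousOn_weightedIntegral hab hg hρ hφ hT hφ
  have h0 : ∀ t ∈ Icc a b, t ≠ 0 := fun t ht => (ha.trans_le ht.1).ne'
  have h1 : ContinuousOn (fun t : ℝ => 1 / (2 * t)) (Icc a b) :=
    continuousOn_const.div (by fun_prop) fun t ht => mul_ne_zero two_ne_zero (h0 t ht)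
  have h2 : ContinuousOn (fun t : ℝ => 1 / (2 * t ^ 2)) (Icc a b) :=
    continuousOn_const.div (by fun_prop) fun t ht => mul_ne_zero two_ne_zero (pow_ne_zero 2 (h0 t ht))
  have h3 : ContinuousOn (fun t : ℝ => (t ^ 2)⁻¹) (Icc a b) :=
    ContinuousOn.inv₀ (by fun_prop) fun t ht => pow_ne_zero 2 (h0 t ht)
  exact (c1.neg.add (c2.sub ((h1.mul (c3.sub (h1.mul c4))).sub (h2.mul c4)))).sub
    (continuousOn_const.mul h3)

end Entropy

end LMinus

end

theorem corollary7 {n : ℕ} {M : Type*} [TopologicalSpace M] [ChartedSpace (LMinus.E n) M]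
    [IsManifold (𝓡 n) ∞ M] [T2Space M] [CompactSpace M] [ConnectedSpace M]
    [MeasurableSpace M] [BorelSpace M]
    {τ₀ τ₁ : ℝ} (hτ₀ : 0 < τ₀) (hτ : τ₀ < τ₁)
    (g : ℝ → LMinus.Metric n M) (hg : LMinus.IsBackwardRicciFlow g (Icc τ₀ τ₁))
    (ρ φ : ℝ → M → ℝ)
    (hρ_smooth : LMinus.IsSmoothFamily n ρ (Icc τ₀ τ₁))
    (hφ_smooth : LMinus.IsSmoothFamily n φ (Icc τ₀ τ₁))
    (hρ_pos : ∀ τ ∈ Icc τ₀ τ₁, ∀ x, 0 < ρ τ x)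
    (hρ_prob : ∀ τ ∈ Icc τ₀ τ₁, ∫ x, ρ τ x ∂LMinus.dvol (g τ) = 1)
    (hρ : LMinus.TransportEq g ρ φ (Icc τ₀ τ₁))
    (hφ : LMinus.HamiltonJacobiEq g φ (Icc τ₀ τ₁)) :
    -- the integrands below are integrable
    (∀ τ ∈ Icc τ₀ τ₁,
      Integrable (fun x => ρ τ x * Real.log (ρ τ x)) (LMinus.dvol (g τ)) ∧
      Integrable (fun x => φ τ x * ρ τ x) (LMinus.dvol (g τ)) ∧
      Integrable (fun x => (LMinus.normSq (g τ) x (fun v w =>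
          LMinus.Ric (g τ) x v w + LMinus.Hess (g τ) (φ τ) x v w)
        + 1 / 2 * LMinus.harnack g (Icc τ₀ τ₁) τ x (LMinus.grad (g τ) (φ τ) x)) * ρ τ x)
        (LMinus.dvol (g τ)) ∧
      Integrable (fun x => LMinus.normSq (g τ) x (fun v w =>
          LMinus.Ric (g τ) x v w + LMinus.Hess (g τ) (φ τ) x v w
            - (g τ).inner x v w / (2 * τ)) * ρ τ x)
        (LMinus.dvol (g τ))) ∧
    -- the formula with the Harnack expression
    ContDiffOn ℝ 2 (LMinus.entropy g ρ) (Icc τ₀ τ₁) ∧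
    (∀ τ ∈ Icc τ₀ τ₁,
      LMinus.scaledDeriv (1 / 2) (Icc τ₀ τ₁)
          (LMinus.scaledDeriv (1 / 2) (Icc τ₀ τ₁) (LMinus.entropy g ρ)) τ =
        τ * ∫ x, (LMinus.normSq (g τ) x (fun v w =>
            LMinus.Ric (g τ) x v w + LMinus.Hess (g τ) (φ τ) x v w)
          + 1 / 2 * LMinus.harnack g (Icc τ₀ τ₁) τ x (LMinus.grad (g τ) (φ τ) x)) * ρ τ x
          ∂LMinus.dvol (g τ)) ∧
    -- the formula for the modified entropy
    ContDiffOn ℝ 2 (LMinus.modEntropy g ρ φ) (Icc τ₀ τ₁) ∧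
    (∀ τ ∈ Icc τ₀ τ₁,
      LMinus.scaledDeriv (3 / 2) (Icc τ₀ τ₁)
          (LMinus.scaledDeriv (3 / 2) (Icc τ₀ τ₁) (LMinus.modEntropy g ρ φ)) τ =
        τ ^ 3 * ∫ x, LMinus.normSq (g τ) x (fun v w =>
            LMinus.Ric (g τ) x v w + LMinus.Hess (g τ) (φ τ) x v w
              - (g τ).inner x v w / (2 * τ)) * ρ τ x
          ∂LMinus.dvol (g τ)) ∧
    -- convexity in `s = τ ^ (-1/2)`, that is, `τ = (s ^ 2)⁻¹`
    ConvexOn ℝ (Icc (τ₁ ^ (-(1 / 2) : ℝ)) (τ₀ ^ (-(1 / 2) : ℝ)))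
      (fun s => LMinus.modEntropy g ρ φ (s ^ 2)⁻¹) := by
  have hu := uniqueDiffOn_Icc hτ
  have hpos : ∀ t ∈ Icc τ₀ τ₁, 0 < t := fun t ht => hτ₀.trans_le ht.1
  have hL := LMinus.isSmoothFamily_lapScal hτ hg hφ_smooth
  have hE1 : ∀ t ∈ Icc τ₀ τ₁, HasDerivWithinAt (LMinus.entropy g ρ)
      (-LMinus.weightedIntegral g ρ (LMinus.lapScal g φ) t) (Icc τ₀ τ₁) t := fun t ht =>
    LMinus.hasDerivWithinAt_entropy hτ ht hg hρ_smooth hφ_smooth hρ hρ_pos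
  have hE2 : ∀ t ∈ Icc τ₀ τ₁,
      HasDerivWithinAt (fun s => -LMinus.weightedIntegral g ρ (LMinus.lapScal g φ) s)
        (-LMinus.weightedIntegral g ρ
          (LMinus.flowDeriv g φ (Icc τ₀ τ₁) (LMinus.lapScal g φ)) t) (Icc τ₀ τ₁) t := fun t ht =>
    (LMinus.hasDerivWithinAt_weightedIntegral hτ ht hg hρ_smooth hφ_smooth hρ hL).neg
  have hW1 := fun t (ht : t ∈ Icc τ₀ τ₁) =>
    LMinus.hasDerivWithinAt_modEntropy hτ ht hg hρ_smooth hφ_smooth hτ₀ hφ hρ hρ_pos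
  have hW2 := fun t (ht : t ∈ Icc τ₀ τ₁) =>
    LMinus.hasDerivWithinAt_modEntropyDeriv hτ ht hg hρ_smooth hφ_smooth hτ₀ hφ hρ
  have hY := fun t (ht : t ∈ Icc τ₀ τ₁) =>
    LMinus.integral_normSq_sub_inner hτ ht hg hρ_smooth hφ_smooth hτ₀ hφ (hρ_prob t ht)
  refine ⟨fun t ht => ⟨?_, LMinus.integrable_weighted ht hρ_smooth hφ_smooth,
    LMinus.integrable_normSq_add_harnack hτ ht hg hρ_smooth hφ_smooth hτ₀ hφ,
    LMinus.integrable_normSq_sub_inner hτ ht hg hρ_smooth hφ_smooth hτ₀ hφ⟩,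
    LMinus.contDiffOn_two_of_hasDerivWithinAt hu hE1 hE2 ?_, fun t ht => ?_,
    LMinus.contDiffOn_two_of_hasDerivWithinAt hu hW1 hW2
      (LMinus.continuousOn_modEntropyDeriv₂ hτ hg hρ_smooth hφ_smooth hτ₀ hρ), fun t ht => ?_,
    LMinus.convexOn_comp_inv_sq hτ₀ hτ.le hW1 hW2 fun t ht => ?_⟩
  · simpa only [mul_comm] using
      LMinus.integrable_weighted (g := g) ht hρ_smooth (hρ_smooth.log hρ_pos)
  · exact (LMinus.continuousOn_weightedIntegral hτ hg hρ_smooth hφ_smooth hρ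
      (LMinus.isSmoothFamily_flowDeriv hτ hg hφ_smooth hL)).neg
  · rw [LMinus.scaledDeriv_scaledDeriv hu hpos hE1 hE2 _ ht,
      LMinus.integral_normSq_add_harnack hτ ht hg hρ_smooth hφ_smooth hτ₀ hφ]
    norm_num
  · rw [LMinus.scaledDeriv_scaledDeriv hu hpos hW1 hW2 _ ht, hY t ht]
    norm_num
  -- Up to the positive factor τ³, the expression required for convexity is the integral of a
  -- squared norm against a positive density.
  · rw [← hY t ht]
    exact integral_nonneg fun x => mul_nonneg (LMinus.normSq_nonneg _ _ _) (hρ_pos t ht x).le
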